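/- **Setting.** Let $K$ be an algebraically closed field, $n\ge 4$, and let $G=SO_{2n}(K)$ be the group of type $D_n$ of the quadratic form $\sum_{k=1}^n x_kx_{-k}$ on $K^{2n}$, with basis $v_{-n},\dots,v_{-1},v_1,\dots,v_n$, where $v_k$ has weight $e_k$ for the diagonal torus and $e_{-k}=-e_k$. The positive roots are $e_b\pm e_a$ $(1\le a<b\le n)$, with simple roots $\alpha_1=e_1+e_2$ and $\alpha_i=e_i-e_{i-1}$ $(2\le i\le n)$, simple reflections $s_i$ and Borel subgroup $B$; $B^-$ is the opposite Borel subgroup. The fundamental weights are $\omega_1=\frac12(e_1+\dots+e_n)$, $\omega_2=\frac12(-e_1+e_2+\dots+e_n)$ and $\omega_r=e_r+\dots+e_n$ for $3\le r\le n$. Let $P_r$ be the maximal parabolic subgroup generated by $B$ and representatives of the $s_i$, $i\ne r$. Let $W$ be the Weyl group with its Bruhat order $\le$, and let $W^{P_r}$ be the set of $w\in W$ for which $w(\alpha_i)$ is a positive root for all $i\neq r$. For $v,w\in W^{P_r}$ put $X_w^v=\overline{BwP_r/P_r}\cap\overline{B^-vP_r/P_r}\subseteq G/P_r$ (Zariski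 closures). For a weight $\lambda$ write $\lambda\ge 0$ if it is a linear combination of simple roots with nonnegative coefficients, and $\lambda\le0$ if $-\lambda\ge0$. An element $u\in W^{P_r}$ is determined by $u(\omega_r)$. Let $J_{p,[s,t]}$ be the set of integer sequences $\underline i=(i_1,\dots,i_p)$ in $[s,t]$ with $i_{k+1}-i_k\ge2$. For $3\le r\le n-1$ define elements of $W^{P_r}$ by the following conditions. * If $n+1-r=2m$: $v_{\underline i}(\omega_r)=\sum_{k=1}^m\alpha_{i_k}$ for $\underline i\in J_{m,[3,n]}$; and, for $\underline i\in J_{m-1,[4,n]}$ and $a\in\{1,2\}$, $v_{a,\underline i}(\omega_r)=\alpha_a+\sum_{k=1}^{m-1}\alpha_{i_k}$. Moreover $w_{\underline i}(\omega_r)=-v_{\underline i}(\omega_r)$ and $w_{a,\underline i}(\omega_r)=-v_{a,\underline i}(\omega_r)$. * If $n+1-r=2m+1$: $v_{\underline i}(\omega_r)=\frac12\alpha_1+\frac12\alpha_2+\sum_{k=1}^m\alpha_{i_k}$ for $\underline i\in J_{m,[4,n]}$; and, for $\underline i\in J_{m-1,[5,n]}$, $v_{\underline i,1}(\omega_r)=\frac32\alpha_1+\frac12\alpha_2+\alpha_3+\sum_{k=1}^{m-1}\alpha_{i_k}$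 and $v_{\underline i,2}(\omega_r)=\frac12\alpha_1+\frac32\alpha_2+\alpha_3+\sum_{k=1}^{m-1}\alpha_{i_k}$. Moreover $w_{\underline i}(\omega_r)=-v_{\underline i}(\omega_r)$ and $w_{\underline i,a}(\omega_r)=-v_{\underline i,a}(\omega_r)$ for $a\in\{1,2\}$. **Proposition.** Let $1\le r\le n$. Let $v\in W^{P_r}$ be maximal with $v(\omega_r)\ge0$ and let $w\in W^{P_r}$ be minimal with $w(\omega_r)\le0$ (for the Bruhat order). Then $X_w^v\ne\emptyset$ if and only if $v\le w$, and the following hold. (i) Let $3\le r\le n-1$. If $n+1-r=2m$, then $X^v_w\neq\emptyset$ if and only if, for some sequences $\underline i,\underline j$ in the index sets above, $(v,w)$ is one of * $(v_{\underline i},w_{\underline j})$ with $|i_k-j_k|\le1$ for all $1\le k\le m$; * $(v_{\underline i},w_{1,\underline j})$ or $(v_{\underline i},w_{2,\underline j})$ with $i_1=3$ and $|i_{k+1}-j_k|\le1$ for all $1\le k\le m-1$; * $(v_{1,\underline i},w_{\underline j})$ or $(v_{2,\underline i},w_{\underline j})$ with $j_1=3$ and $|i_k-j_{k+1}|\le1$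 for all $1\le k\le m-1$; * $(v_{1,\underline i},w_{1,\underline j})$ or $(v_{2,\underline i},w_{2,\underline j})$ with $|i_k-j_k|\le1$ for all $1\le k\le m-1$. If $n+1-r=2m+1$, then $X^v_w\neq\emptyset$ if and only if, for some sequences $\underline i,\underline j$ in the index sets above, $(v,w)$ is one of * $(v_{\underline i},w_{\underline j})$ with $|i_k-j_k|\le1$ for all $1\le k\le m$; * $(v_{\underline i},w_{\underline j,1})$ or $(v_{\underline i},w_{\underline j,2})$ with $i_1=4$ and $|i_{k+1}-j_k|\le1$ for all $1\le k\le m-1$; * $(v_{\underline i,1},w_{\underline j})$ or $(v_{\underline i,2},w_{\underline j})$ with $j_1=4$ and $|i_k-j_{k+1}|\le1$ for all $1\le k\le m-1$; * $(v_{\underline i,1},w_{\underline j,2})$ or $(v_{\underline i,2},w_{\underline j,1})$ with $|i_k-j_k|\le1$ for all $1\le k\le m-1$. (ii) If $r\in\{1,2,n\}$, then $X_w^v\ne\emptyset$. -/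

import Mathlib

noncomputable section

namespace TypeD

/-! Combinatorics of the Weyl group of type `D_n` -/

/-- The index set `{-n, …, -1, 1, …, n}`, ordered as a subset of the integers. -/
abbrev Idx (n : ℕ) : Type := {x : ℤ // x ∈ (Finset.Icc (-(n : ℤ)) n).erase 0}

/-- The index `-x`. -/
def Idx.opp {n : ℕ} (x : Idx n) : Idx n :=
  ⟨-x.1, by have h := x.2; simp only [Finset.mem_erase, Finset.mem_Icc] at h ⊢; omega⟩

/-- The signed permutation that exchanges `a` with `b` and `-a` with `-b`
(for `b ≠ ±a`); it is the reflection in the root `e_b - e_a`, where `e_{-k} = -e_k`. -/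
def rootRefl {n : ℕ} (a b : Idx n) : Equiv.Perm (Idx n) :=
  Equiv.swap a b * Equiv.swap a.opp b.opp

/-- The simple root with number `i` is `e_b - e_a` for `(a, b) = simplePair i`, where
`e_{-k} = -e_k`; number `1` is the special node, `α_1 = e_1 + e_2` and
`α_i = e_i - e_{i-1}` for `i ≥ 2`. -/
def simplePair (i : ℕ) : ℤ × ℤ := if i = 1 then (-1, 2) else ((i : ℤ) - 1, i)

/-- The set of the simple reflections `s_i` with `1 ≤ i ≤ n` and `i ∈ I`:
`s_1 = (1,-2)(-1,2)` and `s_i = (i-1,i)(-(i-1),-i)` for `i ≥ 2`. -/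
def simpleReflections (n : ℕ) (I : Set ℕ) : Set (Equiv.Perm (Idx n)) :=
  {s | ∃ i ∈ I, 1 ≤ i ∧ i ≤ n ∧ ∃ a b : Idx n, ((a : ℤ), (b : ℤ)) = simplePair i ∧ s = rootRefl a b}

/-- The Weyl group of type `D_n`, as a group of signed permutations of `{±1, …, ±n}`. -/
def weylGroup (n : ℕ) : Subgroup (Equiv.Perm (Idx n)) :=
  Subgroup.closure (simpleReflections n Set.univ)

/-- The length of `w`: the number of positive roots `e_b - e_a` (given by the pairs `a < b` in
`{±1, …, ±n}` with `a + b > 0`) that `w` sends to negative roots. -/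
def length {n : ℕ} (w : weylGroup n) : ℕ :=
  (Finset.univ.filter fun p : Idx n × Idx n =>
    (p.1 : ℤ) < p.2 ∧ 0 < (p.1 : ℤ) + p.2 ∧ (w.1 p.2 : ℤ) < w.1 p.1).card

/-- One step in the Bruhat order: `w = t u` for a reflection `t`, and `ℓ(u) < ℓ(w)`. -/
def BruhatStep {n : ℕ} (u w : weylGroup n) : Prop :=
  (∃ a b : Idx n, (a : ℤ) < b ∧ 0 < (a : ℤ) + b ∧ (w : Equiv.Perm (Idx n)) = rootRefl a b * u) ∧
    length u < length w

/-- The Bruhat order `u ≤ w` on the Weyl group. -/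
def BruhatLE {n : ℕ} : weylGroup n → weylGroup n → Prop :=
  Relation.ReflTransGen BruhatStep

/-! Weights: the vector `∑_{k=1}^n c_k e_k` is the odd function `k ↦ c_k`, `-k ↦ -c_k`
on `{±1, …, ±n}`. -/

/-- The real vector space of functions on `{±1, …, ±n}`, which contains the weights. -/
abbrev Wt (n : ℕ) : Type := Idx n → ℝ

/-- The vector `e_k`, for `k ∈ {±1, …, ±n}`; here `e_{-k} = -e_k`. -/
def e (n : ℕ) (k : ℤ) : Wt n := fun x => if (x : ℤ) = k then 1 else if (x : ℤ) = -k then -1 else 0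

/-- The action of the Weyl group on weights: `w e_k = e_{w(k)}`. -/
def act {n : ℕ} (w : weylGroup n) (l : Wt n) : Wt n := fun x => l (w.1⁻¹ x)

/-- The simple root `α_i`, `1 ≤ i ≤ n`. -/
def simpleRoot (n i : ℕ) : Wt n := e n (simplePair i).2 - e n (simplePair i).1

/-- The set `R⁺` of positive roots `e_b ± e_a`, `1 ≤ a < b ≤ n`. -/
def positiveRoots (n : ℕ) : Set (Wt n) :=
  {β | ∃ a b : Idx n, (a : ℤ) < b ∧ 0 < (a : ℤ) + b ∧ β = e n b - e n a}

/-- The fundamental weight `ω_r`, `1 ≤ r ≤ n`: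
`ω_1 = (e_1 + ⋯ + e_n)/2`, `ω_2 = (-e_1 + e_2 + ⋯ + e_n)/2` and
`ω_r = e_r + ⋯ + e_n` for `r ≥ 3`. -/
def fundamentalWeight (n r : ℕ) : Wt n :=
  if r = 1 then (1 / 2 : ℝ) • ∑ k ∈ Finset.Icc (1 : ℤ) n, e n k
  else if r = 2 then ((1 / 2 : ℝ) • ∑ k ∈ Finset.Icc (1 : ℤ) n, e n k) - e n 1
  else ∑ k ∈ Finset.Icc (r : ℤ) n, e n k

/-- `l ≥ 0`: the weight `l` is a linear combination of simple roots with coefficients `≥ 0`. -/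
def Nonneg {n : ℕ} (l : Wt n) : Prop :=
  ∃ c : ℕ → ℝ, (∀ i, 0 ≤ c i) ∧ l = ∑ i ∈ Finset.Icc 1 n, c i • simpleRoot n i

/-- The set `W^{P_r}` of minimal representatives: `w` makes every simple root other than `α_r`
positive. -/
def minReps (n r : ℕ) : Set (weylGroup n) :=
  {w | ∀ i, 1 ≤ i → i ≤ n → i ≠ r → act w (simpleRoot n i) ∈ positiveRoots n}

/-- `v` is maximal in `W^{P_r}` with the property `v(ω_r) ≥ 0`. -/
def IsMaximalNonneg (n r : ℕ) (v : weylGroup n) : Prop :=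
  v ∈ minReps n r ∧ Nonneg (act v (fundamentalWeight n r)) ∧
    ∀ u ∈ minReps n r, Nonneg (act u (fundamentalWeight n r)) → BruhatLE v u → u = v

/-- `w` is minimal in `W^{P_r}` with the property `w(ω_r) ≤ 0`. -/
def IsMinimalNonpos (n r : ℕ) (w : weylGroup n) : Prop :=
  w ∈ minReps n r ∧ Nonneg (-act w (fundamentalWeight n r)) ∧
    ∀ u ∈ minReps n r, Nonneg (-act u (fundamentalWeight n r)) → BruhatLE u w → u = w

/-! The group, its parabolic subgroups, and Richardson varieties -/

section Geometry

variable (K : Type*) [Field K]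

/-- The orthogonal group of the split quadratic form `∑_{k=1}^n x_k x_{-k}` on `K^{2n}`. -/
def orthogonalGroup (n : ℕ) : Subgroup (Matrix.GeneralLinearGroup (Idx n) K) where
  carrier := {g | ∀ x : Idx n → K,
    (∑ k ∈ Finset.univ.filter (fun k : Idx n => 0 < (k : ℤ)), g.1.mulVec x k * g.1.mulVec x k.opp) =
      ∑ k ∈ Finset.univ.filter (fun k : Idx n => 0 < (k : ℤ)), x k * x k.opp}
  one_mem' := by intro x; simp
  mul_mem' := by
    intro a b ha hb x
    have h := ha (b.1.mulVec x)
    rw [hb x] at h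
    simpa [Matrix.mulVec_mulVec] using h
  inv_mem' := by
    intro a ha x
    have h := ha (a⁻¹.1.mulVec x)
    rw [Matrix.mulVec_mulVec, ← Units.val_mul, mul_inv_cancel, Units.val_one,
      Matrix.one_mulVec] at h
    exact h.symm

/-- The invertible matrices that are block triangular for the ordering `b` of the indices. -/
def triangularGroup (n : ℕ) {α : Type} [LinearOrder α] (b : Idx n → α) :
    Subgroup (Matrix.GeneralLinearGroup (Idx n) K) where
  carrier := {g | g.1.BlockTriangular b}
  one_mem' := Matrix.blockTriangular_one
  mul_mem' := fun ha hb => ha.mul hb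
  inv_mem' := by
    intro a ha
    have : Invertible a.1 := a.invertible
    have h := Matrix.blockTriangular_inv_of_blockTriangular (b := b) (M := a.1) ha
    simpa [Matrix.coe_units_inv] using h

/-- The Borel subgroup `B` of `SO_{2n}`. The basis vector `v_k` of `K^{2n}` has weight `e_k`, so
the root vectors for the positive roots `e_b - e_a`, `a < b`, map `v_a` to `v_b`: the elements of
`B` map each `v_a` into the span of the `v_b` with `b ≥ a`. -/
def borel (n : ℕ) : Subgroup (Matrix.GeneralLinearGroup (Idx n) K) :=
  orthogonalGroup K n ⊓ triangularGroup K n (fun x : Idx n => OrderDual.toDual x)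

/-- The opposite Borel subgroup `B⁻`. -/
def borelOpp (n : ℕ) : Subgroup (Matrix.GeneralLinearGroup (Idx n) K) :=
  orthogonalGroup K n ⊓ triangularGroup K n (fun x : Idx n => x)

/-- The group `G = SO_{2n}` of type `D_n`, in every characteristic: it is the identity component
of the orthogonal group, and it is generated by two opposite Borel subgroups. -/
def group (n : ℕ) : Subgroup (Matrix.GeneralLinearGroup (Idx n) K) :=
  borel K n ⊔ borelOpp K n

/-- The permutation matrix `v_k ↦ v_{w(k)}`. For `w` in the Weyl group it represents `w` in the
normalizer of the diagonal torus. -/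
def permRep {n : ℕ} (w : Equiv.Perm (Idx n)) : Matrix.GeneralLinearGroup (Idx n) K where
  val := Equiv.Perm.permMatrix K w⁻¹
  inv := Equiv.Perm.permMatrix K w
  val_inv := by rw [← Matrix.permMatrix_mul, mul_inv_cancel, Matrix.permMatrix_one]
  inv_val := by rw [← Matrix.permMatrix_mul, inv_mul_cancel, Matrix.permMatrix_one]

/-- The maximal parabolic subgroup `P_r`, generated by `B` and representatives of the simple
reflections `s_i` with `i ≠ r`. -/
def parabolic (n r : ℕ) : Subgroup (Matrix.GeneralLinearGroup (Idx n) K) :=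
  borel K n ⊔ Subgroup.closure (permRep K '' simpleReflections n {i | i ≠ r})

/-- The homogeneous space `G/P_r`. -/
abbrev FlagVariety (n r : ℕ) : Type _ := group K n ⧸ (parabolic K n r).subgroupOf (group K n)

/-- The Zariski topology on the affine space `K^σ`. -/
abbrev zariskiAffine (σ : Type*) : TopologicalSpace (σ → K) :=
  TopologicalSpace.induced (MvPolynomial.pointToPoint (k := K)) inferInstance

/-- The Zariski topology on `G`, a locally closed subvariety of the space of matrices. -/
abbrev zariskiGroup (n : ℕ) : TopologicalSpace (group K n) :=
  TopologicalSpace.induced (fun g => fun p : Idx n × Idx n => g.1.1 p.1 p.2)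
    (zariskiAffine K (Idx n × Idx n))

/-- The Zariski topology on `G/P_r`; it is the quotient topology. -/
abbrev zariskiFlag (n r : ℕ) : TopologicalSpace (FlagVariety K n r) :=
  TopologicalSpace.coinduced (fun g : group K n => (g : FlagVariety K n r)) (zariskiGroup K n)

/-- The orbit `H w P_r / P_r` in `G/P_r`, where `H` is `B` or `B⁻`. -/
def cell (n r : ℕ) (H : Subgroup (Matrix.GeneralLinearGroup (Idx n) K)) (w : weylGroup n) :
    Set (FlagVariety K n r) :=
  {x | ∃ g : group K n, x = (g : FlagVariety K n r) ∧
    ∃ b ∈ H, ∃ p ∈ parabolic K n r, g.1 = b * permRep K w.1 * p}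

/-- The Schubert variety `X_w` in `G/P_r`: the Zariski closure of `B w P_r / P_r`. -/
def schubert (n r : ℕ) (w : weylGroup n) : Set (FlagVariety K n r) :=
  @closure _ (zariskiFlag K n r) (cell K n r (borel K n) w)

/-- The opposite Schubert variety `X^v` in `G/P_r`: the Zariski closure of `B⁻ v P_r / P_r`. -/
def schubertOpp (n r : ℕ) (v : weylGroup n) : Set (FlagVariety K n r) :=
  @closure _ (zariskiFlag K n r) (cell K n r (borelOpp K n) v)

/-- The Richardson variety `X_w^v` in `G/P_r`. -/
def richardson (n r : ℕ) (v w : weylGroup n) : Set (FlagVariety K n r) :=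
  schubert K n r w ∩ schubertOpp K n r v

end Geometry

/-! The families of maximal `v` and minimal `w`. An element `u` of `W^{P_r}` is determined by the
weight `u(ω_r)`; the families are described by these weights. -/

/-- The set `J_{p,[s,t]}` of the sequences `(i_1, …, i_p)` in `[s,t]` with `i_{k+1} - i_k ≥ 2`. -/
def J (p s t : ℕ) : Set (Fin p → ℕ) :=
  {i | (∀ k, s ≤ i k ∧ i k ≤ t) ∧ ∀ k l : Fin p, (l : ℕ) = k + 1 → i k + 2 ≤ i l}

/-- `∑_k α_{i_k}`. -/
def rootSum (n : ℕ) {p : ℕ} (i : Fin p → ℕ) : Wt n := ∑ k, simpleRoot n (i k)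

/-- `½ α_1 + ½ α_2 + ∑_k α_{i_k}`. -/
def wtHalf (n : ℕ) {p : ℕ} (i : Fin p → ℕ) : Wt n :=
  (1 / 2 : ℝ) • simpleRoot n 1 + (1 / 2 : ℝ) • simpleRoot n 2 + rootSum n i

/-- `3/2 α_1 + ½ α_2 + α_3 + ∑_k α_{i_k}`. -/
def wtHalf1 (n : ℕ) {p : ℕ} (i : Fin p → ℕ) : Wt n :=
  (3 / 2 : ℝ) • simpleRoot n 1 + (1 / 2 : ℝ) • simpleRoot n 2 + simpleRoot n 3 + rootSum n i

/-- `½ α_1 + 3/2 α_2 + α_3 + ∑_k α_{i_k}`. -/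
def wtHalf2 (n : ℕ) {p : ℕ} (i : Fin p → ℕ) : Wt n :=
  (1 / 2 : ℝ) • simpleRoot n 1 + (3 / 2 : ℝ) • simpleRoot n 2 + simpleRoot n 3 + rootSum n i

/-- `u` is the element of `W^{P_r}` with `u(ω_r) = l`. -/
def HasWt (n r : ℕ) (u : weylGroup n) (l : Wt n) : Prop :=
  u ∈ minReps n r ∧ act u (fundamentalWeight n r) = l

/-- `|i_k - j_k| ≤ 1` for all `k`. -/
def Near {p : ℕ} (i j : Fin p → ℕ) : Prop := ∀ k, |(i k : ℤ) - j k| ≤ 1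

/-- The list of pairs for `(n+1) - r = 2m`, where `m = p + 1`. The sequence `Fin.tail i` is
`(i_2, …, i_m)`. -/
def EvenList (n r p : ℕ) (v w : weylGroup n) : Prop :=
  (∃ i ∈ J (p + 1) 3 n, ∃ j ∈ J (p + 1) 3 n,
    HasWt n r v (rootSum n i) ∧ HasWt n r w (-rootSum n j) ∧ Near i j) ∨
  (∃ i ∈ J (p + 1) 3 n, ∃ j ∈ J p 4 n,
    HasWt n r v (rootSum n i) ∧
    (HasWt n r w (-(simpleRoot n 1 + rootSum n j)) ∨
      HasWt n r w (-(simpleRoot n 2 + rootSum n j))) ∧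
    Near (Fin.tail i) j ∧ i 0 = 3) ∨
  (∃ i ∈ J p 4 n, ∃ j ∈ J (p + 1) 3 n,
    (HasWt n r v (simpleRoot n 1 + rootSum n i) ∨ HasWt n r v (simpleRoot n 2 + rootSum n i)) ∧
    HasWt n r w (-rootSum n j) ∧
    Near i (Fin.tail j) ∧ j 0 = 3) ∨
  (∃ i ∈ J p 4 n, ∃ j ∈ J p 4 n,
    ((HasWt n r v (simpleRoot n 1 + rootSum n i) ∧
        HasWt n r w (-(simpleRoot n 1 + rootSum n j))) ∨
      (HasWt n r v (simpleRoot n 2 + rootSum n i) ∧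
        HasWt n r w (-(simpleRoot n 2 + rootSum n j)))) ∧
    Near i j)

/-- The list of pairs for `(n+1) - r = 2m + 1`, where `m = p + 1`. The elements `w_{j,1}` and
`w_{j,2}` are those that send `ω_r` to `-wtHalf1 n j` and `-wtHalf2 n j`. -/
def OddList (n r p : ℕ) (v w : weylGroup n) : Prop :=
  (∃ i ∈ J (p + 1) 4 n, ∃ j ∈ J (p + 1) 4 n,
    HasWt n r v (wtHalf n i) ∧ HasWt n r w (-wtHalf n j) ∧ Near i j) ∨
  (∃ i ∈ J (p + 1) 4 n, ∃ j ∈ J p 5 n,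
    HasWt n r v (wtHalf n i) ∧
    (HasWt n r w (-wtHalf1 n j) ∨ HasWt n r w (-wtHalf2 n j)) ∧
    Near (Fin.tail i) j ∧ i 0 = 4) ∨
  (∃ i ∈ J p 5 n, ∃ j ∈ J (p + 1) 4 n,
    (HasWt n r v (wtHalf1 n i) ∨ HasWt n r v (wtHalf2 n i)) ∧
    HasWt n r w (-wtHalf n j) ∧
    Near i (Fin.tail j) ∧ j 0 = 4) ∨
  (∃ i ∈ J p 5 n, ∃ j ∈ J p 5 n,
    ((HasWt n r v (wtHalf1 n i) ∧ HasWt n r w (-wtHalf2 n j)) ∨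
      (HasWt n r v (wtHalf2 n i) ∧ HasWt n r w (-wtHalf1 n j))) ∧
    Near i j)

end TypeD

end

noncomputable section

/-! ### Signed permutations, reflections and length. -/

section

namespace TypeD

variable {n : ℕ}

/-! Geometry. The intersection of `X_w` and `X^v` is nonempty exactly when `v ≤ w`
(`richardson_nonempty_iff`). If `v ≤ w`, the point `v` lies in both varieties: a curve in a root
subgroup shows that each Bruhat step stays in the closure of the larger cell
(`permRep_mem_closure_cell_rf`). The converse is an induction on `ℓ(w)`
(`bruhatLE_of_mem_closures`). Let `sw < w` for a simple reflection `s`. Since `P_s/B` is a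
projective line, hence complete (`mem_of_mem_zariskiClosure_projection`), `X_w` lies in `P_s
X_{sw}`. So a common point of `X_w` and `X^v` is moved into `X_{sw}` by `s` or by an element of the
root subgroup of `-α`. These preserve `X^v` if `sv > v`; otherwise they preserve `X^{sv}`, which
contains `X^v`, and the lifting property of the Bruhat order finishes the step. For `w = 1` a minor
of the matrix is nonzero on the closure of `B P_r`, but vanishes on `X^v` unless `v = 1`.

Weights. Because `v` is a minimal representative, `v ≤ w` holds if and only if `w(ω_r)` is reached
from `v(ω_r)` by reflections each of which lowers the weight or fixes it (`bruhatLE_iff_chain`).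
Maximality of `v`, tested with simple reflections only, forces `v(ω_r)` to be a short initial part
plus a sum of simple roots with gaps at least 2 (`LocallyMaximal.hasForm`); the same holds for
`-w(ω_r)`. The sum of the squares of the coordinates is invariant and fixes the number of roots and
the type of the initial part.

Chains. Along a chain the sums over `[t, n]` of the positive parts of the coordinates decrease, and
those of the negative parts increase. Roots with gaps have disjoint supports, so these sums count
the `i_k` that are `≥ t` or `> t`; comparison gives `|i_k - j_k| ≤ 1` (`Chain.near`,
`Chain.near_tail`). If the sums beyond the initial part agree at both ends, the product of the
initial coordinates is preserved (`Chain.prod_eq`), which separates the labels 1 and 2. Conversely,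
exchanging the coordinates `a - 1` and `a`, or `a - 1` and `a + 1`, turns `α_a` into `-α_a` or
`-α_{a+1}` (`chain_rtSum`), and the initial parts are joined by explicit chains.

For `r ≤ 2` all coordinates are nonzero, so the sequence is forced, and the invariant product of all
coordinates matches the initial parts. For `r = n` the two weights are `e_2` and `-e_2`. -/

lemma Idx.ne_zero (x : Idx n) : (x : ℤ) ≠ 0 := by
  have h := x.2
  simp only [Finset.mem_erase, Finset.mem_Icc] at h
  exact h.1

lemma Idx.le_n (x : Idx n) : (x : ℤ) ≤ n := by
  have h := x.2
  simp only [Finset.mem_erase, Finset.mem_Icc] at h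
  exact h.2.2

lemma Idx.neg_n_le (x : Idx n) : -(n : ℤ) ≤ x := by
  have h := x.2
  simp only [Finset.mem_erase, Finset.mem_Icc] at h
  exact h.2.1

/-- The index with value `k`. -/
def Idx.mk' (k : ℤ) (h0 : k ≠ 0) (h1 : -(n : ℤ) ≤ k) (h2 : k ≤ n) : Idx n :=
  ⟨k, by simp only [Finset.mem_erase, Finset.mem_Icc]; exact ⟨h0, h1, h2⟩⟩

@[simp] lemma Idx.coe_mk' (k : ℤ) (h0 : k ≠ 0) (h1 : -(n : ℤ) ≤ k) (h2 : k ≤ n) :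
    ((Idx.mk' k h0 h1 h2 : Idx n) : ℤ) = k := rfl

@[simp] lemma Idx.coe_opp (x : Idx n) : (x.opp : ℤ) = -x := rfl

@[simp] lemma Idx.opp_opp (x : Idx n) : x.opp.opp = x := Subtype.ext (by simp)

lemma Idx.opp_ne (x : Idx n) : x.opp ≠ x := fun h => by
  have := congrArg Subtype.val h
  have h0 := x.ne_zero
  simp only [Idx.coe_opp] at this
  omega

lemma Idx.opp_inj {x y : Idx n} : x.opp = y.opp ↔ x = y :=
  ⟨fun h => by simpa using congrArg Idx.opp h, fun h => h ▸ rfl⟩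

lemma Idx.ext_iff' {x y : Idx n} : x = y ↔ (x : ℤ) = y := Subtype.ext_iff

lemma coe_rootRefl {a b : Idx n} (h1 : (a : ℤ) ≠ b) (h2 : (a : ℤ) ≠ -b) (x : Idx n) :
    (rootRefl a b x : ℤ) = if (x : ℤ) = a then (b : ℤ) else if (x : ℤ) = b then (a : ℤ) else
      if (x : ℤ) = -a then -(b : ℤ) else if (x : ℤ) = -b then -(a : ℤ) else x := by
  have ha := a.ne_zero
  have hb := b.ne_zero
  simp only [rootRefl, Equiv.Perm.mul_apply, Equiv.swap_apply_def, Idx.ext_iff']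
  split_ifs <;> simp only [Idx.coe_opp] at * <;> omega

/-- The degenerate pairs `b = ±a` give the identity. Therefore `rootRefl a b` lies in the Weyl group
for all `a`, `b`, and `rf` needs no hypothesis. -/
lemma rootRefl_self (a : Idx n) : rootRefl a a = 1 := by simp [rootRefl]; rfl

lemma rootRefl_opp (a : Idx n) : rootRefl a a.opp = 1 := by
  rw [rootRefl, Idx.opp_opp, Equiv.swap_comm a.opp a, Equiv.swap_mul_self]

/-- A permutation of the indices that commutes with `x ↦ -x`. -/
def IsOdd (w : Equiv.Perm (Idx n)) : Prop := ∀ x, w x.opp = (w x).opp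

lemma IsOdd.one : IsOdd (1 : Equiv.Perm (Idx n)) := fun _ => rfl

lemma IsOdd.mul {v w : Equiv.Perm (Idx n)} (hv : IsOdd v) (hw : IsOdd w) : IsOdd (v * w) :=
  fun x => by rw [Equiv.Perm.mul_apply, hw, hv]; rfl

lemma IsOdd.inv {v : Equiv.Perm (Idx n)} (hv : IsOdd v) : IsOdd v⁻¹ := fun x => by
  apply v.injective
  rw [hv]; simp

lemma isOdd_rootRefl (a b : Idx n) : IsOdd (rootRefl a b) := by
  intro x
  by_cases h1 : (a : ℤ) = b
  · rw [← Idx.ext_iff'] at h1; subst h1; simp [rootRefl_self]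
  by_cases h2 : (a : ℤ) = -b
  · have : b = a.opp := by rw [Idx.ext_iff']; simp [h2]
    subst this; simp [rootRefl_opp]
  rw [Idx.ext_iff', Idx.coe_opp, coe_rootRefl h1 h2, coe_rootRefl h1 h2]
  have ha := a.ne_zero
  have hb := b.ne_zero
  have hx := x.ne_zero
  simp only [Idx.coe_opp]
  split_ifs <;> omega

lemma IsOdd.coe {w : Equiv.Perm (Idx n)} (h : IsOdd w) (x : Idx n) :
    (w x.opp : ℤ) = -(w x : ℤ) := by rw [h]; rfl

/-- All signed permutations in the Weyl group commute with `x ↦ -x` and are even permutations. -/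
lemma weylGroup_isOdd_sign (w : weylGroup n) : IsOdd w.1 ∧ Equiv.Perm.sign w.1 = 1 := by
  obtain ⟨w, hw⟩ := w
  induction hw using Subgroup.closure_induction with
  | mem x hx =>
    obtain ⟨i, -, hi1, hi2, a, b, hab, rfl⟩ := hx
    refine ⟨isOdd_rootRefl a b, ?_⟩
    have hab' : a ≠ b ∧ a.opp ≠ b.opp := by
      rw [ne_eq, ne_eq, Idx.opp_inj, and_self, Idx.ext_iff']
      simp only [simplePair] at hab
      split_ifs at hab <;> simp only [Prod.mk.injEq] at hab <;> omega
    simp [rootRefl, Equiv.Perm.sign_mul, Equiv.Perm.sign_swap hab'.1, Equiv.Perm.sign_swap hab'.2]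
  | one => exact ⟨IsOdd.one, by simp⟩
  | mul x y hx hy h1 h2 => exact ⟨h1.1.mul h2.1, by simp_all⟩
  | inv x hx h => exact ⟨h.1.inv, by simp_all⟩

lemma weylGroup_isOdd (w : weylGroup n) : IsOdd w.1 := (weylGroup_isOdd_sign w).1

lemma rootRefl_comm (a b : Idx n) : rootRefl a b = rootRefl b a := by
  rw [rootRefl, rootRefl, Equiv.swap_comm, Equiv.swap_comm a.opp]

lemma rootRefl_opp_opp {a b : Idx n} (h1 : (a : ℤ) ≠ b) (h2 : (a : ℤ) ≠ -b) :
    rootRefl a.opp b.opp = rootRefl a b := by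
  ext x
  rw [coe_rootRefl h1 h2, coe_rootRefl (by simpa using h1) (by simp; omega)]
  have ha := a.ne_zero
  have hb := b.ne_zero
  simp only [Idx.coe_opp]
  split_ifs <;> omega

lemma conj_rootRefl {w : Equiv.Perm (Idx n)} (hw : IsOdd w) (a b : Idx n) :
    w * rootRefl a b * w⁻¹ = rootRefl (w a) (w b) := by
  rw [rootRefl, rootRefl, ← hw, ← hw, Equiv.swap_apply_apply, Equiv.swap_apply_apply]
  group

lemma rootRefl_mul_self (a b : Idx n) : rootRefl a b * rootRefl a b = 1 := by
  by_cases h1 : (a : ℤ) = b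
  · rw [← Idx.ext_iff'] at h1; subst h1; simp [rootRefl_self]
  by_cases h2 : (a : ℤ) = -b
  · have : b = a.opp := by rw [Idx.ext_iff']; simp [h2]
    subst this; simp [rootRefl_opp]
  ext x
  rw [Equiv.Perm.mul_apply, coe_rootRefl h1 h2, coe_rootRefl h1 h2, Equiv.Perm.one_apply]
  have ha := a.ne_zero
  have hb := b.ne_zero
  split_ifs <;> omega

lemma mem_weylGroup_of_conj {w : Equiv.Perm (Idx n)} (hw : w ∈ weylGroup n) {a b : Idx n}
    (h : rootRefl (w a) (w b) ∈ weylGroup n) : rootRefl a b ∈ weylGroup n := by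
  rw [← conj_rootRefl (weylGroup_isOdd ⟨w, hw⟩)] at h
  simpa [mul_assoc] using mul_mem (mul_mem (inv_mem hw) h) hw

lemma simple_mem_weylGroup {i : ℕ} (h1 : 1 ≤ i) (hn : i ≤ n) {a b : Idx n}
    (hab : ((a : ℤ), (b : ℤ)) = simplePair i) : rootRefl a b ∈ weylGroup n :=
  Subgroup.subset_closure ⟨i, Set.mem_univ _, h1, hn, a, b, hab, rfl⟩

/-- Induction on the difference `b - a`. If the root is not simple, conjugation with a simple
reflection raises `a` or lowers `b` by one and keeps `|a| < b`. -/
lemma rootRefl_mem_of_pos (m : ℕ) : ∀ a b : Idx n, |(a : ℤ)| < b → (b : ℤ) - a ≤ m →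
    rootRefl a b ∈ weylGroup n := by
  induction m with
  | zero => intro a b h1 h2; have := le_abs_self (a : ℤ); omega
  | succ m ih =>
    intro a b h1 h2
    have ha := a.ne_zero
    have hbn := b.le_n
    rw [abs_lt] at h1
    by_cases hadj : (b : ℤ) = a + 1
    · have hb2 : 2 ≤ (b : ℤ) := by omega
      refine simple_mem_weylGroup (i := (b : ℤ).toNat) (by omega) (by omega) ?_
      have : (b : ℤ).toNat ≠ 1 := by omega
      simp only [simplePair, this, if_false, Prod.mk.injEq]
      omega
    by_cases hsp : (a : ℤ) = -1 ∧ (b : ℤ) = 2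
    · exact simple_mem_weylGroup (i := 1) le_rfl (by omega) (by simp [simplePair, hsp])
    rcases lt_or_ge (a : ℤ) (-1) with ha1 | ha1
    · -- conjugate by the simple reflection of `(-a - 1, -a)`
      let c : Idx n := Idx.mk' (-a - 1) (by omega) (by omega) (by omega)
      have hc : (c : ℤ) = -a - 1 := rfl
      have hs : rootRefl c a.opp ∈ weylGroup n := by
        refine simple_mem_weylGroup (i := (-a : ℤ).toNat) (by omega) (by omega) ?_
        have : (-a : ℤ).toNat ≠ 1 := by omega
        simp only [simplePair, this, if_false, Prod.mk.injEq, hc, Idx.coe_opp]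
        omega
      apply mem_weylGroup_of_conj hs
      have e1 : rootRefl c a.opp b = b := by
        rw [Idx.ext_iff', coe_rootRefl (by simp [hc]) (by simp [hc]; omega)]
        simp only [hc, Idx.coe_opp]; split_ifs <;> omega
      have e2 : (rootRefl c a.opp a : ℤ) = a + 1 := by
        rw [coe_rootRefl (by simp [hc]) (by simp [hc]; omega)]
        simp only [hc, Idx.coe_opp]; split_ifs <;> omega
      rw [e1]
      apply ih _ _ (by rw [e2, abs_lt]; omega) (by rw [e2]; omega)
    · let c : Idx n := Idx.mk' (b - 1) (by omega) (by omega) (by omega)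
      have hc : (c : ℤ) = b - 1 := rfl
      have hs : rootRefl c b ∈ weylGroup n := by
        refine simple_mem_weylGroup (i := (b : ℤ).toNat) (by omega) (by omega) ?_
        have : (b : ℤ).toNat ≠ 1 := by omega
        simp only [simplePair, this, if_false, Prod.mk.injEq, hc]
        omega
      apply mem_weylGroup_of_conj hs
      have e1 : rootRefl c b a = a := by
        rw [Idx.ext_iff', coe_rootRefl (by simp [hc]) (by simp [hc]; omega)]
        simp only [hc]; split_ifs <;> omega
      have e2 : (rootRefl c b b : ℤ) = b - 1 := by
        rw [coe_rootRefl (by simp [hc]) (by simp [hc]; omega)]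
        simp only [hc]; split_ifs <;> omega
      rw [e1]
      apply ih _ _ (by rw [e2, abs_lt]; omega) (by rw [e2]; omega)

lemma rootRefl_mem (a b : Idx n) : rootRefl a b ∈ weylGroup n := by
  by_cases h1 : (a : ℤ) = b
  · rw [← Idx.ext_iff'] at h1; subst h1; simp [rootRefl_self]
  by_cases h2 : (a : ℤ) = -b
  · have : b = a.opp := by rw [Idx.ext_iff']; simp [h2]
    subst this; simp [rootRefl_opp]
  have key : ∀ a b : Idx n, |(a : ℤ)| < b → rootRefl a b ∈ weylGroup n := fun a b h =>
    rootRefl_mem_of_pos _ a b h (Int.self_le_toNat _)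
  have ha := a.ne_zero
  have hb := b.ne_zero
  rcases lt_trichotomy |(a : ℤ)| |(b : ℤ)| with h | h | h
  · rcases lt_or_gt_of_ne hb with hb | hb
    · rw [← rootRefl_opp_opp h1 h2]
      exact key _ _ (by simp only [Idx.coe_opp, abs_neg]; rwa [abs_of_neg hb] at h)
    · exact key _ _ (by rwa [abs_of_pos hb] at h)
  · rw [abs_eq_abs] at h; omega
  · rw [rootRefl_comm]
    rcases lt_or_gt_of_ne ha with ha | ha
    · rw [← rootRefl_opp_opp (Ne.symm h1) (by omega)]
      exact key _ _ (by simp only [Idx.coe_opp, abs_neg]; rwa [abs_of_neg ha] at h)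
    · exact key _ _ (by rwa [abs_of_pos ha] at h)

/-- The reflection in `e_b - e_a`, as an element of the Weyl group. -/
def rf (a b : Idx n) : weylGroup n := ⟨rootRefl a b, rootRefl_mem a b⟩

@[simp] lemma coe_rf (a b : Idx n) : (rf a b : Equiv.Perm (Idx n)) = rootRefl a b := rfl

@[simp] lemma rf_mul_self (a b : Idx n) : rf a b * rf a b = 1 :=
  Subtype.ext (rootRefl_mul_self a b)

@[simp] lemma rf_mul_cancel (a b : Idx n) (w : weylGroup n) : rf a b * (rf a b * w) = w := by
  rw [← mul_assoc, rf_mul_self, one_mul]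

lemma conj_rf (w : weylGroup n) (a b : Idx n) : w * rf a b * w⁻¹ = rf (w.1 a) (w.1 b) :=
  Subtype.ext (conj_rootRefl (weylGroup_isOdd w) a b)

@[simp] lemma coe_inv_apply (w : Equiv.Perm (Idx n)) (x : Idx n) : w (w⁻¹ x) = x :=
  w.apply_symm_apply x

@[simp] lemma inv_coe_apply (w : Equiv.Perm (Idx n)) (x : Idx n) : w⁻¹ (w x) = x :=
  w.symm_apply_apply x

lemma rf_mul (w : weylGroup n) (a b : Idx n) :
    rf a b * w = w * rf (w.1⁻¹ a) (w.1⁻¹ b) := by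
  have := conj_rf w (w.1⁻¹ a) (w.1⁻¹ b)
  rw [coe_inv_apply, coe_inv_apply] at this
  rw [← this]; group

/-! Length and reflections -/

/-- The inversions of `w`. -/
def inversions (w : Equiv.Perm (Idx n)) : Finset (Idx n × Idx n) :=
  Finset.univ.filter fun p => (p.1 : ℤ) < p.2 ∧ (p.1 : ℤ) + p.2 ≠ 0 ∧ (w p.2 : ℤ) < w p.1

lemma mem_inversions {w : Equiv.Perm (Idx n)} {x y : Idx n} : (x, y) ∈ inversions w ↔
    (x : ℤ) < y ∧ (x : ℤ) + y ≠ 0 ∧ (w y : ℤ) < w x := by simp [inversions]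

/-- Every root `e_y - e_x` is given by the two pairs `(x, y)` and `(-y, -x)`, of which exactly one
has positive sum. Counting both makes the set of inversions independent of the condition `x + y >
0`, which a reflection need not respect. -/
lemma card_inversions (w : weylGroup n) : (inversions w.1).card = 2 * length w := by
  have hodd := weylGroup_isOdd w
  have hsplit : inversions w.1 = (Finset.univ.filter fun p : Idx n × Idx n =>
      (p.1 : ℤ) < p.2 ∧ 0 < (p.1 : ℤ) + p.2 ∧ (w.1 p.2 : ℤ) < w.1 p.1) ∪
      (Finset.univ.filter fun p : Idx n × Idx n =>
      (p.1 : ℤ) < p.2 ∧ (p.1 : ℤ) + p.2 < 0 ∧ (w.1 p.2 : ℤ) < w.1 p.1) := by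
    ext p
    simp only [inversions, Finset.mem_filter, Finset.mem_univ, true_and, Finset.mem_union]
    omega
  rw [hsplit, Finset.card_union_of_disjoint, length, two_mul]
  · congr 1
    refine Finset.card_bij' (fun p _ => (p.2.opp, p.1.opp)) (fun p _ => (p.2.opp, p.1.opp))
      ?_ ?_ ?_ ?_
    · intro p hp
      simp only [Finset.mem_filter, Finset.mem_univ, true_and, Idx.coe_opp, hodd.coe] at hp ⊢
      omega
    · intro p hp
      simp only [Finset.mem_filter, Finset.mem_univ, true_and, Idx.coe_opp, hodd.coe] at hp ⊢
      omega
    · intro p _; simp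
    · intro p _; simp
  · rw [Finset.disjoint_filter]
    intro p _ h1 h2
    omega

/-- Put `β = e_y - e_x` and `γ = e_d - e_c`. The reflection `t` in `γ` makes the positive root `β`
negative, so `tβ = β - mγ` with `m > 0`. As `wβ` is negative and `wγ` positive, `wtβ = wβ - m wγ` is
negative. The proof checks this on the positions of `x` and `y` among `±c`, `±d`. -/
lemma rootRefl_flip {w : Equiv.Perm (Idx n)} (hw : IsOdd w) {c d : Idx n} (h : (c : ℤ) < d)
    (h' : (c : ℤ) + d ≠ 0) (hcd : (w c : ℤ) < w d) {x y : Idx n} (hxy : (x : ℤ) < y)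
    (hxy' : (x : ℤ) + y ≠ 0) (hf : (rootRefl c d y : ℤ) < rootRefl c d x)
    (hi : (w y : ℤ) < w x) : (w (rootRefl c d y) : ℤ) < w (rootRefl c d x) := by
  have key : ∀ z : Idx n, (z = c ∧ rootRefl c d z = d) ∨ (z = d ∧ rootRefl c d z = c) ∨
      (z = c.opp ∧ rootRefl c d z = d.opp) ∨ (z = d.opp ∧ rootRefl c d z = c.opp) ∨
      rootRefl c d z = z := by
    intro z
    simp only [Idx.ext_iff', coe_rootRefl (a := c) (b := d) (by omega) (by omega), Idx.coe_opp]
    have hc := c.ne_zero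
    have hd := d.ne_zero
    split_ifs <;> omega
  rcases key x with ⟨hx, hx'⟩ | ⟨hx, hx'⟩ | ⟨hx, hx'⟩ | ⟨hx, hx'⟩ | hx' <;>
  rcases key y with ⟨hy, hy'⟩ | ⟨hy, hy'⟩ | ⟨hy, hy'⟩ | ⟨hy, hy'⟩ | hy' <;>
  rw [hx', hy'] at hf <;> rw [hx', hy'] <;> (try subst hx) <;> (try subst hy) <;>
  (try simp only [hw.coe, Idx.coe_opp] at *) <;> omega

/-- For `t = rf c d`, the inversions of `w` inject into those of `w t`: a pair goes to its image
under `t` if this image is still increasing, and to itself otherwise (by `rootRefl_flip`). The pair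
`(c, d)` is an inversion of `w t` outside the image, hence the strict inequality. -/
lemma length_lt_mul_rf (w : weylGroup n) {c d : Idx n} (h : (c : ℤ) < d) (h' : (c : ℤ) + d ≠ 0)
    (hcd : (w.1 c : ℤ) < w.1 d) : length w < length (w * rf c d) := by
  have hw := weylGroup_isOdd w
  have ht := isOdd_rootRefl c d
  have htt : ∀ x, rootRefl c d (rootRefl c d x) = x := fun x => by
    rw [← Equiv.Perm.mul_apply, rootRefl_mul_self]; rfl
  have tc : rootRefl c d c = d := by
    rw [Idx.ext_iff', coe_rootRefl (by omega) (by omega), if_pos rfl]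
  have td : rootRefl c d d = c := by
    have := htt c
    rwa [tc] at this
  suffices (inversions w.1).card < (inversions (w * rf c d).1).card by
    rw [card_inversions, card_inversions] at this; omega
  have hγ : (c, d) ∈ inversions (w * rf c d).1 := by
    rw [mem_inversions, Subgroup.coe_mul, coe_rf, Equiv.Perm.mul_apply, Equiv.Perm.mul_apply, tc, td]
    exact ⟨h, h', hcd⟩
  have hsum : ∀ x y : Idx n, (x : ℤ) + y ≠ 0 →
      (rootRefl c d x : ℤ) + rootRefl c d y ≠ 0 := fun x y hxy h0 => hxy <| by
    have : rootRefl c d x = rootRefl c d y.opp := by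
      rw [ht, Idx.ext_iff', Idx.coe_opp]; omega
    have := (rootRefl c d).injective this
    rw [Idx.ext_iff', Idx.coe_opp] at this; omega
  rw [← Nat.succ_le_iff, ← Finset.card_erase_add_one hγ, Nat.succ_le_succ_iff]
  refine Finset.card_le_card_of_injOn (fun p =>
    if (rootRefl c d p.1 : ℤ) < rootRefl c d p.2 then (rootRefl c d p.1, rootRefl c d p.2) else p)
    ?_ ?_
  · rintro ⟨x, y⟩ hp
    rw [Finset.mem_coe, mem_inversions] at hp
    obtain ⟨hxy, hxy', hi⟩ := hp
    rw [Finset.mem_coe, Finset.mem_erase]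
    dsimp only
    split_ifs with hc
    · refine And.symm ⟨?_, ?_⟩
      · rw [mem_inversions, Subgroup.coe_mul, coe_rf, Equiv.Perm.mul_apply, Equiv.Perm.mul_apply,
          htt, htt]
        exact ⟨hc, hsum _ _ hxy', hi⟩
      · intro he
        rw [Prod.mk.injEq] at he
        have e1 := congrArg (rootRefl c d) he.1
        have e2 := congrArg (rootRefl c d) he.2
        rw [htt, tc] at e1
        rw [htt, td] at e2
        subst e1 e2
        omega
    · have hne : (rootRefl c d x : ℤ) ≠ rootRefl c d y := fun he => by
        have := (rootRefl c d).injective (Subtype.ext he)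
        subst this; omega
      refine And.symm ⟨?_, ?_⟩
      · rw [mem_inversions, Subgroup.coe_mul, coe_rf, Equiv.Perm.mul_apply, Equiv.Perm.mul_apply]
        exact ⟨hxy, hxy', rootRefl_flip hw h h' hcd hxy hxy' (by omega) hi⟩
      · intro he
        rw [Prod.mk.injEq] at he
        obtain ⟨rfl, rfl⟩ := he
        omega
  · rintro ⟨x, y⟩ hp ⟨x', y'⟩ hp' he
    rw [Finset.mem_coe, mem_inversions] at hp hp'
    simp only at he
    split_ifs at he with h1 h2 h2
    · rw [Prod.mk.injEq] at he
      rw [(rootRefl c d).injective he.1, (rootRefl c d).injective he.2]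
    · rw [Prod.mk.injEq] at he
      rw [← he.1, ← he.2, htt, htt] at h2
      omega
    · rw [Prod.mk.injEq] at he
      rw [he.1, he.2, htt, htt] at h1
      omega
    · exact he

end TypeD

end

section

namespace TypeD

variable {n : ℕ}

/-! Simple roots, positive roots, minimal representatives -/

/-- The simple root with number `i` is `e_b - e_a`. -/
def IsSimplePair (i : ℕ) (a b : Idx n) : Prop :=
  1 ≤ i ∧ i ≤ n ∧ ((a : ℤ), (b : ℤ)) = simplePair i

lemma IsSimplePair.cases {i : ℕ} {a b : Idx n} (h : IsSimplePair i a b) :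
    (i = 1 ∧ (a : ℤ) = -1 ∧ (b : ℤ) = 2) ∨ (2 ≤ i ∧ (a : ℤ) = i - 1 ∧ (b : ℤ) = i) := by
  obtain ⟨h1, h2, h3⟩ := h
  simp only [simplePair] at h3
  split_ifs at h3 <;> simp only [Prod.mk.injEq] at h3 <;> omega

lemma IsSimplePair.lt {i : ℕ} {a b : Idx n} (h : IsSimplePair i a b) : (a : ℤ) < b := by
  have := h.cases; omega

lemma IsSimplePair.add_pos {i : ℕ} {a b : Idx n} (h : IsSimplePair i a b) : 0 < (a : ℤ) + b := by
  have := h.cases; omega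

lemma exists_isSimplePair (hn : 2 ≤ n) {i : ℕ} (h1 : 1 ≤ i) (h2 : i ≤ n) :
    ∃ a b : Idx n, IsSimplePair i a b := by
  by_cases h : i = 1
  · refine ⟨Idx.mk' (-1) (by omega) (by omega) (by omega), Idx.mk' 2 (by omega) (by omega)
      (by omega), h1, h2, ?_⟩
    simp [simplePair, h]
  · refine ⟨Idx.mk' (i - 1) (by omega) (by omega) (by omega), Idx.mk' i (by omega) (by omega)
      (by omega), h1, h2, ?_⟩
    simp [simplePair, h]

lemma act_apply (w : weylGroup n) (l : Wt n) (x : Idx n) : act w l x = l (w.1⁻¹ x) := rfl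

lemma act_apply_coe (w : weylGroup n) (l : Wt n) (x : Idx n) : act w l (w.1 x) = l x := by
  rw [act_apply, inv_coe_apply]

lemma act_mul (v w : weylGroup n) (l : Wt n) : act (v * w) l = act v (act w l) := by
  ext x; simp only [act_apply, Subgroup.coe_mul, mul_inv_rev, Equiv.Perm.mul_apply]

lemma act_one (l : Wt n) : act 1 l = l := rfl

lemma act_e (w : weylGroup n) (x : Idx n) : act w (e n x) = e n (w.1 x) := by
  ext z
  have h1 : ((w.1⁻¹ z : Idx n) : ℤ) = x ↔ (z : ℤ) = w.1 x := by
    rw [← Idx.ext_iff', ← Idx.ext_iff', Equiv.Perm.inv_eq_iff_eq]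
  have h2 : ((w.1⁻¹ z : Idx n) : ℤ) = -x ↔ (z : ℤ) = -(w.1 x : ℤ) := by
    rw [← Idx.coe_opp, ← Idx.ext_iff', ← (weylGroup_isOdd w).coe, ← Idx.ext_iff',
      Equiv.Perm.inv_eq_iff_eq]
  simp only [act_apply, e, h1, h2]

lemma act_simpleRoot (w : weylGroup n) {i : ℕ} {a b : Idx n} (h : IsSimplePair i a b) :
    act w (simpleRoot n i) = e n (w.1 b) - e n (w.1 a) := by
  rw [← act_e, ← act_e, simpleRoot, ← h.2.2]; rfl

lemma e_sub_e_mem_positiveRoots {x y : Idx n} (h1 : (x : ℤ) ≠ y) (h2 : (x : ℤ) + y ≠ 0) :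
    e n y - e n x ∈ positiveRoots n ↔ (x : ℤ) < y := by
  have hx := x.ne_zero
  have hy := y.ne_zero
  constructor
  · rintro ⟨a, b, hab, hab', h⟩
    have ha := a.ne_zero
    have hb := b.ne_zero
    have k1 := congrFun h y
    have k2 := congrFun h x
    simp only [Pi.sub_apply, e] at k1 k2
    by_contra hlt
    have e1 : (y : ℤ) = b ∨ (y : ℤ) = -a := by
      by_contra hc
      push Not at hc
      split_ifs at k1 <;> norm_num at k1 <;> omega
    have e2 : (x : ℤ) = a ∨ (x : ℤ) = -b := by
      by_contra hc
      push Not at hc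
      split_ifs at k2 <;> norm_num at k2 <;> omega
    omega
  · intro h
    rcases lt_or_gt_of_ne h2 with h3 | h3
    · refine ⟨y.opp, x.opp, by simpa using h, by simp; omega, ?_⟩
      ext z
      have hz := z.ne_zero
      simp only [Pi.sub_apply, e, Idx.coe_opp, neg_neg]
      split_ifs <;> first | omega | norm_num
    · exact ⟨x, y, h, by omega, rfl⟩

lemma IsOdd.add_ne {w : Equiv.Perm (Idx n)} (hw : IsOdd w) {x y : Idx n}
    (h : (x : ℤ) + y ≠ 0) : (w x : ℤ) + w y ≠ 0 := fun h0 => h <| by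
  have : w x = w y.opp := by rw [Idx.ext_iff', hw.coe]; omega
  have := w.injective this
  rw [Idx.ext_iff', Idx.coe_opp] at this; omega

lemma perm_coe_ne (w : Equiv.Perm (Idx n)) {x y : Idx n} (h : (x : ℤ) ≠ y) :
    (w x : ℤ) ≠ w y := fun h0 => h <| by rw [w.injective (Subtype.ext h0)]

lemma mem_minReps_iff (hn : 2 ≤ n) {r : ℕ} {w : weylGroup n} :
    w ∈ minReps n r ↔ ∀ i, ∀ a b : Idx n, IsSimplePair i a b → i ≠ r → (w.1 a : ℤ) < w.1 b := by
  have key : ∀ {i : ℕ} {a b : Idx n}, IsSimplePair i a b →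
      (act w (simpleRoot n i) ∈ positiveRoots n ↔ (w.1 a : ℤ) < w.1 b) := by
    intro i a b h
    rw [act_simpleRoot w h, e_sub_e_mem_positiveRoots (perm_coe_ne _ h.lt.ne)
      ((weylGroup_isOdd w).add_ne h.add_pos.ne')]
  constructor
  · intro h i a b hi hr
    exact (key hi).1 (h i hi.1 hi.2.1 hr)
  · intro h i h1 h2 hr
    obtain ⟨a, b, hi⟩ := exists_isSimplePair hn h1 h2
    exact (key hi).2 (h i a b hi hr)

/-- Positivity on `α_1` and `α_2` gives `|u(1)| < u(2)`, and on the other simple roots `u(2) < u(3)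
< ⋯`. Squeezed between `2` and `n`, all these values are fixed, and `u(1) = ±1`. -/
lemma eq_one_of_simple_pos (hn : 2 ≤ n) (u : weylGroup n)
    (h : ∀ i, ∀ a b : Idx n, IsSimplePair i a b → (u.1 a : ℤ) < u.1 b) : u = 1 := by
  obtain ⟨hodd, hsign⟩ := weylGroup_isOdd_sign u
  have hup : ∀ k : ℕ, ∀ x : Idx n, (x : ℤ) = k + 2 → (x : ℤ) ≤ u.1 x := by
    intro k
    induction k with
    | zero =>
      intro x hx
      have hx' : (x : ℤ) = 2 := by simpa using hx
      let y : Idx n := Idx.mk' 1 (by omega) (by omega) (by omega)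
      have hy : (y : ℤ) = 1 := rfl
      have k1 := h 1 y.opp x ⟨le_rfl, by omega, by simp [simplePair, hy, hx']⟩
      have k2 := h 2 y x ⟨by omega, by omega, by simp [simplePair, hy, hx']⟩
      rw [hodd.coe] at k1
      have := (u.1 y).ne_zero
      omega
    | succ k ih =>
      intro x hx
      have := x.le_n
      push_cast at hx
      let y : Idx n := Idx.mk' (k + 2) (by omega) (by omega) (by omega)
      have hy : (y : ℤ) = k + 2 := rfl
      have k1 := h (k + 3) y x ⟨by omega, by omega, by
        simp only [simplePair, hy, hx]; rw [if_neg (by omega)]; simp; omega⟩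
      have := ih y hy
      omega
  have hdown : ∀ k : ℕ, ∀ x : Idx n, (x : ℤ) = n - k → 1 ≤ (x : ℤ) → (u.1 x : ℤ) ≤ x := by
    intro k
    induction k with
    | zero =>
      intro x hx _
      have := (u.1 x).le_n
      push_cast at hx
      omega
    | succ k ih =>
      intro x hx hx1
      push_cast at hx
      let y : Idx n := Idx.mk' (n - k) (by omega) (by omega) (by omega)
      have hy : (y : ℤ) = n - k := rfl
      have k1 := h (n - k) x y ⟨by omega, by omega, by
        simp only [simplePair, hy, hx]; rw [if_neg (by omega)]; simp; omega⟩
      have := ih y hy (by omega)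
      omega
  have hfix : ∀ x : Idx n, 2 ≤ (x : ℤ) → u.1 x = x := by
    intro x hx
    have := x.le_n
    have h1 := hup ((x : ℤ).toNat - 2) x (by omega)
    have h2 := hdown (n - (x : ℤ).toNat) x (by omega) (by omega)
    rw [Idx.ext_iff']; omega
  have hfix' : ∀ x : Idx n, 2 ≤ |(x : ℤ)| → u.1 x = x := by
    intro x hx
    rcases le_total 0 (x : ℤ) with h0 | h0
    · exact hfix x (by rwa [abs_of_nonneg h0] at hx)
    · rw [abs_of_nonpos h0] at hx
      rw [← Idx.opp_inj, ← hodd]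
      exact hfix x.opp (by simpa using hx)
  let y : Idx n := Idx.mk' 1 (by omega) (by omega) (by omega)
  have hy : (y : ℤ) = 1 := rfl
  have hcase : ∀ x : Idx n, x = y ∨ x = y.opp ∨ 2 ≤ |(x : ℤ)| := by
    intro x
    have := x.ne_zero
    simp only [Idx.ext_iff', Idx.coe_opp, hy, le_abs]
    omega
  have huy : u.1 y = y ∨ u.1 y = y.opp := by
    rcases hcase (u.1 y) with h1 | h1 | h1
    · exact Or.inl h1
    · exact Or.inr h1
    · have := u.1.injective (hfix' _ h1)
      rw [this] at h1
      norm_num [hy] at h1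
  rcases huy with huy | huy
  · ext x
    rcases hcase x with rfl | rfl | h1
    · rw [huy]; rfl
    · rw [hodd, huy]; rfl
    · rw [hfix' x h1]; rfl
  -- The sign change at the index 1 alone is a single transposition, whereas elements of the Weyl
  -- group are even permutations. This is where type `D` differs from type `B`.
  · exfalso
    have : u.1 = Equiv.swap y y.opp := by
      ext x
      rcases hcase x with rfl | rfl | h1
      · rw [huy, Equiv.swap_apply_left]
      · rw [hodd, huy, Equiv.swap_apply_right, Idx.opp_opp]
      · rw [hfix' x h1, Equiv.swap_apply_of_ne_of_ne]
        · rintro rfl; norm_num [hy] at h1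
        · rintro rfl; norm_num [hy] at h1
    rw [this, Equiv.Perm.sign_swap (Idx.opp_ne y).symm] at hsign
    revert hsign; decide

/-! Bruhat order -/

lemma length_lt_rf_mul (u : weylGroup n) {a b : Idx n} (h : (a : ℤ) < b) (h' : (a : ℤ) + b ≠ 0)
    (hu : (u.1⁻¹ a : ℤ) < u.1⁻¹ b) : length u < length (rf a b * u) := by
  rw [rf_mul]
  exact length_lt_mul_rf u hu ((weylGroup_isOdd u).inv.add_ne h') (by simpa using h)

lemma rootRefl_left {a b : Idx n} (h : (a : ℤ) ≠ b) (h' : (a : ℤ) + b ≠ 0) :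
    rootRefl a b a = b := by
  rw [Idx.ext_iff', coe_rootRefl h (by omega), if_pos rfl]

lemma rootRefl_right {a b : Idx n} (h : (a : ℤ) ≠ b) (h' : (a : ℤ) + b ≠ 0) :
    rootRefl a b b = a := by
  rw [rootRefl_comm, rootRefl_left (Ne.symm h) (by omega)]

lemma rootRefl_inv (a b : Idx n) : (rootRefl a b)⁻¹ = rootRefl a b :=
  inv_eq_of_mul_eq_one_left (rootRefl_mul_self a b)

lemma rf_mul_inv_apply (u : weylGroup n) (a b x : Idx n) :
    (rf a b * u).1⁻¹ x = u.1⁻¹ (rootRefl a b x) := by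
  rw [Subgroup.coe_mul, mul_inv_rev, coe_rf, rootRefl_inv]; rfl

lemma rf_opp_opp {a b : Idx n} (h1 : (a : ℤ) ≠ b) (h2 : (a : ℤ) + b ≠ 0) :
    rf a.opp b.opp = rf a b := Subtype.ext (rootRefl_opp_opp h1 (by omega))

lemma rf_comm (a b : Idx n) : rf a b = rf b a := Subtype.ext (rootRefl_comm a b)

lemma bruhatStep_rf_mul (u : weylGroup n) {a b : Idx n} (h : (a : ℤ) < b) (h' : (a : ℤ) + b ≠ 0)
    (hu : (u.1⁻¹ a : ℤ) < u.1⁻¹ b) : BruhatStep u (rf a b * u) := by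
  refine ⟨?_, length_lt_rf_mul u h h' hu⟩
  rcases lt_or_gt_of_ne h' with h3 | h3
  · refine ⟨b.opp, a.opp, by simpa using h, by simp; omega, ?_⟩
    rw [rootRefl_opp_opp (by omega) (by omega), rootRefl_comm]; rfl
  · exact ⟨a, b, h, by omega, rfl⟩

/-- The length condition is replaced by a comparison of two values of `u⁻¹`: if `u⁻¹` reversed the
pair, multiplication by the reflection would lower the length. -/
lemma BruhatStep.exists_rf {u w : weylGroup n} (h : BruhatStep u w) :
    ∃ a b : Idx n, (a : ℤ) < b ∧ 0 < (a : ℤ) + b ∧ w = rf a b * u ∧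
      (u.1⁻¹ a : ℤ) < u.1⁻¹ b := by
  obtain ⟨⟨a, b, hab, hab', hw⟩, hl⟩ := h
  have hw' : w = rf a b * u := Subtype.ext hw
  refine ⟨a, b, hab, hab', hw', ?_⟩
  by_contra hc
  have hne := perm_coe_ne u.1⁻¹ hab.ne
  have := length_lt_rf_mul (rf a b * u) hab hab'.ne' (by
    rw [rf_mul_inv_apply, rf_mul_inv_apply, rootRefl_left hab.ne hab'.ne',
      rootRefl_right hab.ne hab'.ne']
    omega)
  rw [rf_mul_cancel, ← hw'] at this
  omega

lemma IsSimplePair.flip {i : ℕ} {a b c d : Idx n} (h : IsSimplePair i a b) (hcd : (c : ℤ) < d)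
    (hcd' : (c : ℤ) + d ≠ 0) (hf : (rootRefl a b d : ℤ) < rootRefl a b c) :
    (c = a ∧ d = b) ∨ (c = b.opp ∧ d = a.opp) := by
  have := h.cases
  have hc := c.ne_zero
  have hd := d.ne_zero
  rw [coe_rootRefl (by omega) (by omega), coe_rootRefl (by omega) (by omega)] at hf
  simp only [Idx.ext_iff', Idx.coe_opp]
  split_ifs at hf <;> omega

lemma IsSimplePair.flip_rf {i : ℕ} {a b c d : Idx n} (h : IsSimplePair i a b) (hcd : (c : ℤ) < d)
    (hcd' : (c : ℤ) + d ≠ 0) (hf : (rootRefl a b d : ℤ) < rootRefl a b c) : rf c d = rf a b := by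
  rcases h.flip hcd hcd' hf with ⟨rfl, rfl⟩ | ⟨rfl, rfl⟩
  · rfl
  · rw [rf_opp_opp h.lt.ne' (by have := h.add_pos; omega), rf_comm]

/-- A simple reflection `s` permutes the positive roots other than its own. If `y = t x` with `t ≠
s`, then `s y = (s t s)(s x)`, the root of `s t s` is again positive, and the comparison that makes
it an upward step is unchanged. -/
lemma BruhatStep.left_mul {x y : weylGroup n} (hxy : BruhatStep x y) {i : ℕ} {a b : Idx n}
    (h : IsSimplePair i a b) : y = rf a b * x ∨ BruhatStep (rf a b * x) (rf a b * y) := by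
  obtain ⟨c, d, hcd, hcd', rfl, hlt⟩ := hxy.exists_rf
  rcases lt_or_gt_of_ne (perm_coe_ne (rootRefl a b) hcd.ne) with hs | hs
  · right
    have : rf a b * (rf c d * x) = rf (rootRefl a b c) (rootRefl a b d) * (rf a b * x) := by
      rw [← coe_rf, ← conj_rf]; group
    rw [this]
    refine bruhatStep_rf_mul _ hs ((isOdd_rootRefl a b).add_ne hcd'.ne') ?_
    have htt : ∀ z, rootRefl a b (rootRefl a b z) = z := fun z => by
      rw [← Equiv.Perm.mul_apply, rootRefl_mul_self]; rfl
    rwa [rf_mul_inv_apply, rf_mul_inv_apply, htt, htt]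
  · left
    rw [h.flip_rf hcd hcd'.ne' hs]

lemma BruhatStep.mul_right {x y : weylGroup n} (hxy : BruhatStep x y) {i : ℕ} {a b : Idx n}
    (h : IsSimplePair i a b) : y = x * rf a b ∨ BruhatStep (x * rf a b) (y * rf a b) := by
  obtain ⟨c, d, hcd, hcd', rfl, hlt⟩ := hxy.exists_rf
  have hodd := (weylGroup_isOdd x).inv.add_ne hcd'.ne'
  rcases lt_or_gt_of_ne (perm_coe_ne (rootRefl a b) hlt.ne) with hs | hs
  · right
    rw [mul_assoc]
    refine bruhatStep_rf_mul _ hcd hcd'.ne' ?_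
    rw [Subgroup.coe_mul, mul_inv_rev, coe_rf, rootRefl_inv]
    exact hs
  · left
    rw [rf_mul, h.flip_rf hlt hodd hs]

lemma BruhatLE.left_mul {x y : weylGroup n} (hxy : BruhatLE x y) {i : ℕ} {a b : Idx n}
    (h : IsSimplePair i a b) : BruhatLE (rf a b * x) y ∨ BruhatLE (rf a b * x) (rf a b * y) := by
  induction hxy using Relation.ReflTransGen.head_induction_on with
  | refl => exact Or.inr .refl
  | head h1 h2 ih =>
    rcases h1.left_mul h with h3 | h3
    · exact Or.inl (h3 ▸ h2)
    · exact ih.imp (.head h3) (.head h3)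

lemma BruhatLE.mul_right {x y : weylGroup n} (hxy : BruhatLE x y) {i : ℕ} {a b : Idx n}
    (h : IsSimplePair i a b) : BruhatLE (x * rf a b) (y * rf a b) ∨ BruhatLE x (y * rf a b) := by
  induction hxy using Relation.ReflTransGen.head_induction_on with
  | refl => exact Or.inl .refl
  | head h1 h2 ih =>
    rcases ih with ih | ih
    · rcases h1.mul_right h with h3 | h3
      · right; rw [h3, mul_assoc, rf_mul_self, mul_one] at ih; exact ih
      · exact Or.inl (.head h3 ih)
    · exact Or.inr (.head h1 ih)

/-- Of the two outcomes of `BruhatLE.mul_right`, one is the claim. The other is `v s ≤ y s`, and `v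
< v s` because `v` is a minimal representative. -/
lemma BruhatLE.mul_rf_of_minReps (hn : 2 ≤ n) {r : ℕ} {v y : weylGroup n} (hv : v ∈ minReps n r)
    (hvy : BruhatLE v y) {i : ℕ} {a b : Idx n} (h : IsSimplePair i a b) (hi : i ≠ r) :
    BruhatLE v (y * rf a b) := by
  rcases hvy.mul_right h with h1 | h1
  · refine .head ?_ h1
    have := (mem_minReps_iff hn).1 hv i a b h hi
    have h2 := bruhatStep_rf_mul v this ((weylGroup_isOdd v).add_ne h.add_pos.ne')
      (by simpa using h.lt)
    rwa [rf_mul, inv_coe_apply, inv_coe_apply] at h2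
  · exact h1

/-- Lifting property: `x ≤ y`, `y < s y` imply `s x ≤ s y`. -/
lemma BruhatLE.lift {x y : weylGroup n} (hxy : BruhatLE x y) {i : ℕ} {a b : Idx n}
    (h : IsSimplePair i a b) (hy : (y.1⁻¹ a : ℤ) < y.1⁻¹ b) :
    BruhatLE (rf a b * x) (rf a b * y) := by
  rcases hxy.left_mul h with h1 | h1
  · exact .tail h1 (bruhatStep_rf_mul y h.lt h.add_pos.ne' hy)
  · exact h1

/-! Fundamental weights -/

lemma fundamentalWeight_apply {r : ℕ} (hr : 1 ≤ r) (x : Idx n) : fundamentalWeight n r x =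
    if r = 1 then (if 0 < (x : ℤ) then 1 / 2 else -1 / 2)
    else if r = 2 then (if 1 < (x : ℤ) ∨ (x : ℤ) = -1 then 1 / 2 else -1 / 2)
    else if (r : ℤ) ≤ x then 1 else if (x : ℤ) ≤ -r then -1 else 0 := by
  have hx := x.ne_zero
  have h1 := x.le_n
  have h2 := x.neg_n_le
  have key : ∀ r : ℕ, 1 ≤ r → (∑ k ∈ Finset.Icc (r : ℤ) n, e n k x : ℝ) =
      if (r : ℤ) ≤ x then 1 else if (x : ℤ) ≤ -r then -1 else 0 := by
    intro r hr
    have : ∀ k ∈ Finset.Icc (r : ℤ) n, e n k x =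
        (if k = x then 1 else 0) - (if k = -(x : ℤ) then 1 else 0) := by
      intro k hk
      rw [Finset.mem_Icc] at hk
      simp only [e]
      split_ifs <;> first | omega | norm_num
    rw [Finset.sum_congr rfl this, Finset.sum_sub_distrib, Finset.sum_ite_eq', Finset.sum_ite_eq']
    simp only [Finset.mem_Icc]
    split_ifs <;> first | omega | norm_num
  have key1 := key 1 le_rfl
  rw [Nat.cast_one] at key1
  unfold fundamentalWeight
  split_ifs <;> simp only [Pi.smul_apply, Pi.sub_apply, Finset.sum_apply, smul_eq_mul] <;>
    (try rw [key1]) <;> (try rw [key r hr]) <;> (try simp only [e]) <;>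
    split_ifs <;> first | omega | norm_num

lemma fundamentalWeight_opp {r : ℕ} (hr : 1 ≤ r) (x : Idx n) :
    fundamentalWeight n r x.opp = -fundamentalWeight n r x := by
  have hx := x.ne_zero
  rw [fundamentalWeight_apply hr, fundamentalWeight_apply hr]
  have hy := x.coe_opp
  generalize x.opp = y at hy ⊢
  rw [eq_neg_iff_add_eq_zero]
  split_ifs <;> first | omega | (norm_num; done)

/-- The pair `(-1, 1)` must be excluded: `ω_2` takes the value `1/2` at `-1` and `-1/2` at `1`. -/
lemma fundamentalWeight_mono {r : ℕ} (hr : 1 ≤ r) {x y : Idx n} (h : (x : ℤ) < y)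
    (h' : (x : ℤ) + y ≠ 0) : fundamentalWeight n r x ≤ fundamentalWeight n r y := by
  have hx := x.ne_zero
  have hy := y.ne_zero
  rw [fundamentalWeight_apply hr, fundamentalWeight_apply hr]
  split_ifs <;> first | omega | norm_num

lemma fundamentalWeight_simple {r i : ℕ} (hr : 1 ≤ r) {a b : Idx n} (h : IsSimplePair i a b)
    (hi : i ≠ r) : fundamentalWeight n r a = fundamentalWeight n r b := by
  have := h.cases
  rw [fundamentalWeight_apply hr, fundamentalWeight_apply hr]
  split_ifs <;> first | omega | norm_num

lemma fundamentalWeight_simple_lt {r : ℕ} (hr : 1 ≤ r) {a b : Idx n} (h : IsSimplePair r a b) :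
    fundamentalWeight n r a < fundamentalWeight n r b := by
  have := h.cases
  rw [fundamentalWeight_apply hr, fundamentalWeight_apply hr]
  split_ifs <;> first | omega | norm_num

lemma fundamentalWeight_lt_imp {r : ℕ} (hr : 1 ≤ r) {x y : Idx n} (h' : (x : ℤ) + y ≠ 0)
    (h : fundamentalWeight n r x < fundamentalWeight n r y) : (x : ℤ) < y := by
  by_contra hc
  rcases eq_or_lt_of_le (not_lt.1 hc) with h1 | h1
  · rw [Subtype.ext h1] at h; exact lt_irrefl _ h
  · exact absurd (fundamentalWeight_mono hr h1 (by omega)) (not_le.2 h)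

lemma stab_simple_lt {r : ℕ} (hr : 1 ≤ r) {u : weylGroup n}
    (hu : act u (fundamentalWeight n r) = fundamentalWeight n r) {a b : Idx n}
    (h : IsSimplePair r a b) : (u.1 a : ℤ) < u.1 b := by
  apply fundamentalWeight_lt_imp hr ((weylGroup_isOdd u).add_ne h.add_pos.ne')
  rw [← hu, act_apply_coe, act_apply_coe]
  exact fundamentalWeight_simple_lt hr h

lemma eq_one_of_minReps_of_stab (hn : 2 ≤ n) {r : ℕ} (hr : 1 ≤ r) {u : weylGroup n}
    (hm : u ∈ minReps n r) (hu : act u (fundamentalWeight n r) = fundamentalWeight n r) :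
    u = 1 := by
  apply eq_one_of_simple_pos hn
  intro i a b h
  by_cases hi : i = r
  · subst hi; exact stab_simple_lt hr hu h
  · exact (mem_minReps_iff hn).1 hm i a b h hi

lemma act_rf_fundamentalWeight {r i : ℕ} (hr : 1 ≤ r) {a b : Idx n} (h : IsSimplePair i a b)
    (hi : i ≠ r) : act (rf a b) (fundamentalWeight n r) = fundamentalWeight n r := by
  have heq := fundamentalWeight_simple hr h hi
  have h1 := h.lt
  have h2 := h.add_pos
  ext x
  rw [act_apply, coe_rf, rootRefl_inv]
  have : rootRefl a b x = if x = a then b else if x = b then a else if x = a.opp then b.opp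
      else if x = b.opp then a.opp else x := by
    rw [Idx.ext_iff', coe_rootRefl (by omega) (by omega)]
    simp only [Idx.ext_iff', Idx.coe_opp]
    split_ifs <;> simp
  rw [this]
  split_ifs with h3 h3 h3 h3
  · rw [h3, heq]
  · rw [h3, heq]
  · rw [h3, fundamentalWeight_opp hr, fundamentalWeight_opp hr, heq]
  · rw [h3, fundamentalWeight_opp hr, fundamentalWeight_opp hr, heq]
  · rfl

/-- The relation `v ≤ y` depends only on the coset of `y` modulo the stabilizer of `ω_r`. A
nontrivial `x` in the stabilizer makes some simple root negative, and not `α_r` by `stab_simple_lt`.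
Removing this simple factor on the right shortens `x` and stays in the stabilizer. -/
lemma BruhatLE.mul_of_stab (hn : 2 ≤ n) {r : ℕ} (hr : 1 ≤ r) {v y : weylGroup n}
    (hv : v ∈ minReps n r) (hvy : BruhatLE v y) (x : weylGroup n)
    (hx : act x (fundamentalWeight n r) = fundamentalWeight n r) : BruhatLE v (y * x) := by
  induction hl : length x using Nat.strong_induction_on generalizing x with
  | _ l ih =>
    subst hl
    by_cases hx1 : x = 1
    · rwa [hx1, mul_one]
    obtain ⟨i, a, b, h, hlt⟩ : ∃ i, ∃ a b : Idx n, IsSimplePair i a b ∧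
        ¬(x.1 a : ℤ) < x.1 b := by
      by_contra hc
      push Not at hc
      exact hx1 (eq_one_of_simple_pos hn x fun i a b h => hc i a b h)
    have hi : i ≠ r := by
      rintro rfl
      exact hlt (stab_simple_lt hr hx h)
    have h1 := h.lt
    have h2 := h.add_pos
    have hx' : (x * rf a b) * rf a b = x := by rw [mul_assoc, rf_mul_self, mul_one]
    have hlen := length_lt_mul_rf (x * rf a b) h1 h2.ne' (by
      rw [Subgroup.coe_mul, coe_rf, Equiv.Perm.mul_apply, Equiv.Perm.mul_apply,
        rootRefl_left h1.ne h2.ne', rootRefl_right h1.ne h2.ne']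
      have := perm_coe_ne x.1 h1.ne
      omega)
    rw [hx'] at hlen
    have := (ih _ hlen (x * rf a b) (by
      rw [act_mul, act_rf_fundamentalWeight hr h hi, hx]) rfl).mul_rf_of_minReps hn hv h hi
    rwa [mul_assoc, hx'] at this

lemma BruhatLE.of_act_eq (hn : 2 ≤ n) {r : ℕ} (hr : 1 ≤ r) {v y w : weylGroup n}
    (hv : v ∈ minReps n r) (hvy : BruhatLE v y)
    (h : act y (fundamentalWeight n r) = act w (fundamentalWeight n r)) : BruhatLE v w := by
  have := hvy.mul_of_stab hn hr hv (y⁻¹ * w) (by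
    rw [act_mul, ← h, ← act_mul, inv_mul_cancel, act_one])
  rwa [mul_inv_cancel_left] at this

lemma exists_descent (hn : 2 ≤ n) {w : weylGroup n} (hw : w ≠ 1) : ∃ i, ∃ a b : Idx n,
    IsSimplePair i a b ∧ (w.1⁻¹ b : ℤ) < w.1⁻¹ a := by
  by_contra hc
  push Not at hc
  apply hw
  rw [← inv_eq_one]
  apply eq_one_of_simple_pos hn
  intro i a b h
  have := hc i a b h
  have := perm_coe_ne w.1⁻¹ h.lt.ne
  rw [Subgroup.coe_inv]
  omega

/-- The only obstruction is that `v` sends some `α_j` with `j ≠ r` to the simple root `e_b - e_a`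
itself. Then `ω_r` has equal values at `v⁻¹ a` and `v⁻¹ b`, and `v⁻¹ a < v⁻¹ b`; each alternative of
the hypothesis excludes this. -/
lemma rf_mul_mem_minReps (hn : 2 ≤ n) {r : ℕ} (hr : 1 ≤ r) {v : weylGroup n}
    (hv : v ∈ minReps n r) {i : ℕ} {a b : Idx n} (h : IsSimplePair i a b)
    (hne : fundamentalWeight n r (v.1⁻¹ a) ≠ fundamentalWeight n r (v.1⁻¹ b) ∨
      (v.1⁻¹ b : ℤ) < v.1⁻¹ a) : rf a b * v ∈ minReps n r := by
  rw [mem_minReps_iff hn] at hv ⊢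
  intro j c d hj hjr
  have hcd := hv j c d hj hjr
  have hodd := weylGroup_isOdd v
  have hω := fundamentalWeight_simple hr hj hjr
  have hjlt := hj.lt
  by_contra hc
  have hne' := perm_coe_ne (rf a b * v).1 hj.lt.ne
  rcases h.flip hcd (hodd.add_ne hj.add_pos.ne') (by
    simp only [Subgroup.coe_mul, coe_rf, Equiv.Perm.mul_apply] at hc hne'
    omega) with ⟨h1, h2⟩ | ⟨h1, h2⟩
  · rw [← h1, ← h2, inv_coe_apply, inv_coe_apply, hω] at hne
    rcases hne with hne | hne
    · exact hne rfl
    · omega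
  · have e1 : v.1⁻¹ a = d.opp := by rw [Equiv.Perm.inv_eq_iff_eq, hodd, h2, Idx.opp_opp]
    have e2 : v.1⁻¹ b = c.opp := by rw [Equiv.Perm.inv_eq_iff_eq, hodd, h1, Idx.opp_opp]
    rw [e1, e2, fundamentalWeight_opp hr, fundamentalWeight_opp hr, hω] at hne
    simp only [Idx.coe_opp] at hne
    rcases hne with hne | hne
    · exact hne rfl
    · omega

end TypeD

end

section

namespace TypeD

/-! Zariski closed sets and the projective line -/

section Completeness

open Polynomial

variable {K : Type*} [Field K] {σ : Type*}

/-- The Zariski closure of a set of points of affine space. -/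
def zariskiClosure (S : Set (σ → K)) : Set (σ → K) :=
  {x | ∀ F : MvPolynomial σ K, (∀ s ∈ S, MvPolynomial.eval s F = 0) → MvPolynomial.eval x F = 0}

lemma subset_zariskiClosure (S : Set (σ → K)) : S ⊆ zariskiClosure S := fun _ hx _ hF => hF _ hx

lemma zariskiClosure_idem {S T : Set (σ → K)} (h : S ⊆ zariskiClosure T) :
    zariskiClosure S ⊆ zariskiClosure T := fun _ hx F hF => hx F fun s hs => h hs F hF

/-- A polynomial map preserves Zariski closures. -/
lemma map_zariskiClosure {S T : Set (σ → K)} (φ : σ → MvPolynomial σ K)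
    (h : ∀ s ∈ S, (fun i => MvPolynomial.eval s (φ i)) ∈ zariskiClosure T) {x : σ → K}
    (hx : x ∈ zariskiClosure S) : (fun i => MvPolynomial.eval x (φ i)) ∈ zariskiClosure T := by
  intro F hF
  have key : ∀ y : σ → K, MvPolynomial.eval y (MvPolynomial.bind₁ φ F) =
      MvPolynomial.eval (fun i => MvPolynomial.eval y (φ i)) F := fun y => by
    rw [MvPolynomial.eval, MvPolynomial.eval₂Hom_bind₁]; rfl
  rw [← key]
  exact hx _ fun s hs => by rw [key]; exact h s hs F hF

/-- Evaluation of a polynomial in `t` whose coefficients are polynomial functions. -/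
def evalAt (t : K) (x : σ → K) : (MvPolynomial σ K)[X] →+* K :=
  eval₂RingHom (MvPolynomial.eval x) t

lemma evalAt_eq (t : K) (x : σ → K) (f : (MvPolynomial σ K)[X]) :
    evalAt t x f = eval t (f.map (MvPolynomial.eval x)) := by
  rw [evalAt, coe_eval₂RingHom, eval_map]

/-- The point with coordinates `ψ i` at `(t, x)`. -/
def pointAt (ψ : σ → (MvPolynomial σ K)[X]) (t : K) (x : σ → K) : σ → K :=
  fun i => evalAt t x (ψ i)

lemma evalAt_aeval (ψ : σ → (MvPolynomial σ K)[X]) (t : K) (x : σ → K) (F : MvPolynomial σ K) :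
    evalAt t x (MvPolynomial.aeval ψ F) = MvPolynomial.eval (pointAt ψ t x) F := by
  rw [MvPolynomial.map_aeval, MvPolynomial.eval]
  congr 2
  ext c
  simp [evalAt]

/-- Specialization at `x` maps `J` onto an ideal of `K[X]`. Its generator has no root, since a root
would be a common zero of `J` over `x`; over an algebraically closed field it is therefore a unit.
-/
lemma exists_map_eq_one [IsAlgClosed K] (J : Ideal (MvPolynomial σ K)[X]) (x : σ → K)
    (h : ∀ t, ∃ f ∈ J, evalAt t x f ≠ 0) : ∃ f ∈ J, f.map (MvPolynomial.eval x) = 1 := by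
  have hsurj : Function.Surjective (mapRingHom (MvPolynomial.eval x)) :=
    map_surjective _ fun c => ⟨MvPolynomial.C c, by simp⟩
  suffices hJ : J.map (mapRingHom (MvPolynomial.eval x)) = ⊤ by
    have : (1 : K[X]) ∈ J.map (mapRingHom (MvPolynomial.eval x)) := by rw [hJ]; trivial
    obtain ⟨f, hf, h1⟩ := (Ideal.mem_map_iff_of_surjective _ hsurj).1 this
    exact ⟨f, hf, h1⟩
  obtain ⟨q, hq⟩ := IsPrincipalIdealRing.principal (J.map (mapRingHom (MvPolynomial.eval x)))
  have hdvd : ∀ f ∈ J, q ∣ f.map (MvPolynomial.eval x) := fun f hf => by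
    have := Ideal.mem_map_of_mem (mapRingHom (MvPolynomial.eval x)) hf
    rw [hq] at this
    exact Ideal.mem_span_singleton.1 this
  by_cases hdeg : q.degree = 0
  · rw [hq]
    exact Ideal.span_singleton_eq_top.2 (isUnit_iff_degree_eq_zero.2 hdeg)
  · exfalso
    obtain ⟨t, ht⟩ := IsAlgClosed.exists_root q hdeg
    obtain ⟨f, hf, hne⟩ := h t
    apply hne
    rw [evalAt_eq]
    exact ht.dvd (hdvd f hf)

/-- The ideal of the polynomials that vanish at all `(t, x)` with `x ∈ Y` and `ψ(t, x) ∈ A`. -/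
def fiberIdeal (Y A : Set (σ → K)) (ψ : σ → (MvPolynomial σ K)[X]) :
    Ideal (MvPolynomial σ K)[X] where
  carrier := {f | ∀ x ∈ Y, ∀ t, pointAt ψ t x ∈ A → evalAt t x f = 0}
  add_mem' ha hb x hx t h := by rw [map_add, ha x hx t h, hb x hx t h, add_zero]
  zero_mem' x _ t _ := map_zero _
  smul_mem' c f hf x hx t h := by rw [smul_eq_mul, map_mul, hf x hx t h, mul_zero]

lemma exists_mem_fiberIdeal [IsAlgClosed K] {Y A : Set (σ → K)} (hA : zariskiClosure A ⊆ A)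
    (ψ : σ → (MvPolynomial σ K)[X]) (x : σ → K) (h : ∀ t, pointAt ψ t x ∉ A) :
    ∃ f ∈ fiberIdeal Y A ψ, f.map (MvPolynomial.eval x) = 1 := by
  apply exists_map_eq_one
  intro t
  have h1 : pointAt ψ t x ∉ zariskiClosure A := fun h' => h t (hA h')
  simp only [zariskiClosure, Set.mem_ofPred_eq] at h1
  push Not at h1
  obtain ⟨F, hF, hne⟩ := h1
  refine ⟨MvPolynomial.aeval ψ F, ?_, by rwa [evalAt_aeval]⟩
  intro y _ t hy
  rw [evalAt_aeval]
  exact hF _ hy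

/-- The projective line is complete: the projection to `x` of a closed family over the projective
line, given by the charts `ψ₀` and `ψ₁` glued along `t ↦ t⁻¹`, is closed. -/
theorem mem_of_mem_zariskiClosure_projection [IsAlgClosed K] (Y A : Set (σ → K))
    (hA : zariskiClosure A ⊆ A) (ψ₀ ψ₁ : σ → (MvPolynomial σ K)[X])
    (hglue : ∀ x ∈ Y, ∀ t ≠ 0, pointAt ψ₀ t x ∈ A ↔ pointAt ψ₁ t⁻¹ x ∈ A) {x₀ : σ → K}
    (hx₀ : x₀ ∈ Y)
    (hcl : x₀ ∈ zariskiClosure {x | x ∈ Y ∧ ((∃ t, pointAt ψ₀ t x ∈ A) ∨ pointAt ψ₁ 0 x ∈ A)}) :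
    (∃ t, pointAt ψ₀ t x₀ ∈ A) ∨ pointAt ψ₁ 0 x₀ ∈ A := by
  by_contra hc
  push Not at hc
  have h1 : ∀ t, pointAt ψ₁ t x₀ ∉ A := by
    intro t ht
    by_cases h0 : t = 0
    · subst h0; exact hc.2 ht
    · exact hc.1 t⁻¹ ((hglue x₀ hx₀ t⁻¹ (inv_ne_zero h0)).2 (by rwa [inv_inv]))
  obtain ⟨f, hf, hf1⟩ := exists_mem_fiberIdeal (Y := Y) hA ψ₀ x₀ hc.1
  obtain ⟨g, hg, hg1⟩ := exists_mem_fiberIdeal (Y := Y) hA ψ₁ x₀ h1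
  set N := g.natDegree with hN
  -- the polynomial `g` in the chart at infinity, transported to the other chart
  let k : (MvPolynomial σ K)[X] := X * reflect N g
  -- At `t = 0` the reversed polynomial takes the value of the top coefficient of `g`, which need
  -- not vanish; the extra factor `X` makes `k` vanish there.
  have hk : ∀ x ∈ Y, ∀ t, pointAt ψ₀ t x ∈ A → evalAt t x k = 0 := by
    intro x hx t ht
    by_cases h0 : t = 0
    · simp [k, h0, evalAt]
    · have h2 := hg x hx t⁻¹ ((hglue x hx t h0).1 ht)
      letI : Invertible t⁻¹ := invertibleOfNonzero (inv_ne_zero h0)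
      have h3 := (eval₂_reflect_eq_zero_iff (MvPolynomial.eval x) t⁻¹ N g le_rfl).2 h2
      rw [invOf_eq_inv, inv_inv] at h3
      rw [map_mul, evalAt, coe_eval₂RingHom, h3, mul_zero]
  have hkdeg : k.natDegree ≤ N + 1 := by
    have h2 : (reflect N g).natDegree ≤ N := by simpa [hN] using natDegree_reflect_le (N := N) (p := g)
    refine (natDegree_mul_le).trans ?_
    have := natDegree_X_le (R := MvPolynomial σ K)
    omega
  -- The resultant is a combination of `f` and `k`, so it vanishes at every `x` whose fibre meets
  -- the first chart. The factor `g.coeff 0` vanishes at every `x` whose fibre contains the point at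
  -- infinity. Their product thus vanishes on the whole projection.
  obtain ⟨p, q, -, -, hpq⟩ := exists_mul_add_mul_eq_C_resultant f k le_rfl hkdeg (by omega)
  have hF := hcl (resultant f k f.natDegree (N + 1) * g.coeff 0) ?_
  -- At `x₀` both `f` and `g` become 1, so `k` becomes `X ^ (N + 1)`. The resultant is taken with
  -- the fixed degree `N + 1`, where this polynomial has coefficient 1, hence it specializes to
  -- `±1`.
  · have hk1 : k.map (MvPolynomial.eval x₀) = X ^ (N + 1) := by
      rw [Polynomial.map_mul, map_X, ← reflect_map, hg1, reflect_one, pow_succ']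
    have hg0 : MvPolynomial.eval x₀ (g.coeff 0) = 1 := by
      rw [← coeff_map, hg1, coeff_one_zero]
    rw [map_mul, ← resultant_map_map, hf1, hk1, resultant_one_left, hg0, mul_one, coeff_X_pow_self,
      one_pow, mul_one] at hF
    exact pow_ne_zero _ (neg_ne_zero.2 one_ne_zero) hF
  · rintro x ⟨hx, ⟨t, ht⟩ | ht⟩
    · have h2 := congrArg (evalAt t x) hpq
      rw [map_add, map_mul, map_mul, hf x hx t ht, hk x hx t ht] at h2
      simp [evalAt] at h2
      simp [← h2]
    · have h2 := hg x hx 0 ht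
      rw [evalAt_eq, ← coeff_zero_eq_eval_zero, coeff_map] at h2
      simp [h2]

end Completeness

end TypeD

end

/-! ### Root subgroups, torus and Borel subgroups as matrices. -/

section

namespace TypeD

variable {n : ℕ}

section MatrixGroup

open Matrix

variable {K : Type*} [Field K]

lemma gl_ext_mulVec {g h : GeneralLinearGroup (Idx n) K} (H : ∀ x, g.1 *ᵥ x = h.1 *ᵥ x) : g = h :=
  Units.ext (Matrix.ext_of_mulVec_single fun i => H _)

lemma gl_mul_mulVec (g h : GeneralLinearGroup (Idx n) K) (x : Idx n → K) :
    (g * h).1 *ᵥ x = g.1 *ᵥ (h.1 *ᵥ x) := by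
  rw [Matrix.mulVec_mulVec, Units.val_mul]

lemma permRep_mulVec (w : Equiv.Perm (Idx n)) (x : Idx n → K) (z : Idx n) :
    ((permRep K w).1 *ᵥ x) z = x (w⁻¹ z) := by
  change (Equiv.Perm.permMatrix K w⁻¹ *ᵥ x) z = _
  rw [Matrix.permMatrix_mulVec]; rfl

lemma permRep_apply (w : Equiv.Perm (Idx n)) (y z : Idx n) :
    (permRep K w).1 y z = if w z = y then 1 else 0 := by
  change Equiv.Perm.permMatrix K w⁻¹ y z = _
  have : w.symm y = z ↔ w z = y := by rw [Equiv.symm_apply_eq, eq_comm]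
  simp [Equiv.Perm.permMatrix, PEquiv.toMatrix_apply, Equiv.toPEquiv_apply, this]

lemma permRep_mul (v w : Equiv.Perm (Idx n)) :
    permRep K (v * w) = permRep K v * permRep K w := by
  refine gl_ext_mulVec fun x => funext fun z => ?_
  rw [gl_mul_mulVec, permRep_mulVec, permRep_mulVec, permRep_mulVec, _root_.mul_inv_rev]; rfl

lemma permRep_one : permRep K (1 : Equiv.Perm (Idx n)) = 1 := by
  refine gl_ext_mulVec fun x => funext fun z => ?_
  rw [permRep_mulVec]; simp

lemma permRep_inv (w : Equiv.Perm (Idx n)) : permRep K w⁻¹ = (permRep K w)⁻¹ := by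
  rw [eq_inv_iff_mul_eq_one, ← permRep_mul, inv_mul_cancel, permRep_one]

/-- The condition that `e_b - e_a` is a root. -/
def IsRootPair (a b : Idx n) : Prop := (a : ℤ) ≠ b ∧ (a : ℤ) + b ≠ 0

lemma IsRootPair.symm {a b : Idx n} (h : IsRootPair a b) : IsRootPair b a :=
  ⟨h.1.symm, by have := h.2; omega⟩

lemma IsRootPair.opp {a b : Idx n} (h : IsRootPair a b) : IsRootPair a.opp b.opp := by
  have h1 := h.1
  have h2 := h.2
  constructor <;> simp only [Idx.coe_opp] <;> omega

lemma IsRootPair.map {a b : Idx n} (h : IsRootPair a b) {w : Equiv.Perm (Idx n)} (hw : IsOdd w) :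
    IsRootPair (w a) (w b) := ⟨perm_coe_ne w h.1, hw.add_ne h.2⟩

lemma IsSimplePair.isRootPair {i : ℕ} {a b : Idx n} (h : IsSimplePair i a b) : IsRootPair a b :=
  ⟨h.lt.ne, h.add_pos.ne'⟩

/-- The matrix `v_a ↦ v_a + c v_b`, `v_{-b} ↦ v_{-b} - c v_{-a}`. -/
def rootMatrix (a b : Idx n) (c : K) : Matrix (Idx n) (Idx n) K := Matrix.of fun i j =>
  (if i = j then 1 else 0) + (if i = b then (if j = a then c else 0) else 0) -
    (if i = a.opp then (if j = b.opp then c else 0) else 0)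

lemma rootMatrix_mulVec (a b : Idx n) (c : K) (x : Idx n → K) (z : Idx n) :
    (rootMatrix a b c *ᵥ x) z = x z + (if z = b then c * x a else 0) -
      (if z = a.opp then c * x b.opp else 0) := by
  simp only [rootMatrix, mulVec, dotProduct, Matrix.of_apply, sub_mul, add_mul, ite_mul, one_mul,
    zero_mul, Finset.sum_sub_distrib, Finset.sum_add_distrib, Finset.sum_ite_eq, Finset.mem_univ,
    if_true]
  congr 2
  · split_ifs <;> simp
  · split_ifs <;> simp

lemma IsRootPair.ne {a b : Idx n} (h : IsRootPair a b) : a ≠ b ∧ b ≠ a ∧ a ≠ b.opp ∧ b ≠ a.opp ∧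
    b.opp ≠ a ∧ a.opp ≠ b ∧ a ≠ a.opp ∧ b ≠ b.opp ∧ a.opp ≠ a ∧ b.opp ≠ b ∧
    a.opp ≠ b.opp ∧ b.opp ≠ a.opp := by
  have h1 := h.1
  have h2 := h.2
  have ha := a.ne_zero
  have hb := b.ne_zero
  simp only [ne_eq, Idx.ext_iff', Idx.coe_opp]
  omega

lemma rootMatrix_mul {a b : Idx n} (h : IsRootPair a b) (c d : K) :
    rootMatrix a b c * rootMatrix a b d = rootMatrix a b (c + d) := by
  obtain ⟨h1, h2, h3, h4, h5, h6, h7, h8, h9, h10, h11, h12⟩ := h.ne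
  refine Matrix.ext_of_mulVec_single fun i => funext fun z => ?_
  rw [← Matrix.mulVec_mulVec]
  generalize (Pi.single i 1 : Idx n → K) = x
  simp only [rootMatrix_mulVec, h1, h3, h7, h12, h10, h5, if_false]
  split_ifs <;> ring

lemma rootMatrix_zero (a b : Idx n) : rootMatrix a b (0 : K) = 1 := by
  refine Matrix.ext_of_mulVec_single fun i => funext fun z => ?_
  rw [Matrix.one_mulVec, rootMatrix_mulVec]
  simp

/-- The elements of the root subgroups. -/
def rootElt {a b : Idx n} (h : IsRootPair a b) (c : K) : GeneralLinearGroup (Idx n) K where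
  val := rootMatrix a b c
  inv := rootMatrix a b (-c)
  val_inv := by rw [rootMatrix_mul h, add_neg_cancel, rootMatrix_zero]
  inv_val := by rw [rootMatrix_mul h, neg_add_cancel, rootMatrix_zero]

lemma rootElt_mulVec {a b : Idx n} (h : IsRootPair a b) (c : K) (x : Idx n → K) (z : Idx n) :
    ((rootElt h c).1 *ᵥ x) z = x z + (if z = b then c * x a else 0) -
      (if z = a.opp then c * x b.opp else 0) := rootMatrix_mulVec a b c x z

lemma rootElt_mul {a b : Idx n} (h : IsRootPair a b) (c d : K) :
    rootElt h c * rootElt h d = rootElt h (c + d) := Units.ext (rootMatrix_mul h c d)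

lemma rootElt_zero {a b : Idx n} (h : IsRootPair a b) : rootElt h (0 : K) = 1 :=
  Units.ext (rootMatrix_zero a b)

lemma rootElt_inv {a b : Idx n} (h : IsRootPair a b) (c : K) :
    (rootElt h c)⁻¹ = rootElt h (-c) := by
  rw [inv_eq_iff_mul_eq_one, rootElt_mul, add_neg_cancel, rootElt_zero]

lemma permRep_mul_rootElt {a b : Idx n} (h : IsRootPair a b) {w : Equiv.Perm (Idx n)}
    (hw : IsOdd w) (c : K) :
    permRep K w * rootElt h c = rootElt (h.map hw) c * permRep K w := by
  refine gl_ext_mulVec fun x => funext fun z => ?_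
  rw [gl_mul_mulVec, gl_mul_mulVec, permRep_mulVec, rootElt_mulVec, rootElt_mulVec]
  rw [← hw a, ← hw b]
  simp only [permRep_mulVec, inv_coe_apply, Equiv.Perm.inv_eq_iff_eq]

lemma rootElt_opp {a b : Idx n} (h : IsRootPair a b) (c : K) :
    rootElt h.opp c = rootElt h.symm (-c) := by
  refine gl_ext_mulVec fun x => funext fun z => ?_
  rw [rootElt_mulVec, rootElt_mulVec]
  simp only [Idx.opp_opp]
  split_ifs <;> ring

/-- Invertible diagonal matrices. -/
def diagElt (d : Idx n → K) (hd : ∀ z, d z ≠ 0) : GeneralLinearGroup (Idx n) K where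
  val := Matrix.diagonal d
  inv := Matrix.diagonal fun z => (d z)⁻¹
  val_inv := by simp [Matrix.diagonal_mul_diagonal, hd]
  inv_val := by simp [Matrix.diagonal_mul_diagonal, hd]

lemma diagElt_mulVec (d : Idx n → K) (hd : ∀ z, d z ≠ 0) (x : Idx n → K) (z : Idx n) :
    ((diagElt d hd).1 *ᵥ x) z = d z * x z := Matrix.mulVec_diagonal d x z

/-- The diagonal torus of the orthogonal group. -/
def IsTorus (g : GeneralLinearGroup (Idx n) K) : Prop :=
  ∃ (d : Idx n → K) (hd : ∀ z, d z ≠ 0), (∀ z, d z * d z.opp = 1) ∧ g = diagElt d hd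

lemma rootRefl_apply_eq {a b : Idx n} (h : IsRootPair a b) (x : Idx n) : rootRefl a b x =
    if x = a then b else if x = b then a else if x = a.opp then b.opp
      else if x = b.opp then a.opp else x := by
  rw [Idx.ext_iff', coe_rootRefl h.1 (by have := h.2; omega)]
  simp only [Idx.ext_iff', Idx.coe_opp]
  split_ifs <;> simp

/-- The rank-one relation of `SL_2`, which expresses a lower unipotent matrix with entry `c ≠ 0` by
upper unipotent matrices with entry `c⁻¹`, a torus element and the reflection. It puts root curves
into cells and glues the two charts of `P_s/B`. -/
lemma rootElt_eq {a b : Idx n} (h : IsRootPair a b) {c : K} (hc : c ≠ 0) :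
    ∃ d, IsTorus d ∧ rootElt h c =
      rootElt h.symm c⁻¹ * (d * permRep K (rootRefl a b)) * rootElt h.symm c⁻¹ := by
  have hr := rootRefl_apply_eq h
  have hne := h.ne
  obtain ⟨h1, h2, h3, h4, h5, h6, h7, h8, h9, h10, h11, h12⟩ := h.ne
  -- These are the nonzero entries of the monomial matrix obtained by multiplying `rootElt h c` on
  -- both sides with `rootElt h.symm (-c⁻¹)`.
  let d : Idx n → K := fun z => if z = b then c else if z = a then -c⁻¹ else
    if z = b.opp then c⁻¹ else if z = a.opp then -c else 1
  have hd : ∀ z, d z ≠ 0 := by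
    intro z
    simp only [d]
    split_ifs <;> simp [hc]
  refine ⟨diagElt d hd, ⟨d, hd, ?_, rfl⟩, ?_⟩
  · intro z
    have hb : z.opp = b ↔ z = b.opp := by rw [← Idx.opp_inj, Idx.opp_opp]
    have ha : z.opp = a ↔ z = a.opp := by rw [← Idx.opp_inj, Idx.opp_opp]
    simp only [d, hb, ha, Idx.opp_inj]
    split_ifs <;> simp_all
  · suffices H : rootElt h.symm (-c⁻¹) * rootElt h c * rootElt h.symm (-c⁻¹) =
        diagElt d hd * permRep K (rootRefl a b) by
      rw [← H, ← rootElt_inv]; group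
    refine gl_ext_mulVec fun x => funext fun z => ?_
    rw [gl_mul_mulVec, gl_mul_mulVec, gl_mul_mulVec, diagElt_mulVec, permRep_mulVec, rootRefl_inv,
      hr]
    simp only [rootElt_mulVec, h1, h2, h3, h4, h5, h6, h7, h8, h9, h10, h11, h12, if_false, if_true,
      d]
    split_ifs <;> first | (subst_vars; contradiction) | skip
    all_goals (subst_vars; field_simp) <;> ring

/-- The quadratic form. -/
def quadForm (x : Idx n → K) : K :=
  ∑ k ∈ Finset.univ.filter (fun k : Idx n => 0 < (k : ℤ)), x k * x k.opp

lemma mem_orthogonalGroup_iff {g : GeneralLinearGroup (Idx n) K} :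
    g ∈ orthogonalGroup K n ↔ ∀ x, quadForm (g.1 *ᵥ x) = quadForm x := Iff.rfl

lemma sum_pos_pair (a : Idx n) (s : K) :
    (∑ k ∈ Finset.univ.filter (fun k : Idx n => 0 < (k : ℤ)),
      ((if k = a then s else 0) + (if k = a.opp then s else 0))) = s := by
  rw [Finset.sum_add_distrib, Finset.sum_ite_eq', Finset.sum_ite_eq']
  have ha := a.ne_zero
  simp only [Finset.mem_filter, Finset.mem_univ, true_and, Idx.coe_opp]
  rcases lt_or_gt_of_ne ha with h | h
  · rw [if_neg (by omega), if_pos (by omega), zero_add]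
  · rw [if_pos (by omega), if_neg (by omega), add_zero]

lemma rootElt_mem_orthogonalGroup {a b : Idx n} (h : IsRootPair a b) (c : K) :
    rootElt h c ∈ orthogonalGroup K n := by
  rw [mem_orthogonalGroup_iff]
  intro x
  obtain ⟨h1, h2, h3, h4, h5, h6, h7, h8, h9, h10, h11, h12⟩ := h.ne
  have key : ∀ k : Idx n, ((rootElt h c).1 *ᵥ x) k * ((rootElt h c).1 *ᵥ x) k.opp =
      x k * x k.opp + ((if k = b then c * x a * x b.opp else 0) +
        (if k = b.opp then c * x a * x b.opp else 0)) -
      ((if k = a then c * x a * x b.opp else 0) +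
        (if k = a.opp then c * x a * x b.opp else 0)) := by
    intro k
    have hb : k.opp = b ↔ k = b.opp := by rw [← Idx.opp_inj, Idx.opp_opp]
    have ha : k.opp = a.opp ↔ k = a := Idx.opp_inj
    simp only [rootElt_mulVec, hb, ha]
    split_ifs <;> first | (subst_vars; contradiction) | skip
    all_goals (subst_vars; (try simp only [Idx.opp_opp]); ring)
  simp only [quadForm, key]
  rw [Finset.sum_sub_distrib, Finset.sum_add_distrib, sum_pos_pair, sum_pos_pair, add_sub_cancel_right]

lemma IsTorus.mem_orthogonalGroup {g : GeneralLinearGroup (Idx n) K} (h : IsTorus g) :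
    g ∈ orthogonalGroup K n := by
  obtain ⟨d, hd, h1, rfl⟩ := h
  rw [mem_orthogonalGroup_iff]
  intro x
  simp only [quadForm, diagElt_mulVec]
  refine Finset.sum_congr rfl fun k _ => ?_
  rw [mul_mul_mul_comm, h1, one_mul]

lemma mem_borel_iff {g : GeneralLinearGroup (Idx n) K} :
    g ∈ borel K n ↔ g ∈ orthogonalGroup K n ∧ ∀ i j : Idx n, (i : ℤ) < j → g.1 i j = 0 :=
  Iff.rfl

lemma mem_borelOpp_iff {g : GeneralLinearGroup (Idx n) K} :
    g ∈ borelOpp K n ↔ g ∈ orthogonalGroup K n ∧ ∀ i j : Idx n, (j : ℤ) < i → g.1 i j = 0 :=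
  Iff.rfl

lemma rootElt_apply {a b : Idx n} (h : IsRootPair a b) (c : K) (i j : Idx n) :
    (rootElt h c).1 i j = (if i = j then 1 else 0) + (if i = b then (if j = a then c else 0) else 0)
      - (if i = a.opp then (if j = b.opp then c else 0) else 0) := rfl

lemma rootElt_mem_borel {a b : Idx n} (h : IsRootPair a b) (hlt : (a : ℤ) < b) (c : K) :
    rootElt h c ∈ borel K n := by
  refine mem_borel_iff.2 ⟨rootElt_mem_orthogonalGroup h c, fun i j hij => ?_⟩
  rw [rootElt_apply]
  simp only [Idx.ext_iff', Idx.coe_opp]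
  split_ifs <;> first | omega | simp

lemma rootElt_mem_borelOpp {a b : Idx n} (h : IsRootPair a b) (hlt : (b : ℤ) < a) (c : K) :
    rootElt h c ∈ borelOpp K n := by
  refine mem_borelOpp_iff.2 ⟨rootElt_mem_orthogonalGroup h c, fun i j hij => ?_⟩
  rw [rootElt_apply]
  simp only [Idx.ext_iff', Idx.coe_opp]
  split_ifs <;> first | omega | simp

lemma IsTorus.mem_borel {g : GeneralLinearGroup (Idx n) K} (h : IsTorus g) : g ∈ borel K n := by
  refine mem_borel_iff.2 ⟨h.mem_orthogonalGroup, fun i j hij => ?_⟩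
  obtain ⟨d, hd, h1, rfl⟩ := h
  exact Matrix.diagonal_apply_ne _ (by rw [ne_eq, Idx.ext_iff']; omega)

lemma IsTorus.mem_borelOpp {g : GeneralLinearGroup (Idx n) K} (h : IsTorus g) :
    g ∈ borelOpp K n := by
  refine mem_borelOpp_iff.2 ⟨h.mem_orthogonalGroup, fun i j hij => ?_⟩
  obtain ⟨d, hd, h1, rfl⟩ := h
  exact Matrix.diagonal_apply_ne _ (by rw [ne_eq, Idx.ext_iff']; omega)

lemma IsTorus.conj {g : GeneralLinearGroup (Idx n) K} (h : IsTorus g) {w : Equiv.Perm (Idx n)}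
    (hw : IsOdd w) : IsTorus (permRep K w * g * permRep K w⁻¹) := by
  obtain ⟨d, hd, h1, rfl⟩ := h
  refine ⟨fun z => d (w⁻¹ z), fun z => hd _, fun z => ?_, ?_⟩
  · dsimp only
    rw [hw.inv, h1]
  · refine gl_ext_mulVec fun x => funext fun z => ?_
    rw [gl_mul_mulVec, gl_mul_mulVec, permRep_mulVec, diagElt_mulVec, permRep_mulVec,
      diagElt_mulVec, inv_inv, coe_inv_apply]

lemma permRep_rootRefl_mem {S : Subgroup (GeneralLinearGroup (Idx n) K)} {a b : Idx n}
    (h : IsRootPair a b) (h1 : ∀ c, rootElt h c ∈ S) (h2 : ∀ c, rootElt h.symm c ∈ S)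
    (h3 : ∀ d, IsTorus d → d ∈ S) : permRep K (rootRefl a b) ∈ S := by
  obtain ⟨d, hd, heq⟩ := rootElt_eq h (one_ne_zero (α := K))
  have : permRep K (rootRefl a b) =
      d⁻¹ * ((rootElt h.symm 1⁻¹)⁻¹ * rootElt h 1 * (rootElt h.symm 1⁻¹)⁻¹) := by rw [heq]; group
  rw [this]
  exact mul_mem (inv_mem (h3 d hd)) (mul_mem (mul_mem (inv_mem (h2 _)) (h1 _)) (inv_mem (h2 _)))

lemma permRep_rootRefl_mem_orthogonalGroup (a b : Idx n) :
    permRep K (rootRefl a b) ∈ orthogonalGroup K n := by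
  by_cases h1 : (a : ℤ) = b
  · rw [← Idx.ext_iff'] at h1; subst h1; rw [rootRefl_self, permRep_one]; exact one_mem _
  by_cases h2 : (a : ℤ) + b = 0
  · have : b = a.opp := by rw [Idx.ext_iff', Idx.coe_opp]; omega
    subst this; rw [rootRefl_opp, permRep_one]; exact one_mem _
  have h : IsRootPair a b := ⟨h1, h2⟩
  exact permRep_rootRefl_mem h (rootElt_mem_orthogonalGroup h)
    (rootElt_mem_orthogonalGroup h.symm) fun d hd => hd.mem_orthogonalGroup

lemma rootElt_mem_group {a b : Idx n} (h : IsRootPair a b) (c : K) :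
    rootElt h c ∈ group K n := by
  rcases lt_or_gt_of_ne h.1 with h1 | h1
  · exact Subgroup.mem_sup_left (rootElt_mem_borel h h1 c)
  · exact Subgroup.mem_sup_right (rootElt_mem_borelOpp h h1 c)

lemma permRep_mem_of_generators {S : Subgroup (GeneralLinearGroup (Idx n) K)} (w : weylGroup n)
    (hS : ∀ i, ∀ a b : Idx n, IsSimplePair i a b → permRep K (rootRefl a b) ∈ S) :
    permRep K w.1 ∈ S := by
  obtain ⟨w, hw⟩ := w
  induction hw using Subgroup.closure_induction with
  | mem x hx =>
    obtain ⟨i, -, hi1, hi2, a, b, hab, rfl⟩ := hx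
    exact hS i a b ⟨hi1, hi2, hab⟩
  | one => rw [permRep_one]; exact one_mem _
  | mul x y hx hy h1 h2 => rw [permRep_mul]; exact mul_mem h1 h2
  | inv x hx h => rw [permRep_inv]; exact inv_mem h

lemma permRep_mem_group (w : weylGroup n) : permRep K w.1 ∈ group K n :=
  permRep_mem_of_generators w fun _ _ _ h => permRep_rootRefl_mem h.isRootPair
    (rootElt_mem_group _) (rootElt_mem_group _) fun _ hd => Subgroup.mem_sup_left hd.mem_borel

lemma borel_le_parabolic (r : ℕ) : borel K n ≤ parabolic K n r := le_sup_left

lemma parabolic_le_group (r : ℕ) : parabolic K n r ≤ group K n := by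
  refine sup_le le_sup_left ((Subgroup.closure_le _).2 ?_)
  rintro _ ⟨_, ⟨i, -, -, -, a, b, -, rfl⟩, rfl⟩
  exact permRep_mem_group (rf a b)

/-! Elimination in the Borel subgroup -/

lemma gl_diag_ne_zero {g : GeneralLinearGroup (Idx n) K} (hg : g ∈ borel K n) (i : Idx n) :
    g.1 i i ≠ 0 := by
  have h1 := (mem_borel_iff.1 hg).2
  have h2 := (mem_borel_iff.1 (inv_mem hg)).2
  have h3 : (g.1 * g⁻¹.1) i i = 1 := by rw [← Units.val_mul, mul_inv_cancel]; simp
  rw [Matrix.mul_apply, Finset.sum_eq_single i] at h3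
  · intro h0; rw [h0, zero_mul] at h3; exact zero_ne_one h3
  · intro k _ hk
    rw [ne_eq, Idx.ext_iff'] at hk
    rcases lt_or_gt_of_ne hk with h | h
    · rw [h2 k i h, mul_zero]
    · rw [h1 i k h, zero_mul]
  · simp

/-- The polar form of the quadratic form. -/
def polarForm (x y : Idx n → K) : K :=
  ∑ k ∈ Finset.univ.filter (fun k : Idx n => 0 < (k : ℤ)), (x k * y k.opp + y k * x k.opp)

lemma quadForm_add (x y : Idx n → K) : quadForm (x + y) = quadForm x + quadForm y + polarForm x y := by
  simp only [quadForm, polarForm, ← Finset.sum_add_distrib, Pi.add_apply]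
  exact Finset.sum_congr rfl fun k _ => by ring

lemma polarForm_mulVec {g : GeneralLinearGroup (Idx n) K} (hg : g ∈ orthogonalGroup K n)
    (x y : Idx n → K) : polarForm (g.1 *ᵥ x) (g.1 *ᵥ y) = polarForm x y := by
  rw [mem_orthogonalGroup_iff] at hg
  have h := hg (x + y)
  rw [Matrix.mulVec_add, quadForm_add, quadForm_add, hg, hg] at h
  exact add_left_cancel h

/-- Isotropy of the columns comes from the quadratic form itself. The polar form alone would not
give it in characteristic 2. -/
lemma quadForm_col {g : GeneralLinearGroup (Idx n) K} (hg : g ∈ orthogonalGroup K n) (i : Idx n) :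
    quadForm (fun k => g.1 k i) = 0 := by
  have h := hg (Pi.single i 1)
  rw [Matrix.mulVec_single_one] at h
  change quadForm (g.1.col i) = quadForm (Pi.single i 1) at h
  refine Eq.trans h ?_
  refine Finset.sum_eq_zero fun k _ => ?_
  by_cases hk : k = i
  · subst hk; rw [Pi.single_eq_of_ne (Idx.opp_ne k), mul_zero]
  · rw [Pi.single_eq_of_ne hk, zero_mul]

lemma polarForm_col {g : GeneralLinearGroup (Idx n) K} (hg : g ∈ orthogonalGroup K n) {i j : Idx n}
    (hij : (i : ℤ) + j ≠ 0) :
    polarForm (fun k => g.1 k i) (fun k => g.1 k j) = 0 := by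
  have h := polarForm_mulVec hg (Pi.single i 1) (Pi.single j 1)
  rw [Matrix.mulVec_single_one, Matrix.mulVec_single_one] at h
  refine Eq.trans h ?_
  refine Finset.sum_eq_zero fun k _ => ?_
  have h1 : ∀ k : Idx n, (Pi.single i 1 : Idx n → K) k * (Pi.single j 1 : Idx n → K) k.opp = 0 := by
    intro k
    by_cases hk : k = i
    · subst hk
      rw [Pi.single_eq_of_ne (M := fun _ => K) (i := j), mul_zero]
      rw [ne_eq, Idx.ext_iff', Idx.coe_opp]; omega
    · rw [Pi.single_eq_of_ne hk, zero_mul]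
  have h2 := h1 k.opp
  rw [Idx.opp_opp] at h2
  rw [h1, mul_comm, h2, add_zero]

/-- Elements of `B` have no entry at `(1, -1)`. -/
lemma borel_apply_one_neg_one {g : GeneralLinearGroup (Idx n) K} (hg : g ∈ borel K n) {i : Idx n}
    (hi : (i : ℤ) = 1) : g.1 i i.opp = 0 := by
  obtain ⟨h1, h2⟩ := mem_borel_iff.1 hg
  have h3 := quadForm_col h1 i.opp
  rw [quadForm, Finset.sum_eq_single i] at h3
  · exact (mul_eq_zero.1 h3).resolve_right (gl_diag_ne_zero hg _)
  · intro k hk hki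
    simp only [Finset.mem_filter, Finset.mem_univ, true_and] at hk
    rw [ne_eq, Idx.ext_iff'] at hki
    rw [h2 k.opp i.opp (by simp only [Idx.coe_opp]; omega), mul_zero]
  · intro h; simp [hi] at h

/-- Conjugation by the reflection permutes the entries. An entry required to vanish comes from
another such entry, except for the one coming from `(b, a)`, its mirror image `(-a, -b)`, and
entries `(k, -k)` at the special node. The last two kinds vanish by orthogonality. -/
lemma borel_conj_simple {g : GeneralLinearGroup (Idx n) K} (hg : g ∈ borel K n) {i : ℕ}
    {a b : Idx n} (h : IsSimplePair i a b) (h0 : g.1 b a = 0) :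
    permRep K (rootRefl a b) * g * permRep K (rootRefl a b) ∈ borel K n := by
  have ht := permRep_rootRefl_mem_orthogonalGroup (K := K) a b
  obtain ⟨h1, h2⟩ := mem_borel_iff.1 hg
  have hc := h.cases
  have hb0 := b.le_n
  refine mem_borel_iff.2 ⟨mul_mem (mul_mem ht h1) ht, fun x y hxy => ?_⟩
  have hval : (permRep K (rootRefl a b) * g * permRep K (rootRefl a b)).1 x y =
      g.1 (rootRefl a b x) (rootRefl a b y) := by
    have : (permRep K (rootRefl a b) * g * permRep K (rootRefl a b)).1 x y =
      ((permRep K (rootRefl a b) * g * permRep K (rootRefl a b)).1 *ᵥ (Pi.single y 1)) x := by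
      rw [Matrix.mulVec_single_one]; rfl
    rw [this, gl_mul_mulVec, gl_mul_mulVec, permRep_mulVec, rootRefl_inv]
    have h3 : (permRep K (rootRefl a b)).1 *ᵥ Pi.single y 1 =
        Pi.single (rootRefl a b y) (1 : K) := by
      funext z
      rw [permRep_mulVec, rootRefl_inv]
      simp only [Pi.single_apply]
      congr 1
      rw [eq_iff_iff, ← (rootRefl a b).injective.eq_iff, ← Equiv.Perm.mul_apply, rootRefl_mul_self]
      rfl
    rw [h3, Matrix.mulVec_single_one]; rfl
  rw [hval]
  -- the remaining special entries
  have hadd := h.add_pos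
  have hlt := h.lt
  -- The columns `a` and `-b` are orthogonal. After triangularity and `h0`, their polar form is the
  -- product of this entry with a nonzero diagonal entry.
  have hn0 : g.1 a.opp b.opp = 0 := by
    have h3 := polarForm_col h1 (i := a) (j := b.opp) (by rw [Idx.coe_opp]; omega)
    rcases hc with ⟨-, ha, hb⟩ | ⟨hi2, ha, hb⟩
    · rw [polarForm, Finset.sum_eq_single a.opp] at h3
      · rw [Idx.opp_opp] at h3
        have h4 := borel_apply_one_neg_one hg (i := a.opp) (by rw [Idx.coe_opp]; omega)
        rw [Idx.opp_opp] at h4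
        rw [h4, zero_mul, zero_add] at h3
        exact (mul_eq_zero.1 h3).resolve_right (gl_diag_ne_zero hg _)
      · intro k hk hki
        simp only [Finset.mem_filter, Finset.mem_univ, true_and] at hk
        rw [ne_eq, Idx.ext_iff', Idx.coe_opp] at hki
        have e2 : g.1 k.opp a = 0 := h2 _ _ (by rw [Idx.coe_opp]; omega)
        by_cases hk2 : k = b
        · subst hk2; rw [h0, zero_mul, e2, mul_zero, add_zero]
        · rw [Idx.ext_iff'] at hk2
          rw [e2, h2 k.opp b.opp (by simp only [Idx.coe_opp]; omega), mul_zero, mul_zero, add_zero]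
      · intro hk; simp [ha] at hk
    · rw [polarForm, Finset.sum_eq_single a] at h3
      · rw [h2 a.opp a (by rw [Idx.coe_opp]; omega), mul_zero, add_zero] at h3
        exact (mul_eq_zero.1 h3).resolve_left (gl_diag_ne_zero hg _)
      · intro k hk hki
        simp only [Finset.mem_filter, Finset.mem_univ, true_and] at hk
        rw [ne_eq, Idx.ext_iff'] at hki
        rw [h2 k.opp a (by rw [Idx.coe_opp]; omega), mul_zero, add_zero]
        rcases lt_trichotomy (k : ℤ) a with hk2 | hk2 | hk2
        · rw [h2 k a hk2, zero_mul]
        · omega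
        · by_cases hk3 : k = b
          · subst hk3; rw [h0, zero_mul]
          · rw [Idx.ext_iff'] at hk3
            rw [h2 k.opp b.opp (by simp only [Idx.coe_opp]; omega), mul_zero]
      · intro hk
        have := a.ne_zero
        simp only [Finset.mem_filter, Finset.mem_univ, true_and] at hk
        omega
  by_cases hflip : (rootRefl a b x : ℤ) < rootRefl a b y
  · exact h2 _ _ hflip
  by_cases hsum : (x : ℤ) + y = 0
  · -- entries `(2, -2)` and `(1, -1)` for the special node
    have hy : y = x.opp := by rw [Idx.ext_iff', Idx.coe_opp]; omega
    subst hy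
    have hx0 := x.ne_zero
    rw [isOdd_rootRefl] at hflip ⊢
    have hr := coe_rootRefl (a := a) (b := b) h.lt.ne (by omega) x
    rw [Idx.coe_opp] at hflip hxy
    have hsp : (a : ℤ) = -1 ∧ (b : ℤ) = 2 := by
      split_ifs at hr <;> omega
    have hz : (rootRefl a b x : ℤ) = 1 ∨ (rootRefl a b x : ℤ) = 2 := by
      split_ifs at hr <;> omega
    rcases hz with hz | hz
    · exact borel_apply_one_neg_one hg hz
    · have hzb : rootRefl a b x = b := by rw [Idx.ext_iff']; omega
      rw [hzb]
      have h3 := quadForm_col h1 b.opp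
      rw [quadForm, Finset.sum_eq_single b] at h3
      · exact (mul_eq_zero.1 h3).resolve_right (gl_diag_ne_zero hg _)
      · intro k hk hki
        simp only [Finset.mem_filter, Finset.mem_univ, true_and] at hk
        rw [ne_eq, Idx.ext_iff'] at hki
        by_cases hk1 : k = a.opp
        · rw [hk1, hn0, zero_mul]
        · rw [Idx.ext_iff', Idx.coe_opp] at hk1
          rw [h2 k.opp b.opp (by simp only [Idx.coe_opp]; omega), mul_zero]
      · intro h; simp [hsp] at h
  · have hne := perm_coe_ne (rootRefl a b) hxy.ne
    rcases h.flip hxy hsum (by omega) with ⟨rfl, rfl⟩ | ⟨rfl, rfl⟩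
    · rw [rootRefl_left h.lt.ne h.add_pos.ne', rootRefl_right h.lt.ne h.add_pos.ne']
      exact h0
    · rw [isOdd_rootRefl, isOdd_rootRefl, rootRefl_left h.lt.ne h.add_pos.ne',
        rootRefl_right h.lt.ne h.add_pos.ne']
      exact hn0

lemma borel_elimination {g : GeneralLinearGroup (Idx n) K} (hg : g ∈ borel K n) {i : ℕ}
    {a b : Idx n} (h : IsSimplePair i a b) : ∃ c, permRep K (rootRefl a b) *
      (g * rootElt h.isRootPair c) * permRep K (rootRefl a b) ∈ borel K n := by
  -- The parameter solves `g b a + c * g b b = 0`, which is the entry `(b, a)` of the product.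
  refine ⟨-(g.1 b a) / g.1 b b, borel_conj_simple
    (mul_mem hg (rootElt_mem_borel h.isRootPair h.lt _)) h ?_⟩
  have h1 := gl_diag_ne_zero hg b
  have h2 := h.isRootPair.ne
  have h3 : ∀ c : K, ∀ k, (rootElt h.isRootPair c).1 k a =
      (if k = a then 1 else 0) + (if k = b then c else 0) := fun c k => by
    simp [rootElt_apply, h2]
  rw [Units.val_mul, Matrix.mul_apply, Finset.sum_congr rfl fun k _ => by rw [h3, mul_add]]
  rw [Finset.sum_add_distrib]
  simp only [mul_ite, mul_one, mul_zero, Finset.sum_ite_eq', Finset.mem_univ, if_true]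
  rw [mul_div_cancel₀ _ h1, add_neg_cancel]

/-- The permutation `x ↦ -x`. -/
def oppPerm (n : ℕ) : Equiv.Perm (Idx n) where
  toFun := Idx.opp
  invFun := Idx.opp
  left_inv := Idx.opp_opp
  right_inv := Idx.opp_opp

lemma oppPerm_isOdd : IsOdd (oppPerm n) := fun _ => rfl

lemma oppPerm_mul_self : oppPerm n * oppPerm n = 1 := Equiv.ext Idx.opp_opp

lemma permRep_oppPerm_mem : permRep K (oppPerm n) ∈ orthogonalGroup K n := by
  intro x
  refine Finset.sum_congr rfl fun k _ => ?_
  rw [permRep_mulVec, permRep_mulVec, mul_comm, oppPerm_isOdd.inv]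
  have : (oppPerm n)⁻¹ k = k.opp := rfl
  rw [this, Idx.opp_opp]

lemma oppConj_apply (g : GeneralLinearGroup (Idx n) K) (x y : Idx n) :
    (permRep K (oppPerm n) * g * permRep K (oppPerm n)).1 x y = g.1 x.opp y.opp := by
  have h1 : (permRep K (oppPerm n) * g * permRep K (oppPerm n)).1 x y =
      ((permRep K (oppPerm n) * g * permRep K (oppPerm n)).1 *ᵥ (Pi.single y 1)) x := by
    rw [Matrix.mulVec_single_one]; rfl
  have h3 : (permRep K (oppPerm n)).1 *ᵥ Pi.single y 1 = Pi.single y.opp (1 : K) := by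
    funext z
    rw [permRep_mulVec]
    simp only [Pi.single_apply]
    congr 1
    rw [eq_iff_iff, ← Idx.opp_inj]
    exact Iff.of_eq (congrArg (· = y.opp) z.opp_opp)
  rw [h1, gl_mul_mulVec, gl_mul_mulVec, permRep_mulVec, h3, Matrix.mulVec_single_one]; rfl

lemma oppConj_mem_borel_iff {g : GeneralLinearGroup (Idx n) K} :
    permRep K (oppPerm n) * g * permRep K (oppPerm n) ∈ borel K n ↔ g ∈ borelOpp K n := by
  have hm := permRep_oppPerm_mem (K := K) (n := n)
  rw [mem_borel_iff, mem_borelOpp_iff, Subgroup.mul_mem_cancel_right _ hm,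
    Subgroup.mul_mem_cancel_left _ hm]
  refine and_congr_right fun _ => ⟨fun h i j hij => ?_, fun h i j hij => ?_⟩
  · have := h i.opp j.opp (by simpa using hij)
    rwa [oppConj_apply, Idx.opp_opp, Idx.opp_opp] at this
  · rw [oppConj_apply]
    exact h _ _ (by simpa using hij)

lemma permRep_oppPerm_mul_self : permRep K (oppPerm n) * permRep K (oppPerm n) = 1 := by
  rw [← permRep_mul, oppPerm_mul_self, permRep_one]

/-- Conjugation by `x ↦ -x` exchanges `B` and `B⁻`, commutes with the reflection and turns a root
element into one for the negative root. Only orthogonality of this permutation matrix is used, not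
membership in the Weyl group. -/
lemma borelOpp_elimination {g : GeneralLinearGroup (Idx n) K} (hg : g ∈ borelOpp K n) {i : ℕ}
    {a b : Idx n} (h : IsSimplePair i a b) : ∃ c, permRep K (rootRefl a b) *
      (g * rootElt h.isRootPair.symm c) * permRep K (rootRefl a b) ∈ borelOpp K n := by
  set ν := permRep K (oppPerm n) with hν
  have hνν : ν * ν = 1 := permRep_oppPerm_mul_self
  have hg' : ν * g * ν ∈ borel K n := by
    rw [oppConj_mem_borel_iff]; exact hg
  obtain ⟨c, hc⟩ := borel_elimination hg' h
  refine ⟨-c, ?_⟩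
  rw [← oppConj_mem_borel_iff, ← hν]
  have h1 : ν * permRep K (rootRefl a b) = permRep K (rootRefl a b) * ν := by
    rw [hν, ← permRep_mul, ← permRep_mul]
    congr 1
    ext x
    exact congrArg Subtype.val (isOdd_rootRefl a b x).symm
  have h2 : ν * rootElt h.isRootPair c = rootElt h.isRootPair.symm (-c) * ν := by
    rw [← rootElt_opp h.isRootPair, hν, permRep_mul_rootElt _ oppPerm_isOdd]; rfl
  have : ν * (permRep K (rootRefl a b) * (g * rootElt h.isRootPair.symm (-c)) *
      permRep K (rootRefl a b)) * ν = permRep K (rootRefl a b) *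
        ((ν * g * ν) * rootElt h.isRootPair c) * permRep K (rootRefl a b) := by
    have e1 : rootElt h.isRootPair c = ν * (rootElt h.isRootPair.symm (-c) * ν) := by
      rw [← h2, ← mul_assoc, hνν, one_mul]
    calc _ = (ν * permRep K (rootRefl a b)) * (g * rootElt h.isRootPair.symm (-c)) *
          (permRep K (rootRefl a b) * ν) := by group
      _ = (permRep K (rootRefl a b) * ν) * (g * (ν * ν) * rootElt h.isRootPair.symm (-c)) *
          (ν * permRep K (rootRefl a b)) := by rw [h1, hνν, mul_one]
      _ = permRep K (rootRefl a b) * ((ν * g * ν) * (ν * (rootElt h.isRootPair.symm (-c) * ν))) *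
          permRep K (rootRefl a b) := by group
      _ = _ := by rw [← e1]
  rw [this]
  exact hc

end MatrixGroup

end TypeD

end

/-! ### Closures of cells and nonempty Richardson varieties. -/

section

namespace TypeD

variable {n : ℕ}

section Closures

open Matrix

variable {K : Type*} [Field K]

/-- The matrix entries as a point of affine space. -/
def entries (g : GeneralLinearGroup (Idx n) K) : Idx n × Idx n → K := fun p => g.1 p.1 p.2

/-- The Zariski closure in the general linear group. -/
def glClosure (S : Set (GeneralLinearGroup (Idx n) K)) : Set (GeneralLinearGroup (Idx n) K) :=
  {g | entries g ∈ zariskiClosure (entries '' S)}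

lemma subset_glClosure (S : Set (GeneralLinearGroup (Idx n) K)) : S ⊆ glClosure S :=
  fun _ hg => subset_zariskiClosure _ (Set.mem_image_of_mem _ hg)

lemma glClosure_minimal {S T : Set (GeneralLinearGroup (Idx n) K)} (h : S ⊆ glClosure T) :
    glClosure S ⊆ glClosure T := fun _ hg => zariskiClosure_idem (by
  rintro _ ⟨s, hs, rfl⟩
  exact h hs) hg

lemma mul_left_mem_glClosure {S T : Set (GeneralLinearGroup (Idx n) K)}
    (h : GeneralLinearGroup (Idx n) K) (H : ∀ s ∈ S, h * s ∈ glClosure T)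
    {g : GeneralLinearGroup (Idx n) K} (hg : g ∈ glClosure S) : h * g ∈ glClosure T := by
  have key : ∀ g : GeneralLinearGroup (Idx n) K, entries (h * g) = fun p => MvPolynomial.eval
      (entries g) (∑ k, MvPolynomial.C (h.1 p.1 k) * MvPolynomial.X (k, p.2)) := fun g => by
    funext p
    simp [entries, Matrix.mul_apply]
  change entries (h * g) ∈ zariskiClosure _
  rw [key]
  refine map_zariskiClosure _ ?_ hg
  rintro _ ⟨s, hs, rfl⟩
  rw [← key]
  exact H s hs

lemma mul_right_mem_glClosure {S T : Set (GeneralLinearGroup (Idx n) K)}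
    (h : GeneralLinearGroup (Idx n) K) (H : ∀ s ∈ S, s * h ∈ glClosure T)
    {g : GeneralLinearGroup (Idx n) K} (hg : g ∈ glClosure S) : g * h ∈ glClosure T := by
  have key : ∀ g : GeneralLinearGroup (Idx n) K, entries (g * h) = fun p => MvPolynomial.eval
      (entries g) (∑ k, MvPolynomial.X (p.1, k) * MvPolynomial.C (h.1 k p.2)) := fun g => by
    funext p
    simp [entries, Matrix.mul_apply]
  change entries (g * h) ∈ zariskiClosure _
  rw [key]
  refine map_zariskiClosure _ ?_ hg
  rintro _ ⟨s, hs, rfl⟩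
  rw [← key]
  exact H s hs

/-- The set `H w P_r`. -/
def glCell (r : ℕ) (H : Subgroup (GeneralLinearGroup (Idx n) K)) (w : weylGroup n) :
    Set (GeneralLinearGroup (Idx n) K) :=
  {g | ∃ b ∈ H, ∃ p ∈ parabolic K n r, g = b * permRep K w.1 * p}

variable {r : ℕ} {H : Subgroup (GeneralLinearGroup (Idx n) K)}

lemma mul_left_mem_closure_cell {w : weylGroup n} {h : GeneralLinearGroup (Idx n) K} (hh : h ∈ H)
    {g : GeneralLinearGroup (Idx n) K} (hg : g ∈ glClosure (glCell r H w)) :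
    h * g ∈ glClosure (glCell r H w) := by
  refine mul_left_mem_glClosure h ?_ hg
  rintro _ ⟨b, hb, p, hp, rfl⟩
  exact subset_glClosure _ ⟨h * b, mul_mem hh hb, p, hp, by group⟩

lemma mul_left_mem_closure_cell_iff {w : weylGroup n} {h : GeneralLinearGroup (Idx n) K}
    (hh : h ∈ H) {g : GeneralLinearGroup (Idx n) K} :
    h * g ∈ glClosure (glCell r H w) ↔ g ∈ glClosure (glCell r H w) :=
  ⟨fun hg => by simpa using mul_left_mem_closure_cell (inv_mem hh) hg,
    mul_left_mem_closure_cell hh⟩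

lemma mul_right_mem_closure_cell {w : weylGroup n} {h : GeneralLinearGroup (Idx n) K}
    (hh : h ∈ parabolic K n r) {g : GeneralLinearGroup (Idx n) K}
    (hg : g ∈ glClosure (glCell r H w)) : g * h ∈ glClosure (glCell r H w) := by
  refine mul_right_mem_glClosure h ?_ hg
  rintro _ ⟨b, hb, p, hp, rfl⟩
  exact subset_glClosure _ ⟨b, hb, p * h, mul_mem hp hh, by group⟩

lemma permRep_mem_cell (w : weylGroup n) : permRep K w.1 ∈ glCell r H w :=
  ⟨1, one_mem _, 1, one_mem _, by group⟩

/-- The closure of a cell is stable under `H` on the left and `P_r` on the right, so one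
representative of a double coset brings in the whole double coset and its closure. -/
lemma closure_cell_subset {u w : weylGroup n}
    (h : permRep K u.1 ∈ glClosure (glCell r H w)) :
    glClosure (glCell r H u) ⊆ glClosure (glCell r H w) := by
  refine glClosure_minimal ?_
  rintro _ ⟨b, hb, p, hp, rfl⟩
  exact mul_right_mem_closure_cell hp (mul_left_mem_closure_cell hb h)

/-- The entries of `rootElt c * g` as polynomials in `c` and the entries of `g`. -/
def rootPoly (a b : Idx n) (p : Idx n × Idx n) :
    Polynomial (MvPolynomial (Idx n × Idx n) K) :=
  Polynomial.C (MvPolynomial.X p) +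
    (if p.1 = b then Polynomial.X * Polynomial.C (MvPolynomial.X (a, p.2)) else 0) -
    (if p.1 = a.opp then Polynomial.X * Polynomial.C (MvPolynomial.X (b.opp, p.2)) else 0)

lemma gl_mul_apply (h g : GeneralLinearGroup (Idx n) K) (i j : Idx n) :
    (h * g).1 i j = (h.1 *ᵥ (fun k => g.1 k j)) i := by
  rw [Units.val_mul, Matrix.mul_apply]; rfl

lemma pointAt_rootPoly {a b : Idx n} (h : IsRootPair a b) (c : K)
    (g : GeneralLinearGroup (Idx n) K) :
    pointAt (rootPoly a b) c (entries g) = entries (rootElt h c * g) := by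
  funext p
  simp only [entries, gl_mul_apply, rootElt_mulVec, pointAt, rootPoly, evalAt, map_add, map_sub]
  congr 2
  · simp [entries]
  · split_ifs <;> simp [entries, mul_comm c]
  · split_ifs <;> simp [entries, mul_comm c]

lemma permRep_mul_permRep_rootRefl (a b : Idx n) :
    permRep K (rootRefl a b) * permRep K (rootRefl a b) = 1 := by
  rw [← permRep_mul, rootRefl_mul_self, permRep_one]

lemma rootRefl_conj_rootElt {a b : Idx n} (h : IsRootPair a b) (c : K) :
    permRep K (rootRefl a b) * rootElt h c * permRep K (rootRefl a b) = rootElt h.symm c := by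
  have hcongr : ∀ {a' b' : Idx n} (h' : IsRootPair a' b'), a' = b → b' = a →
      rootElt h' c = rootElt h.symm c := by
    rintro _ _ h' rfl rfl; rfl
  rw [permRep_mul_rootElt h (isOdd_rootRefl a b), mul_assoc, permRep_mul_permRep_rootRefl, mul_one,
    hcongr _ (rootRefl_left h.1 h.2) (rootRefl_right h.1 h.2)]

/-- The curve `c ↦ U_{ab}(c) u` connects the cells of `t u` and `u`, for the reflection `t`. -/
lemma permRep_mem_closure_cell_rf [IsAlgClosed K] {a b : Idx n} (h : IsRootPair a b)
    (u : weylGroup n) (hroot : ∀ c, rootElt h.symm c ∈ H) (htorus : ∀ d, IsTorus d → d ∈ H)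
    (hu : (u.1⁻¹ b : ℤ) < u.1⁻¹ a) :
    permRep K u.1 ∈ glClosure (glCell r H (rf a b * u)) := by
  have hcurve : ∀ c : K, c ≠ 0 → rootElt h c * permRep K u.1 ∈ glCell r H (rf a b * u) := by
    intro c hc
    obtain ⟨d, hd, heq⟩ := rootElt_eq h hc
    have hodd := weylGroup_isOdd u
    refine ⟨rootElt h.symm c⁻¹ * d, mul_mem (hroot _) (htorus d hd),
      rootElt (h.symm.map hodd.inv) c⁻¹,
      borel_le_parabolic r (rootElt_mem_borel _ hu _), ?_⟩
    have h1 := permRep_mul_rootElt h.symm hodd.inv c⁻¹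
    have h2 : rootElt h.symm c⁻¹ * permRep K u.1 =
        permRep K u.1 * rootElt (h.symm.map hodd.inv) c⁻¹ := by
      rw [permRep_inv] at h1
      rw [← mul_inv_eq_iff_eq_mul] at h1
      rw [← h1]; group
    rw [heq, Subgroup.coe_mul, permRep_mul, coe_rf, mul_assoc, h2]
    group
  intro F hF
  have hG : (MvPolynomial.aeval (rootPoly a b) F).map (MvPolynomial.eval (entries (permRep K u.1)))
      = 0 := by
    have h1 : ∀ c : K, c ≠ 0 → ((MvPolynomial.aeval (rootPoly a b) F).map
        (MvPolynomial.eval (entries (permRep K u.1)))).eval c = 0 := by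
      intro c hc
      rw [← evalAt_eq, evalAt_aeval, pointAt_rootPoly h]
      exact hF _ ⟨_, hcurve c hc, rfl⟩
    have : Infinite K := inferInstance
    -- The factor `X` makes the polynomial vanish at 0 too. As `K` is infinite it is then the zero
    -- polynomial, so `F` also vanishes at the limit point `c = 0` of the curve.
    have h2 : Polynomial.X * (MvPolynomial.aeval (rootPoly a b) F).map
        (MvPolynomial.eval (entries (permRep K u.1))) = 0 := by
      refine Polynomial.funext fun c => ?_
      by_cases hc : c = 0
      · simp [hc]
      · rw [Polynomial.eval_mul, h1 c hc, mul_zero, Polynomial.eval_zero]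
    exact (mul_eq_zero.1 h2).resolve_left Polynomial.X_ne_zero
  have h3 : MvPolynomial.eval (pointAt (rootPoly a b) 0 (entries (permRep K u.1))) F = 0 := by
    rw [← evalAt_aeval, evalAt_eq, hG, Polynomial.eval_zero]
  rwa [pointAt_rootPoly h, rootElt_zero, one_mul] at h3

/-- `P_s A` is closed if `A` is the closure of a cell. -/
lemma glClosure_projection [IsAlgClosed K] {i : ℕ} {a b : Idx n} (h : IsSimplePair i a b)
    (w : weylGroup n) {S : Set (GeneralLinearGroup (Idx n) K)}
    (hS : ∀ g ∈ S, (∃ c, rootElt h.isRootPair.symm c * g ∈ glClosure (glCell r (borel K n) w)) ∨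
      permRep K (rootRefl a b) * g ∈ glClosure (glCell r (borel K n) w))
    {g : GeneralLinearGroup (Idx n) K} (hg : g ∈ glClosure S) :
    (∃ c, rootElt h.isRootPair.symm c * g ∈ glClosure (glCell r (borel K n) w)) ∨
      permRep K (rootRefl a b) * g ∈ glClosure (glCell r (borel K n) w) := by
  -- The two charts of the projective line `B\P_s` are `c ↦ U_{ba}(c)` and `c ↦ s U_{ab}(c)`; the
  -- point missing from the first is `s`, at `c = 0` in the second.
  let ψ₁ : Idx n × Idx n → Polynomial (MvPolynomial (Idx n × Idx n) K) :=
    fun p => rootPoly a b (rootRefl a b p.1, p.2)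
  have hψ₁ : ∀ (c : K) (g : GeneralLinearGroup (Idx n) K), pointAt ψ₁ c (entries g) =
      entries (permRep K (rootRefl a b) * (rootElt h.isRootPair c * g)) := by
    intro c g
    funext p
    have h1 := congrFun (pointAt_rootPoly h.isRootPair c g) (rootRefl a b p.1, p.2)
    refine Eq.trans h1 ?_
    simp only [entries]
    rw [gl_mul_apply (permRep K (rootRefl a b)), permRep_mulVec, rootRefl_inv]
  have hψ₀ := fun (c : K) (g : GeneralLinearGroup (Idx n) K) =>
    pointAt_rootPoly h.isRootPair.symm c g
  have key := mem_of_mem_zariskiClosure_projection (Set.range entries)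
    (zariskiClosure (entries '' glCell r (borel K n) w)) (zariskiClosure_idem (Set.Subset.refl _))
    (rootPoly b a) ψ₁ ?_ (x₀ := entries g) ⟨g, rfl⟩ ?_
  · simp only [hψ₀, hψ₁, rootElt_zero, one_mul] at key
    exact key
  -- By `rootElt_eq`, `U_{ba}(c)` and `s U_{ab}(c⁻¹)` differ by a left factor in `B`, under which
  -- the closed set is stable.
  · rintro _ ⟨g, rfl⟩ c hc
    obtain ⟨d, hd, heq⟩ := rootElt_eq h.isRootPair.symm hc
    rw [hψ₀, hψ₁]
    change rootElt h.isRootPair.symm c * g ∈ glClosure _ ↔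
      permRep K (rootRefl a b) * (rootElt h.isRootPair c⁻¹ * g) ∈ glClosure _
    rw [heq, rootRefl_comm b a]
    have : rootElt h.isRootPair.symm.symm c⁻¹ * (d * permRep K (rootRefl a b)) *
        rootElt h.isRootPair.symm.symm c⁻¹ * g = (rootElt h.isRootPair c⁻¹ * d) *
        (permRep K (rootRefl a b) * (rootElt h.isRootPair c⁻¹ * g)) := by group
    rw [this, mul_left_mem_closure_cell_iff
      (mul_mem (rootElt_mem_borel _ h.lt _) hd.mem_borel)]
  · refine zariskiClosure_idem ?_ hg
    rintro _ ⟨s, hs, rfl⟩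
    apply subset_zariskiClosure
    refine ⟨⟨s, rfl⟩, ?_⟩
    simp only [hψ₀, hψ₁, rootElt_zero, one_mul]
    exact hS s hs

/-- `B s w P_r` lies in `P_s w P_r`, and the cosets in `P_s/B` are represented by `s` and the
elements of the root subgroup of the negative simple root. -/
lemma cell_projection {i : ℕ} {a b : Idx n} (h : IsSimplePair i a b) (w : weylGroup n)
    {g : GeneralLinearGroup (Idx n) K} (hg : g ∈ glCell r (borel K n) (rf a b * w)) :
    (∃ c, rootElt h.isRootPair.symm c * g ∈ glClosure (glCell r (borel K n) w)) ∨
      permRep K (rootRefl a b) * g ∈ glClosure (glCell r (borel K n) w) := by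
  obtain ⟨g₀, hg₀, p, hp, rfl⟩ := hg
  set t := permRep K (rootRefl a b) with ht
  have htt : t * t = 1 := permRep_mul_permRep_rootRefl a b
  have htinv : t⁻¹ = t := inv_eq_of_mul_eq_one_left htt
  -- The parameter `c` removes from `g₀⁻¹` the component along the simple root, so that `s
  -- U_{ab}(-c) g₀ s` lies in `B`. If `c = 0` then `s` is the required element; otherwise the
  -- rank-one relation replaces it by an element for the negative root.
  obtain ⟨c, hc⟩ := borel_elimination (inv_mem hg₀) h
  have hc' := inv_mem hc
  simp only [_root_.mul_inv_rev, inv_inv, ← ht, htinv, rootElt_inv] at hc'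
  set y := t * (rootElt h.isRootPair (-c) * g₀ * t) with hy
  have hw : permRep K (rf a b * w).1 = t * permRep K w.1 := by
    rw [Subgroup.coe_mul, permRep_mul, coe_rf]
  have hyA : y * permRep K w.1 * p ∈ glClosure (glCell r (borel K n) w) :=
    subset_glClosure _ ⟨y, hc', p, hp, rfl⟩
  have hg₀' : t * (rootElt h.isRootPair (-c) * (g₀ * permRep K (rf a b * w).1 * p)) =
      y * permRep K w.1 * p := by rw [hw, hy]; group
  by_cases h0 : c = 0
  · right
    rw [h0, neg_zero, rootElt_zero, one_mul] at hg₀'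
    rw [hg₀']
    exact hyA
  · left
    have hc0 : -c ≠ 0 := neg_ne_zero.2 h0
    obtain ⟨d, hd, heq⟩ := rootElt_eq h.isRootPair h0
    rw [← ht] at heq
    set g := g₀ * permRep K (rf a b * w).1 * p
    have hg : g = rootElt h.isRootPair c * (t * (y * permRep K w.1 * p)) := by
      rw [← hg₀', ← mul_assoc t, htt, one_mul, ← mul_assoc, rootElt_mul, add_neg_cancel,
        rootElt_zero, one_mul]
    refine ⟨-c⁻¹, ?_⟩
    have hconj := rootRefl_conj_rootElt h.isRootPair.symm c⁻¹
    rw [rootRefl_comm b a, ← ht] at hconj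
    have : rootElt h.isRootPair.symm (-c⁻¹) * g =
        (d * rootElt h.isRootPair c⁻¹) * (y * permRep K w.1 * p) := by
      rw [hg, heq, ← rootElt_inv, ← hconj]; group
    rw [this, mul_left_mem_closure_cell_iff
      (mul_mem hd.mem_borel (rootElt_mem_borel _ h.lt _))]
    exact hyA

/-- If `s v > v`, the closure of `B⁻ v P` is stable under `s`. -/
lemma rootRefl_mul_mem_closure_cell_opp [IsAlgClosed K] {i : ℕ} {a b : Idx n}
    (h : IsSimplePair i a b) {v : weylGroup n} (hv : (v.1⁻¹ a : ℤ) < v.1⁻¹ b)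
    {g : GeneralLinearGroup (Idx n) K} (hg : g ∈ glClosure (glCell r (borelOpp K n) v)) :
    permRep K (rootRefl a b) * g ∈ glClosure (glCell r (borelOpp K n) v) := by
  refine mul_left_mem_glClosure _ ?_ hg
  rintro _ ⟨g₀, hg₀, p, hp, rfl⟩
  set t := permRep K (rootRefl a b) with ht
  have htt : t * t = 1 := permRep_mul_permRep_rootRefl a b
  have htinv : t⁻¹ = t := inv_eq_of_mul_eq_one_left htt
  have hodd := weylGroup_isOdd v
  obtain ⟨c, hc⟩ := borelOpp_elimination hg₀ h
  rw [← ht] at hc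
  set y := t * (g₀ * rootElt h.isRootPair.symm c) * t with hy
  have heq : t * (g₀ * permRep K v.1 * p) =
      y * (t * rootElt h.isRootPair.symm (-c) * permRep K v.1 * p) := by
    have e1 : y * t = t * (g₀ * rootElt h.isRootPair.symm c) := by
      rw [hy, mul_assoc _ t t, htt, mul_one]
    calc _ = t * (g₀ * (rootElt h.isRootPair.symm c * rootElt h.isRootPair.symm (-c))) *
          permRep K v.1 * p := by
            rw [rootElt_mul, add_neg_cancel, rootElt_zero, mul_one]; group
      _ = (y * t) * rootElt h.isRootPair.symm (-c) * permRep K v.1 * p := by rw [e1]; group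
      _ = _ := by group
  rw [heq]
  refine mul_left_mem_closure_cell hc (mul_right_mem_closure_cell hp ?_)
  -- For `c = 0` the element is `s v`, which lies in the closure because `s v > v`. For `c ≠ 0` the
  -- rank-one relation rewrites `s U_{ba}(-c) v` as an element of `B⁻ v B`; the last factor is in
  -- `B` by `hv`.
  by_cases h0 : c = 0
  · rw [h0, neg_zero, rootElt_zero, mul_one]
    have := permRep_mem_closure_cell_rf (r := r) (H := borelOpp K n) h.isRootPair (rf a b * v)
      (rootElt_mem_borelOpp _ h.lt) (fun d hd => hd.mem_borelOpp) (by
        rwa [rf_mul_inv_apply, rf_mul_inv_apply, rootRefl_left h.lt.ne h.add_pos.ne',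
          rootRefl_right h.lt.ne h.add_pos.ne'])
    rwa [rf_mul_cancel, Subgroup.coe_mul, permRep_mul, coe_rf] at this
  · obtain ⟨d, hd, heq⟩ := rootElt_eq h.isRootPair.symm (neg_ne_zero.2 h0)
    rw [rootRefl_comm b a, ← ht] at heq
    have hconj := rootRefl_conj_rootElt h.isRootPair (-c)⁻¹
    rw [← ht] at hconj
    have hd' := hd.conj (isOdd_rootRefl a b)
    rw [rootRefl_inv, ← ht] at hd'
    have h1 := permRep_mul_rootElt h.isRootPair hodd.inv (-c)⁻¹
    have h2 : rootElt h.isRootPair (-c)⁻¹ * permRep K v.1 =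
        permRep K v.1 * rootElt (h.isRootPair.map hodd.inv) (-c)⁻¹ := by
      rw [permRep_inv, ← mul_inv_eq_iff_eq_mul] at h1
      rw [← h1]; group
    have e1 : t * rootElt h.isRootPair.symm (-c) * permRep K v.1 =
        (rootElt h.isRootPair.symm (-c)⁻¹ * (t * d * t)) * permRep K v.1 *
          rootElt (h.isRootPair.map hodd.inv) (-c)⁻¹ := by
      rw [mul_assoc _ (permRep K v.1), ← h2, heq, ← hconj]
      calc _ = t * rootElt h.isRootPair (-c)⁻¹ * 1 * d * t *
            (rootElt h.isRootPair (-c)⁻¹ * permRep K v.1) := by group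
        _ = t * rootElt h.isRootPair (-c)⁻¹ * (t * t) * d * t *
            (rootElt h.isRootPair (-c)⁻¹ * permRep K v.1) := by rw [htt]
        _ = _ := by group
    rw [e1]
    exact subset_glClosure _ ⟨_, mul_mem (rootElt_mem_borelOpp _ h.lt _) hd'.mem_borelOpp, _,
      borel_le_parabolic r (rootElt_mem_borel _ hv _), rfl⟩

/-! The base point -/

/-- The maximal value of the fundamental weight `ω_r`. -/
def topWeight (r : ℕ) : ℝ := if r = 1 ∨ r = 2 then 1 / 2 else 1

lemma fundamentalWeight_cases (hr : 1 ≤ r) (x : Idx n) :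
    fundamentalWeight n r x ≤ topWeight r ∧ (fundamentalWeight n r x = topWeight r ∨
      fundamentalWeight n r x.opp = topWeight r ∨
      (fundamentalWeight n r x = 0 ∧ 0 < topWeight r)) := by
  rw [fundamentalWeight_opp hr, fundamentalWeight_apply hr, topWeight]
  split_ifs <;> first | omega | norm_num

/-- Elements of `B` raise indices and `ω_r` is monotone, except on the pair `(-1, 1)` for `ω_2`;
there the entry vanishes by `borel_apply_one_neg_one`. -/
lemma top_of_borel_apply_ne_zero (hr : 1 ≤ r) {g : GeneralLinearGroup (Idx n) K}
    (hg : g ∈ borel K n) {x y : Idx n} (hx : fundamentalWeight n r x = topWeight r)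
    (h0 : g.1 y x ≠ 0) : fundamentalWeight n r y = topWeight r := by
  have hle := ((fundamentalWeight_cases hr y).1)
  have hyx : ¬ (y : ℤ) < x := fun h => h0 ((mem_borel_iff.1 hg).2 y x h)
  by_cases hxy : (x : ℤ) = y
  · rw [← Subtype.ext hxy]; exact hx
  by_cases hs : (x : ℤ) + y = 0
  · have hx' : x = y.opp := by rw [Idx.ext_iff', Idx.coe_opp]; omega
    subst hx'
    have : (y : ℤ) ≠ 1 := fun h1 => h0 (borel_apply_one_neg_one hg h1)
    have hy0 := y.ne_zero
    have hy1 := y.coe_opp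
    rw [fundamentalWeight_apply hr, topWeight] at hx
    rw [hy1] at hyx
    exfalso
    split_ifs at hx <;> first | omega | norm_num at hx
  · have := fundamentalWeight_mono hr (x := x) (y := y) (by omega) hs
    exact le_antisymm hle (hx ▸ this)

lemma top_of_borelOpp_apply_ne_zero (hr : 1 ≤ r) {g : GeneralLinearGroup (Idx n) K}
    (hg : g ∈ borelOpp K n) {x y : Idx n} (hy : fundamentalWeight n r y = topWeight r)
    (h0 : g.1 y x ≠ 0) : fundamentalWeight n r x = topWeight r := by
  have hle := ((fundamentalWeight_cases hr x).1)
  have hyx : ¬ (x : ℤ) < y := fun h => h0 ((mem_borelOpp_iff.1 hg).2 y x h)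
  by_cases hxy : (x : ℤ) = y
  · rw [Subtype.ext hxy]; exact hy
  by_cases hs : (y : ℤ) + x = 0
  · have hy' : y = x.opp := by rw [Idx.ext_iff', Idx.coe_opp]; omega
    subst hy'
    have : (x : ℤ) ≠ 1 := fun h1 => h0 <| by
      have := borel_apply_one_neg_one (oppConj_mem_borel_iff.2 hg) h1
      rwa [oppConj_apply, Idx.opp_opp] at this
    have hx0 := x.ne_zero
    have hx1 := x.coe_opp
    rw [fundamentalWeight_apply hr, topWeight] at hy
    rw [hx1] at hyx
    exfalso
    split_ifs at hy <;> first | omega | norm_num at hy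
  · have := fundamentalWeight_mono hr (x := y) (y := x) (by omega) hs
    exact le_antisymm hle (hy ▸ this)

/-- `P_r` preserves the span of the `v_x` for which `ω_r` takes its maximal value at `x`. -/
lemma top_of_parabolic_apply_ne_zero (hr : 1 ≤ r) {g : GeneralLinearGroup (Idx n) K}
    (hg : g ∈ parabolic K n r) {x y : Idx n} (hx : fundamentalWeight n r x = topWeight r)
    (h0 : g.1 y x ≠ 0) : fundamentalWeight n r y = topWeight r := by
  classical
  let β : Idx n → ℕ := fun x => if fundamentalWeight n r x = topWeight r then 0 else 1
  have hle : parabolic K n r ≤ triangularGroup K n β := by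
    refine sup_le (fun b hb => ?_) ((Subgroup.closure_le _).2 ?_)
    · intro i j hij
      by_contra hne
      have hj : fundamentalWeight n r j = topWeight r := by
        by_contra hj
        simp only [β, hj] at hij
        split_ifs at hij <;> omega
      have hi := top_of_borel_apply_ne_zero hr hb hj hne
      simp [β, hi, hj] at hij
    · rintro _ ⟨_, ⟨k, hk, h1, h2, a, b, hab, rfl⟩, rfl⟩
      intro i j hij
      rw [permRep_apply, if_neg]
      rintro rfl
      have h3 := congrFun (act_rf_fundamentalWeight hr ⟨h1, h2, hab⟩ hk) (rootRefl a b j)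
      rw [← coe_rf, act_apply_coe, coe_rf] at h3
      simp [β, h3] at hij
  by_contra hy
  exact h0 (hle hg (i := y) (j := x) (by simp [β, hx, hy]))

/-- The minor of `g` for the rows and columns where `ω_r` takes its maximal value. -/
def topMinor (r : ℕ) (g : Matrix (Idx n) (Idx n) K) :
    Matrix {x : Idx n // fundamentalWeight n r x = topWeight r}
      {x : Idx n // fundamentalWeight n r x = topWeight r} K := g.submatrix (↑) (↑)

open Classical in
lemma det_topMinor_ne_zero {g : GeneralLinearGroup (Idx n) K}
    (hg : ∀ x y : Idx n, fundamentalWeight n r x = topWeight r →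
      fundamentalWeight n r y ≠ topWeight r → g.1 y x = 0) : (topMinor r g.1).det ≠ 0 := by
  have h := Matrix.twoBlockTriangular_det g.1 (fun x => fundamentalWeight n r x = topWeight r)
    fun i hi j hj => hg j i hj hi
  have hdet : g.1.det ≠ 0 := ((Matrix.isUnit_iff_isUnit_det _).1 g.isUnit).ne_zero
  rw [h] at hdet
  exact left_ne_zero_of_mul hdet

open Classical in
-- `P_r` preserves the span of the top indices, so the minor of `b v p` is the product of those of
-- `b v` and `p`. A nonzero term in the expansion of the first, with `b` triangular, shows that `v`
-- maps top indices to top indices. By finiteness it permutes them, and they determine `ω_r`, whose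
-- values are the top value, its negative and possibly 0.
lemma act_eq_of_det_topMinor_ne_zero (hr : 1 ≤ r) {v : weylGroup n}
    {g : GeneralLinearGroup (Idx n) K} (hg : g ∈ glCell r (borelOpp K n) v)
    (hdet : (topMinor r g.1).det ≠ 0) :
    act v (fundamentalWeight n r) = fundamentalWeight n r := by
  obtain ⟨b, hb, p, hp, rfl⟩ := hg
  have hprod : topMinor r (b * permRep K v.1 * p).1 =
      topMinor r (b * permRep K v.1).1 * topMinor r p.1 := by
    ext i j
    rw [Matrix.mul_apply, topMinor, Matrix.submatrix_apply, Units.val_mul, Matrix.mul_apply]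
    symm
    refine Finset.sum_of_injOn (fun x => (x : Idx n)) (fun x _ y _ h => Subtype.ext h)
      (fun _ _ => Finset.mem_coe.2 (Finset.mem_univ _)) ?_ (fun _ _ => rfl)
    intro k _ hk
    have : p.1 k j = 0 := by
      by_contra hne
      exact hk ⟨⟨k, top_of_parabolic_apply_ne_zero hr hp j.2 hne⟩, by simp, rfl⟩
    rw [this, mul_zero]
  rw [hprod, Matrix.det_mul] at hdet
  have h1 := left_ne_zero_of_mul hdet
  rw [Matrix.det_apply] at h1
  obtain ⟨σ, -, hσ⟩ := Finset.exists_ne_zero_of_sum_ne_zero h1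
  have h2 : ∀ x, topMinor r (b * permRep K v.1).1 (σ x) x ≠ 0 := fun x h0 => hσ <|
    (congrArg (Equiv.Perm.sign σ • ·) (Finset.prod_eq_zero
      (f := fun i => topMinor r (b * permRep K v.1).1 (σ i) i) (Finset.mem_univ x) h0)).trans
      (smul_zero _)
  have hmap : ∀ x : Idx n, fundamentalWeight n r x = topWeight r →
      fundamentalWeight n r (v.1 x) = topWeight r := by
    intro x hx
    have h3 := h2 ⟨x, hx⟩
    rw [topMinor, Matrix.submatrix_apply, Units.val_mul, Matrix.mul_apply,
      Finset.sum_eq_single (v.1 x)] at h3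
    · exact top_of_borelOpp_apply_ne_zero hr hb (σ ⟨x, hx⟩).2 (left_ne_zero_of_mul h3)
    · intro k _ hk
      rw [permRep_apply, if_neg (Ne.symm hk), mul_zero]
    · simp
  have hiff : ∀ x : Idx n, fundamentalWeight n r (v.1 x) = topWeight r ↔
      fundamentalWeight n r x = topWeight r := by
    intro x
    refine ⟨fun hx => ?_, hmap x⟩
    let T := Finset.univ.filter fun x : Idx n => fundamentalWeight n r x = topWeight r
    have hT : T.image v.1 = T := by
      apply Finset.eq_of_subset_of_card_le
      · intro y hy
        obtain ⟨z, hz, rfl⟩ := Finset.mem_image.1 hy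
        simp only [T, Finset.mem_filter, Finset.mem_univ, true_and] at hz ⊢
        exact hmap z hz
      · rw [Finset.card_image_of_injective _ v.1.injective]
    have : v.1 x ∈ T.image v.1 := by rw [hT]; simpa [T] using hx
    obtain ⟨z, hz, hzx⟩ := Finset.mem_image.1 this
    rw [← v.1.injective hzx]
    simpa [T] using hz
  ext x
  obtain ⟨y, rfl⟩ := v.1.surjective x
  rw [act_apply_coe]
  have hodd := weylGroup_isOdd v
  rcases (fundamentalWeight_cases hr y).2 with h | h | ⟨h, hpos⟩
  · rw [h, (hiff y).2 h]
  · have := (hiff y.opp).2 h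
    rw [hodd, fundamentalWeight_opp hr] at this
    rw [fundamentalWeight_opp hr] at h
    linarith
  · rcases (fundamentalWeight_cases hr (v.1 y)).2 with h' | h' | ⟨h', -⟩
    · rw [(hiff y).1 h'] at h; linarith
    · rw [← hodd] at h'
      have := (hiff y.opp).1 h'
      rw [fundamentalWeight_opp hr] at this
      linarith
    · rw [h, h']

open Classical in
-- The block condition satisfied by `P_r` is closed, so it holds on the closure of `B P_r` and makes
-- the top minor invertible there. If `v ≠ 1`, the determinant of this minor is a polynomial that
-- vanishes on `B⁻ v P_r`, hence on its closure.
lemma base_case (hn : 2 ≤ n) (hr : 1 ≤ r) {v : weylGroup n} (hv : v ∈ minReps n r)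
    {g : GeneralLinearGroup (Idx n) K} (hg : g ∈ glClosure (glCell r (borel K n) 1))
    (hg' : g ∈ glClosure (glCell r (borelOpp K n) v)) : v = 1 := by
  have h1 : (topMinor r g.1).det ≠ 0 := by
    apply det_topMinor_ne_zero
    intro x y hx hy
    have := hg (MvPolynomial.X (y, x)) ?_
    · simpa [entries] using this
    · rintro _ ⟨_, ⟨b, hb, p, hp, rfl⟩, rfl⟩
      have hbp : b * permRep K (1 : weylGroup n).1 * p ∈ parabolic K n r := by
        rw [OneMemClass.coe_one, permRep_one, mul_one]
        exact mul_mem (borel_le_parabolic r hb) hp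
      rw [MvPolynomial.eval_X]
      by_contra hne
      exact hy (top_of_parabolic_apply_ne_zero hr hbp hx hne)
  by_contra hne
  apply h1
  have key : ∀ g : GeneralLinearGroup (Idx n) K, (topMinor r g.1).det = MvPolynomial.eval (entries g)
      (Matrix.of fun (i j : {x : Idx n // fundamentalWeight n r x = topWeight r}) =>
        (MvPolynomial.X ((i : Idx n), (j : Idx n)) : MvPolynomial (Idx n × Idx n) K)).det := by
    intro g
    rw [RingHom.map_det]
    congr 1
    ext i j
    simp [topMinor, entries]
  rw [key]
  apply hg'
  rintro _ ⟨s, hs, rfl⟩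
  rw [← key]
  by_contra h0
  exact hne (eq_one_of_minReps_of_stab hn hr hv (act_eq_of_det_topMinor_ne_zero hr hs h0))

/-- If the closures of `B w P_r` and `B⁻ v P_r` intersect, then `v ≤ w`. -/
theorem bruhatLE_of_mem_closures [IsAlgClosed K] (hn : 2 ≤ n) (hr : 1 ≤ r) {v w : weylGroup n}
    (hv : v ∈ minReps n r) {g : GeneralLinearGroup (Idx n) K}
    (hg : g ∈ glClosure (glCell r (borel K n) w))
    (hg' : g ∈ glClosure (glCell r (borelOpp K n) v)) : BruhatLE v w := by
  induction hl : length w using Nat.strong_induction_on generalizing v w g with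
  | _ l ih =>
    subst hl
    by_cases hw1 : w = 1
    · subst hw1
      rw [base_case hn hr hv hg hg']
      exact .refl
    obtain ⟨i, a, b, h, hlt⟩ := exists_descent hn hw1
    have hba := h.lt.ne
    have hab := h.add_pos.ne'
    set w' := rf a b * w with hw'
    have hww : w = rf a b * w' := by rw [hw', rf_mul_cancel]
    have hw'lt : (w'.1⁻¹ a : ℤ) < w'.1⁻¹ b := by
      rwa [rf_mul_inv_apply, rf_mul_inv_apply, rootRefl_left hba hab, rootRefl_right hba hab]
    have hlen : length w' < length w := by
      rw [hww]; exact length_lt_rf_mul w' h.lt hab hw'lt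
    have hstep : BruhatStep w' w := by
      have := bruhatStep_rf_mul w' h.lt hab hw'lt
      rwa [← hww] at this
    rw [hww] at hg
    have hproj := glClosure_projection h w' (fun s hs => cell_projection h w' hs) hg
    -- pass to a point in the smaller Schubert variety
    have move : ∀ u : weylGroup n, (u.1⁻¹ a : ℤ) < u.1⁻¹ b →
        g ∈ glClosure (glCell r (borelOpp K n) u) → ∃ g' : GeneralLinearGroup (Idx n) K,
        g' ∈ glClosure (glCell r (borel K n) w') ∧ g' ∈ glClosure (glCell r (borelOpp K n) u) := by
      intro u hu hgu
      rcases hproj with ⟨c, hc⟩ | hc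
      · exact ⟨_, hc, mul_left_mem_closure_cell
          (rootElt_mem_borelOpp h.isRootPair.symm h.lt c) hgu⟩
      · exact ⟨_, hc, rootRefl_mul_mem_closure_cell_opp h hu hgu⟩
    -- If `s v > v`, the moved point stays in `X^v`, and induction gives `v ≤ s w < w`.
    by_cases hvlt : (v.1⁻¹ a : ℤ) < v.1⁻¹ b
    · obtain ⟨g', h1, h2⟩ := move v hvlt hg'
      exact (ih _ hlen hv h1 h2 rfl).tail hstep
    -- If `s v < v`, then `X^v` is contained in `X^{sv}`; induction gives `s v ≤ s w`, and the
    -- lifting property gives `v ≤ w`.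
    · have hvlt' : (v.1⁻¹ b : ℤ) < v.1⁻¹ a := by
        have := perm_coe_ne v.1⁻¹ hba
        omega
      have hv' := rf_mul_mem_minReps hn hr hv h (Or.inr hvlt')
      have hmem := permRep_mem_closure_cell_rf (r := r) (H := borelOpp K n) h.isRootPair v
        (rootElt_mem_borelOpp _ h.lt) (fun d hd => hd.mem_borelOpp) hvlt'
      obtain ⟨g', h1, h2⟩ := move (rf a b * v) (by
        rwa [rf_mul_inv_apply, rf_mul_inv_apply, rootRefl_left hba hab, rootRefl_right hba hab])
        (closure_cell_subset hmem hg')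
      have := (ih _ hlen hv' h1 h2 rfl).lift h hw'lt
      rwa [rf_mul_cancel, ← hww] at this

lemma closure_cell_mono [IsAlgClosed K] {v w : weylGroup n} (h : BruhatLE v w) :
    permRep K v.1 ∈ glClosure (glCell r (borel K n) w) := by
  induction h with
  | refl => exact subset_glClosure _ (permRep_mem_cell _)
  | tail _ hs ih =>
    obtain ⟨a, b, hab, hab', rfl, hlt⟩ := hs.exists_rf
    refine closure_cell_subset ?_ ih
    have hp : IsRootPair b a := IsRootPair.symm ⟨hab.ne, hab'.ne'⟩
    have := permRep_mem_closure_cell_rf (K := K) (r := r) (H := borel K n) hp _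
      (rootElt_mem_borel _ hab) (fun d hd => hd.mem_borel) hlt
    rwa [rf_comm b a] at this

/-! The Zariski topology on the flag variety -/

lemma isClosed_zariskiGroup_iff {Z : Set (group K n)} :
    @IsClosed _ (zariskiGroup K n) Z ↔ ∃ s : Set (MvPolynomial (Idx n × Idx n) K),
      Z = {g | ∀ F ∈ s, MvPolynomial.eval (entries g.1) F = 0} := by
  have hz : ∀ (s : Set (MvPolynomial (Idx n × Idx n) K)) (x : Idx n × Idx n → K),
      MvPolynomial.pointToPoint (k := K) x ∈ PrimeSpectrum.zeroLocus s ↔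
      ∀ F ∈ s, MvPolynomial.eval x F = 0 := by
    intro s x
    rw [PrimeSpectrum.mem_zeroLocus]
    change s ⊆ (MvPolynomial.vanishingIdeal K {x} : Set _) ↔ _
    refine forall₂_congr fun F _ => ?_
    rw [SetLike.mem_coe, MvPolynomial.mem_vanishingIdeal_singleton_iff]
    rfl
  letI := zariskiAffine K (Idx n × Idx n)
  rw [isClosed_induced_iff]
  constructor
  · rintro ⟨t, ht, rfl⟩
    obtain ⟨u, hu, rfl⟩ :=
      (isClosed_induced_iff (f := MvPolynomial.pointToPoint (k := K))).1 ht
    obtain ⟨s, rfl⟩ := (PrimeSpectrum.isClosed_iff_zeroLocus u).1 hu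
    refine ⟨s, ?_⟩
    ext g
    exact hz s _
  · rintro ⟨s, rfl⟩
    refine ⟨_, (isClosed_induced_iff (f := MvPolynomial.pointToPoint (k := K))).2
      ⟨PrimeSpectrum.zeroLocus s, PrimeSpectrum.isClosed_zeroLocus s, rfl⟩, ?_⟩
    ext g
    exact hz s _

/-- Closed sets in the quotient topology are those with closed preimage. The closure of `H w P_r` in
matrix entries is right `P_r`-stable, so it is the preimage of its image in `G/P_r`. Conversely, the
equations of the preimage of any closed set containing the cell vanish on `H w P_r`. -/
lemma mk_mem_closure_cell_iff (w : weylGroup n) (g : group K n)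
    (hH : H ≤ group K n) :
    (g : FlagVariety K n r) ∈ @closure _ (zariskiFlag K n r) (cell K n r H w) ↔
      g.1 ∈ glClosure (glCell r H w) := by
  letI τ := zariskiFlag K n r
  letI τ' := zariskiGroup K n
  have hcont : Continuous fun g : group K n => (g : FlagVariety K n r) := continuous_coinduced_rng
  constructor
  · intro hg
    have hcl : IsClosed {x : FlagVariety K n r | ∃ g : group K n, x = (g : FlagVariety K n r) ∧
        g.1 ∈ glClosure (glCell r H w)} := by
      rw [isClosed_coinduced, isClosed_zariskiGroup_iff]
      refine ⟨{F | ∀ s ∈ entries '' glCell r H w, MvPolynomial.eval s F = 0}, ?_⟩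
      ext g
      constructor
      · rintro ⟨g', hgg', hg'⟩
        have := QuotientGroup.eq.1 hgg'.symm
        rw [Subgroup.mem_subgroupOf] at this
        have h2 := mul_right_mem_closure_cell this hg'
        simp only [Subgroup.coe_mul, Subgroup.coe_inv, mul_inv_cancel_left] at h2
        exact fun F hF => h2 F hF
      · intro h
        exact ⟨g, rfl, fun F hF => h F hF⟩
    have hsub : cell K n r H w ⊆ {x : FlagVariety K n r | ∃ g : group K n,
        x = (g : FlagVariety K n r) ∧ g.1 ∈ glClosure (glCell r H w)} := by
      rintro x ⟨g, rfl, hg⟩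
      exact ⟨g, rfl, subset_glClosure _ hg⟩
    obtain ⟨g', hgg', hg'⟩ := closure_minimal hsub hcl hg
    have := QuotientGroup.eq.1 hgg'.symm
    rw [Subgroup.mem_subgroupOf] at this
    have h2 := mul_right_mem_closure_cell this hg'
    simpa only [Subgroup.coe_mul, Subgroup.coe_inv, mul_inv_cancel_left] using h2
  · intro hg
    have hcl := (isClosed_closure (s := cell K n r H w)).preimage hcont
    obtain ⟨s, hs⟩ := isClosed_zariskiGroup_iff.1 hcl
    have : g ∈ (fun g : group K n => (g : FlagVariety K n r)) ⁻¹' closure (cell K n r H w) := by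
      rw [hs]
      intro F hF
      apply hg
      rintro _ ⟨x, ⟨b, hb, p, hp, rfl⟩, rfl⟩
      let x' : group K n := ⟨b * permRep K w.1 * p,
        mul_mem (mul_mem (hH hb) (permRep_mem_group w)) (parabolic_le_group r hp)⟩
      have hx' : x' ∈ (fun g : group K n => (g : FlagVariety K n r)) ⁻¹'
          closure (cell K n r H w) := subset_closure ⟨x', rfl, b, hb, p, hp, rfl⟩
      rw [hs] at hx'
      exact hx' F hF
    exact this

theorem richardson_nonempty_iff [IsAlgClosed K] (hn : 2 ≤ n) (hr : 1 ≤ r) {v w : weylGroup n}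
    (hv : v ∈ minReps n r) : (richardson K n r v w).Nonempty ↔ BruhatLE v w := by
  constructor
  · rintro ⟨x, hx1, hx2⟩
    obtain ⟨g, rfl⟩ := QuotientGroup.mk_surjective x
    exact bruhatLE_of_mem_closures hn hr hv
      ((mk_mem_closure_cell_iff w g le_sup_left).1 hx1)
      ((mk_mem_closure_cell_iff v g le_sup_right).1 hx2)
  · intro h
    refine ⟨((⟨permRep K v.1, permRep_mem_group v⟩ : group K n) : FlagVariety K n r),
      (mk_mem_closure_cell_iff w _ le_sup_left).2 (closure_cell_mono h),
      (mk_mem_closure_cell_iff v _ le_sup_right).2 (subset_glClosure _ (permRep_mem_cell v))⟩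

end Closures

end TypeD

end

section

namespace TypeD

/-! Reflections and their chains on integral weights, written as functions on `{1, …, n}` -/

/-- `g` is the image of `f` under the reflection in `e_b - ε e_a`, where `ε = ±1`. -/
structure ReflRel (n : ℕ) (ε : ℤ) (a b : ℕ) (f g : ℕ → ℤ) : Prop where
  sign : ε = 1 ∨ ε = -1
  one_le : 1 ≤ a
  lt : a < b
  le : b ≤ n
  left : g a = ε * f b
  right : g b = ε * f a
  other : ∀ x, x ≠ a → x ≠ b → g x = f x

/-- One reflection that lowers the weight, or leaves it unchanged. -/
def Step (n : ℕ) (f g : ℕ → ℤ) : Prop :=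
  ∃ ε a b, ReflRel n ε a b f g ∧ ε * f a ≤ f b

/-- Chains of reflections that lower the weight. -/
def Chain (n : ℕ) : (ℕ → ℤ) → (ℕ → ℤ) → Prop := Relation.ReflTransGen (Step n)

variable {n : ℕ} {f g : ℕ → ℤ}

lemma Step.neg (h : Step n f g) : Step n (-g) (-f) := by
  obtain ⟨ε, a, b, h, hle⟩ := h
  refine ⟨ε, a, b, ⟨h.sign, h.one_le, h.lt, h.le, ?_, ?_, fun x hx hx' => ?_⟩, ?_⟩
  · rw [Pi.neg_apply, Pi.neg_apply, h.right]
    rcases h.sign with rfl | rfl <;> ring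
  · rw [Pi.neg_apply, Pi.neg_apply, h.left]
    rcases h.sign with rfl | rfl <;> ring
  · rw [Pi.neg_apply, Pi.neg_apply, h.other x hx hx']
  · rw [Pi.neg_apply, Pi.neg_apply, h.left, h.right]
    rcases h.sign with rfl | rfl <;> linarith

lemma Chain.neg (h : Chain n f g) : Chain n (-g) (-f) := by
  induction h with
  | refl => exact .refl
  | tail _ hs ih => exact .head hs.neg ih

lemma Chain.trans {h : ℕ → ℤ} (h1 : Chain n f g) (h2 : Chain n g h) : Chain n f h :=
  Relation.ReflTransGen.trans h1 h2

lemma Chain.swap {a b : ℕ} (ha : 1 ≤ a) (hab : a < b) (hb : b ≤ n) (hle : f a ≤ f b)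
    (h1 : g a = f b) (h2 : g b = f a) (h3 : ∀ x, x ≠ a → x ≠ b → g x = f x) : Chain n f g :=
  .single ⟨1, a, b, ⟨.inl rfl, ha, hab, hb, by simpa, by simpa, h3⟩, by simpa⟩

lemma Chain.swap_neg {a b : ℕ} (ha : 1 ≤ a) (hab : a < b) (hb : b ≤ n) (hle : -f a ≤ f b)
    (h1 : g a = -f b) (h2 : g b = -f a) (h3 : ∀ x, x ≠ a → x ≠ b → g x = f x) : Chain n f g :=
  .single ⟨-1, a, b, ⟨.inr rfl, ha, hab, hb, by simpa, by simpa, h3⟩, by simpa⟩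

lemma sum_Icc_pair {M : Type*} [AddCommMonoid M] {t a b : ℕ} (F : ℕ → M) (ha : t ≤ a) (hab : a < b)
    (hb : b ≤ n) : ∑ x ∈ Finset.Icc t n, F x =
      F a + (F b + ∑ x ∈ ((Finset.Icc t n).erase a).erase b, F x) := by
  rw [Finset.add_sum_erase _ F (by simp; omega), Finset.add_sum_erase _ F (by simp; omega)]

/-- Sums over final segments of a monotone function of the entries decrease along a step. -/
lemma Step.sum_le (h : Step n f g) {F : ℤ → ℤ} (hF : Monotone F) {t : ℕ} :
    ∑ x ∈ Finset.Icc t n, F (g x) ≤ ∑ x ∈ Finset.Icc t n, F (f x) := by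
  obtain ⟨ε, a, b, h, hle⟩ := h
  by_cases ha : t ≤ a
  · rw [sum_Icc_pair (fun x => F (g x)) ha h.lt h.le, sum_Icc_pair (fun x => F (f x)) ha h.lt h.le]
    have : ∑ x ∈ ((Finset.Icc t n).erase a).erase b, F (g x) =
        ∑ x ∈ ((Finset.Icc t n).erase a).erase b, F (f x) := by
      refine Finset.sum_congr rfl fun x hx => ?_
      simp only [Finset.mem_erase] at hx
      rw [h.other x hx.2.1 hx.1]
    rw [this, h.left, h.right]
    rcases h.sign with rfl | rfl
    · simp only [one_mul]; linarith
    · have h1 : F (-1 * f b) ≤ F (f a) := hF (by linarith)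
      have h2 := hF hle
      linarith
  · refine Finset.sum_le_sum fun x hx => hF ?_
    rw [Finset.mem_Icc] at hx
    by_cases hxb : x = b
    · rw [hxb, h.right]; exact hle
    · rw [h.other x (by omega) hxb]

lemma Chain.sum_le (h : Chain n f g) {F : ℤ → ℤ} (hF : Monotone F) (t : ℕ) :
    ∑ x ∈ Finset.Icc t n, F (g x) ≤ ∑ x ∈ Finset.Icc t n, F (f x) := by
  induction h with
  | refl => exact le_rfl
  | tail _ hs ih => exact (hs.sum_le hF).trans ih

lemma monotone_posPart : Monotone fun x : ℤ => max x 0 := fun _ _ h => max_le_max_right _ h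

lemma monotone_neg_negPart : Monotone fun x : ℤ => -max (-x) 0 :=
  fun _ _ h => neg_le_neg (max_le_max_right _ (neg_le_neg h))

lemma Chain.pos_le (h : Chain n f g) (t : ℕ) :
    ∑ x ∈ Finset.Icc t n, max (g x) 0 ≤ ∑ x ∈ Finset.Icc t n, max (f x) 0 :=
  h.sum_le monotone_posPart t

lemma Chain.neg_le (h : Chain n f g) (t : ℕ) :
    ∑ x ∈ Finset.Icc t n, max (-f x) 0 ≤ ∑ x ∈ Finset.Icc t n, max (-g x) 0 := by
  have := h.sum_le monotone_neg_negPart t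
  simp only [Finset.sum_neg_distrib] at this
  linarith

lemma ReflRel.sum_sq {ε : ℤ} {a b : ℕ} (h : ReflRel n ε a b f g) :
    ∑ x ∈ Finset.Icc 1 n, (g x) ^ 2 = ∑ x ∈ Finset.Icc 1 n, (f x) ^ 2 := by
  rw [sum_Icc_pair (fun x => (g x) ^ 2) h.one_le h.lt h.le,
    sum_Icc_pair (fun x => (f x) ^ 2) h.one_le h.lt h.le]
  have : ∑ x ∈ ((Finset.Icc 1 n).erase a).erase b, (g x) ^ 2 =
      ∑ x ∈ ((Finset.Icc 1 n).erase a).erase b, (f x) ^ 2 := by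
    refine Finset.sum_congr rfl fun x hx => ?_
    simp only [Finset.mem_erase] at hx
    rw [h.other x hx.2.1 hx.1]
  rw [this, h.left, h.right]
  rcases h.sign with rfl | rfl <;> ring

lemma ReflRel.prod {ε : ℤ} {a b k : ℕ} (h : ReflRel n ε a b f g) (hk : b ≤ k) :
    ∏ x ∈ Finset.Icc 1 k, g x = ∏ x ∈ Finset.Icc 1 k, f x := by
  have key : ∀ F : ℕ → ℤ, ∏ x ∈ Finset.Icc 1 k, F x =
      F a * (F b * ∏ x ∈ ((Finset.Icc 1 k).erase a).erase b, F x) := by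
    intro F
    have := h.one_le
    have := h.lt
    rw [Finset.mul_prod_erase _ F (by simp; omega), Finset.mul_prod_erase _ F (by simp; omega)]
  rw [key, key]
  have : ∏ x ∈ ((Finset.Icc 1 k).erase a).erase b, g x =
      ∏ x ∈ ((Finset.Icc 1 k).erase a).erase b, f x := by
    refine Finset.prod_congr rfl fun x hx => ?_
    simp only [Finset.mem_erase] at hx
    rw [h.other x hx.2.1 hx.1]
  rw [this, h.left, h.right]
  rcases h.sign with rfl | rfl <;> ring

/-- If the positive and the negative parts of the entries beyond `k` have the same sums at both
ends of a chain, then the product of the first `k` entries does not change. -/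
lemma Chain.prod_eq (h : Chain n f g) {k : ℕ}
    (h1 : ∑ x ∈ Finset.Icc (k + 1) n, max (f x) 0 ≤ ∑ x ∈ Finset.Icc (k + 1) n, max (g x) 0)
    (h2 : ∑ x ∈ Finset.Icc (k + 1) n, max (-g x) 0 ≤ ∑ x ∈ Finset.Icc (k + 1) n, max (-f x) 0) :
    ∏ x ∈ Finset.Icc 1 k, g x = ∏ x ∈ Finset.Icc 1 k, f x := by
  induction h with
  | refl => rfl
  | @tail g g' hc hs ih =>
    have hs1 := Chain.pos_le (.single hs) (k + 1)
    have hs2 := Chain.neg_le (.single hs) (k + 1)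
    have hc1 := Chain.pos_le hc (k + 1)
    have hc2 := Chain.neg_le hc (k + 1)
    rw [← ih (by linarith) (by linarith)]
    obtain ⟨ε, a, b, h, hle⟩ := hs
    by_cases hb : b ≤ k
    · exact h.prod hb
    · by_cases ha : a ≤ k
      -- The reflection mixes an index `a ≤ k` with an index `b > k`. Equal sums of positive and of
      -- negative parts force the coordinate at `b` to be unchanged, so `ε * g a = g b`, and the
      -- coordinate at `a` is unchanged as well.
      · have key : ∀ F : ℤ → ℤ, ∑ x ∈ Finset.Icc (k + 1) n, F (g' x) =
            ∑ x ∈ Finset.Icc (k + 1) n, F (g x) → F (ε * g a) = F (g b) := by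
          intro F hF
          have hbm : b ∈ Finset.Icc (k + 1) n := by have := h.le; simp; omega
          rw [← Finset.add_sum_erase _ _ hbm, ← Finset.add_sum_erase _ _ hbm, h.right] at hF
          have : ∑ x ∈ (Finset.Icc (k + 1) n).erase b, F (g' x) =
              ∑ x ∈ (Finset.Icc (k + 1) n).erase b, F (g x) := by
            refine Finset.sum_congr rfl fun x hx => ?_
            simp only [Finset.mem_erase, Finset.mem_Icc] at hx
            rw [h.other x (by omega) hx.1]
          linarith
        have e1 := key (fun x => max x 0) (by linarith)
        have e2 := key (fun x => max (-x) 0) (by linarith)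
        have e3 : ε * g a = g b := by
          omega
        refine Finset.prod_congr rfl fun x hx => ?_
        rw [Finset.mem_Icc] at hx
        by_cases hxa : x = a
        · rw [hxa, h.left, ← e3]
          rcases h.sign with rfl | rfl <;> ring
        · exact h.other x hxa (by omega)
      · have := h.lt
        refine Finset.prod_congr rfl fun x hx => ?_
        rw [Finset.mem_Icc] at hx
        exact h.other x (by omega) (by omega)

/-! Sequences with gaps -/

/-- The simple root `α_i` as a function on `{1, …, n}`. -/
def rt (i : ℕ) : ℕ → ℤ := fun x =>
  if i = 1 then (if x = 1 ∨ x = 2 then 1 else 0) else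
    if x = i then 1 else if 1 ≤ x ∧ x + 1 = i then -1 else 0

/-- `∑_k α_{i_k}` as a function on `{1, …, n}`. -/
def rtSum {p : ℕ} (i : Fin p → ℕ) : ℕ → ℤ := ∑ k, rt (i k)

lemma rt_of_two_le {i : ℕ} (hi : 2 ≤ i) (x : ℕ) :
    rt i x = if x = i then 1 else if x + 1 = i then -1 else 0 := by
  unfold rt
  split_ifs <;> first | rfl | omega

variable {p s t N : ℕ} {i j : Fin p → ℕ}

lemma J.mono {s' t' : ℕ} (hi : i ∈ J p s t) (hs : s' ≤ s) (ht : t ≤ t') : i ∈ J p s' t' :=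
  ⟨fun k => ⟨hs.trans (hi.1 k).1, (hi.1 k).2.trans ht⟩, hi.2⟩

lemma J.gap (hi : i ∈ J p s t) {k l : Fin p} (h : k < l) : i k + 2 ≤ i l := by
  obtain ⟨k, hk⟩ := k
  obtain ⟨l, hl⟩ := l
  simp only [Fin.mk_lt_mk] at h
  induction l, h using Nat.le_induction with
  | base => exact hi.2 _ _ rfl
  | succ l h ih =>
    have := ih (by omega)
    have := hi.2 ⟨l, by omega⟩ ⟨l + 1, hl⟩ rfl
    omega

lemma J.strictMono (hi : i ∈ J p s t) : StrictMono i := fun _ _ h => by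
  have := J.gap hi h
  omega

lemma J.tail {i : Fin (p + 1) → ℕ} (hi : i ∈ J (p + 1) s t) : Fin.tail i ∈ J p (i 0 + 2) t := by
  refine ⟨fun k => ⟨J.gap hi (Fin.succ_pos k), (hi.1 _).2⟩, fun k l h => hi.2 _ _ ?_⟩
  simp [h]

lemma J.init {i : Fin (p + 1) → ℕ} (hi : i ∈ J (p + 1) s t) :
    Fin.init i ∈ J p s (i (Fin.last p) - 2) := by
  refine ⟨fun k => ⟨(hi.1 _).1, ?_⟩, fun k l h => hi.2 _ _ (by simpa using h)⟩
  have := J.gap hi (Fin.castSucc_lt_last k)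
  change i k.castSucc ≤ _
  omega

lemma J.snoc (hi : i ∈ J p s t) (hs : s ≤ t + 2) :
    (Fin.snoc i (t + 2) : Fin (p + 1) → ℕ) ∈ J (p + 1) s (t + 2) := by
  constructor
  · intro k
    refine Fin.lastCases ?_ (fun k => ?_) k
    · simpa using hs
    · have := hi.1 k
      simp only [Fin.snoc_castSucc]
      omega
  · intro k l h
    induction l using Fin.lastCases with
    | last =>
      induction k using Fin.lastCases with
      | last => simp at h
      | cast k =>
        have := hi.1 k
        simp only [Fin.snoc_castSucc, Fin.snoc_last]
        omega
    | cast l =>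
      induction k using Fin.lastCases with
      | last => have := l.2; simp at h; omega
      | cast k =>
        simp only [Fin.snoc_castSucc]
        exact hi.2 k l (by simpa using h)

lemma rtSum_snoc (m : ℕ) : rtSum (Fin.snoc i m : Fin (p + 1) → ℕ) = rtSum i + rt m := by
  simp [rtSum, Fin.sum_univ_castSucc]

lemma rtSum_init (i : Fin (p + 1) → ℕ) : rtSum i = rtSum (Fin.init i) + rt (i (Fin.last p)) := by
  rw [← rtSum_snoc, Fin.snoc_init_self]

lemma rtSum_tail (i : Fin (p + 1) → ℕ) : rtSum i = rt (i 0) + rtSum (Fin.tail i) := by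
  simp [rtSum, Fin.sum_univ_succ, Fin.tail]

lemma rtSum_zero (i : Fin 0 → ℕ) : rtSum i = 0 := by simp [rtSum]

lemma rtSum_eq_zero (hs : 2 ≤ s) (hi : i ∈ J p s t) {x : ℕ} (hx : x + 1 < s ∨ t < x) :
    rtSum i x = 0 := by
  rw [rtSum, Finset.sum_apply]
  refine Finset.sum_eq_zero fun k _ => ?_
  have := hi.1 k
  rw [rt_of_two_le (by omega)]
  split_ifs <;> first | rfl | omega

/-- The number of the `k` with `i_k = x`. -/
def seqCount (i : Fin p → ℕ) (x : ℕ) : ℕ := (Finset.univ.filter fun k => i k = x).card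

lemma rtSum_apply (hs : 2 ≤ s) (hi : i ∈ J p s t) (x : ℕ) :
    rtSum i x = seqCount i x - seqCount i (x + 1) := by
  rw [rtSum, Finset.sum_apply, seqCount, seqCount, Finset.card_filter, Finset.card_filter]
  push_cast
  rw [← Finset.sum_sub_distrib]
  refine Finset.sum_congr rfl fun k _ => ?_
  have := hi.1 k
  rw [rt_of_two_le (by omega)]
  split_ifs <;> first | rfl | omega

lemma seqCount_le_one (hi : i ∈ J p s t) (x : ℕ) : seqCount i x ≤ 1 := by
  refine Finset.card_le_one.2 fun k hk l hl => ?_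
  simp only [Finset.mem_filter, Finset.mem_univ, true_and] at hk hl
  exact (J.strictMono hi).injective (hk.trans hl.symm)

/-- Gaps of at least 2 prevent cancellation between consecutive roots. Hence `seqCount i x` and
`seqCount i (x + 1)` are the positive and negative parts of the coordinate at `x`. -/
lemma seqCount_succ (hi : i ∈ J p s t) (x : ℕ) : seqCount i x = 0 ∨ seqCount i (x + 1) = 0 := by
  by_contra! h
  obtain ⟨k, hk⟩ := Finset.card_pos.1 (Nat.pos_of_ne_zero h.1)
  obtain ⟨l, hl⟩ := Finset.card_pos.1 (Nat.pos_of_ne_zero h.2)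
  simp only [Finset.mem_filter, Finset.mem_univ, true_and] at hk hl
  have := J.gap hi ((J.strictMono hi).lt_iff_lt.1 (by omega : i k < i l))
  omega

lemma max_rtSum (hs : 2 ≤ s) (hi : i ∈ J p s t) (x : ℕ) : max (rtSum i x) 0 = seqCount i x := by
  rw [rtSum_apply hs hi]
  have := seqCount_succ hi x
  omega

lemma max_neg_rtSum (hs : 2 ≤ s) (hi : i ∈ J p s t) (x : ℕ) :
    max (-rtSum i x) 0 = seqCount i (x + 1) := by
  rw [rtSum_apply hs hi]
  have := seqCount_succ hi x
  omega

/-- The number of the `k` with `i_k ≥ t`. -/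
def tailCount (i : Fin p → ℕ) (t : ℕ) : ℕ := (Finset.univ.filter fun k => t ≤ i k).card

lemma sum_seqCount (hi : i ∈ J p s n) (t : ℕ) :
    ∑ x ∈ Finset.Icc t n, seqCount i x = tailCount i t := by
  rw [tailCount, Finset.card_eq_sum_card_fiberwise (f := i) (t := Finset.Icc t n)]
  · refine Finset.sum_congr rfl fun x hx => ?_
    rw [Finset.mem_Icc] at hx
    rw [seqCount, Finset.filter_filter]
    congr 1
    ext k
    simp only [Finset.mem_filter, Finset.mem_univ, true_and]
    omega
  · intro k hk
    simp only [Finset.coe_filter, Finset.mem_univ, true_and] at hk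
    have := (hi.1 k).2
    have hk : t ≤ i k := hk
    simp [hk, this]

lemma sum_seqCount_succ (hi : i ∈ J p s n) (t : ℕ) :
    ∑ x ∈ Finset.Icc t n, seqCount i (x + 1) = tailCount i (t + 1) := by
  rw [← sum_seqCount (hi := J.mono hi le_rfl (Nat.le_succ n))]
  rw [← Finset.map_add_right_Icc t n 1, Finset.sum_map]
  rfl

lemma tailCount_eq (hi : ∀ k, t ≤ i k) : tailCount i t = p := by
  simp [tailCount, hi]

lemma tailCount_le : tailCount i t ≤ p :=
  (Finset.card_filter_le _ _).trans (by simp)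

lemma le_tailCount (hi : StrictMono i) (k : Fin p) : p - k ≤ tailCount i (i k) := by
  have : Finset.Ici k ⊆ Finset.univ.filter fun l => i k ≤ i l := by
    intro l hl
    simpa using hi.monotone (by simpa using hl)
  simpa [tailCount] using Finset.card_le_card this

lemma tailCount_lt (hi : StrictMono i) {k : Fin p} (h : i k < t) : tailCount i t < p - k := by
  have : (Finset.univ.filter fun l => t ≤ i l) ⊆ Finset.Ioi k := by
    intro l hl
    simp only [Finset.mem_filter, Finset.mem_univ, true_and, Finset.mem_Ioi] at hl ⊢
    exact hi.lt_iff_lt.1 (by omega)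
  have := Finset.card_le_card this
  simp only [Fin.card_Ioi] at this
  have := k.2
  unfold tailCount
  omega

/-- If `i k < j k - 1`, fewer than `p - k` entries of `i` are at least `j k - 1`, whereas at least
`p - k` entries of `j` are at least `j k`. -/
lemma le_add_one_of_tailCount (hi : StrictMono i) (hj : StrictMono j) {k : Fin p} (hk : 1 ≤ j k)
    (h : tailCount j (j k - 1 + 1) ≤ tailCount i (j k - 1)) : j k ≤ i k + 1 := by
  by_contra! hlt
  have h1 := le_tailCount hj k
  have h2 := tailCount_lt hi (k := k) (t := j k - 1) (by omega)
  rw [Nat.sub_add_cancel hk] at h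
  omega

lemma tailCount_tail {i : Fin (p + 1) → ℕ} (h : i 0 < t) :
    tailCount i t = tailCount (Fin.tail i) t := by
  rw [tailCount, tailCount, Finset.card_filter, Finset.card_filter, Fin.sum_univ_succ,
    if_neg (by omega), zero_add]
  rfl

/-! The weights `B + ∑ α_{i_k}`, with `B` supported below the sequence -/

variable {B B' : ℕ → ℤ}

lemma sum_pos_add_rtSum (hs : 2 ≤ s) (hi : i ∈ J p s n) (hB : ∀ x, s ≤ x + 1 → B x = 0)
    (ht : s ≤ t + 1) : ∑ x ∈ Finset.Icc t n, max ((B + rtSum i) x) 0 = tailCount i t := by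
  rw [← sum_seqCount hi]
  push_cast
  refine Finset.sum_congr rfl fun x hx => ?_
  rw [Finset.mem_Icc] at hx
  rw [Pi.add_apply, hB x (by omega), zero_add, max_rtSum hs hi]

lemma sum_neg_add_rtSum (hs : 2 ≤ s) (hi : i ∈ J p s n) (hB : ∀ x, s ≤ x + 1 → B x = 0)
    (ht : s ≤ t + 1) : ∑ x ∈ Finset.Icc t n, max (-(B + rtSum i) x) 0 = tailCount i (t + 1) := by
  rw [← sum_seqCount_succ hi]
  push_cast
  refine Finset.sum_congr rfl fun x hx => ?_
  rw [Finset.mem_Icc] at hx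
  rw [Pi.add_apply, hB x (by omega), zero_add, max_neg_rtSum hs hi]

/-- Both inequalities are monotonicity of partial sums along the chain. The shift from `t` to `t +
1` arises because `α_i` has its negative entry at `i - 1`, and the target weight is negated. -/
lemma Chain.tailCount_le {q s' : ℕ} {j : Fin q → ℕ} (hs : 2 ≤ s) (hs' : 2 ≤ s')
    (hi : i ∈ J p s n) (hB : ∀ x, s ≤ x + 1 → B x = 0)
    (hj : j ∈ J q s' n) (hB' : ∀ x, s' ≤ x + 1 → B' x = 0)
    (h : Chain n (B + rtSum i) (-(B' + rtSum j))) (ht : s ≤ t + 1) (ht' : s' ≤ t + 1) :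
    tailCount j (t + 1) ≤ tailCount i t ∧ tailCount i (t + 1) ≤ tailCount j t := by
  have h1 := h.pos_le t
  have h2 := h.neg_le t
  simp only [Pi.neg_apply, neg_neg] at h1 h2
  rw [sum_pos_add_rtSum hs hi hB ht, sum_neg_add_rtSum hs' hj hB' ht'] at h1
  rw [sum_neg_add_rtSum hs hi hB ht, sum_pos_add_rtSum hs' hj hB' ht'] at h2
  exact ⟨by exact_mod_cast h1, by exact_mod_cast h2⟩

lemma Chain.near (hs : 2 ≤ s) (hi : i ∈ J p s n) (hB : ∀ x, s ≤ x + 1 → B x = 0)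
    (hj : j ∈ J p s n) (hB' : ∀ x, s ≤ x + 1 → B' x = 0)
    (h : Chain n (B + rtSum i) (-(B' + rtSum j))) : Near i j := by
  intro k
  have hik := (hi.1 k).1
  have hjk := (hj.1 k).1
  have h1 := le_add_one_of_tailCount (J.strictMono hi) (J.strictMono hj) (k := k) (by omega)
    (h.tailCount_le hs hs hi hB hj hB' (by omega) (by omega)).1
  have h2 := le_add_one_of_tailCount (J.strictMono hj) (J.strictMono hi) (k := k) (by omega)
    (h.tailCount_le hs hs hi hB hj hB' (by omega) (by omega)).2
  rw [abs_le]
  omega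

lemma Chain.near_tail {i : Fin (p + 1) → ℕ} (hs : 2 ≤ s) (hi : i ∈ J (p + 1) s n)
    (hB : ∀ x, s ≤ x + 1 → B x = 0) (hj : j ∈ J p (s + 1) n)
    (hB' : ∀ x, s + 1 ≤ x + 1 → B' x = 0)
    (h : Chain n (B + rtSum i) (-(B' + rtSum j))) : Near (Fin.tail i) j ∧ i 0 = s := by
  have hc := fun t ht ht' => h.tailCount_le (t := t) hs (by omega) hi hB hj hB' ht ht'
  -- Otherwise all `p + 1` entries of `i` would be at least `s + 1`, while `j` has only `p` entries.
  have h0 : i 0 = s := by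
    by_contra hne
    have h1 := (hi.1 0).1
    have h2 := (hc s (by omega) le_rfl).2
    rw [tailCount_eq (i := i) fun k => ?_] at h2
    · have := TypeD.tailCount_le (i := j) (t := s)
      omega
    · have := (J.strictMono hi).monotone (Fin.zero_le k)
      omega
  refine ⟨fun k => ?_, h0⟩
  have ht := J.tail hi
  have hik := (ht.1 k).1
  have hjk := (hj.1 k).1
  have h1 : j k ≤ Fin.tail i k + 1 := by
    by_cases hjs : j k ≤ s + 1
    · omega
    · refine le_add_one_of_tailCount (J.strictMono ht) (J.strictMono hj) (by omega) ?_
      rw [← tailCount_tail (by omega)]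
      exact (hc _ (by omega) (by omega)).1
  have h2 : Fin.tail i k ≤ j k + 1 := by
    refine le_add_one_of_tailCount (J.strictMono hj) (J.strictMono ht) (by omega) ?_
    rw [← tailCount_tail (by omega)]
    exact (hc _ (by omega) (by omega)).2
  rw [abs_le]
  omega

/-- Both sequences have `p` roots, all supported in `[s - 1, n]`, so the positive and the negative
parts there sum to `p` at both ends of the chain. This is the equality case of `Chain.prod_eq` with
`k = s - 2`. -/
lemma Chain.prod_base (hs : 2 ≤ s) (hi : i ∈ J p s n) (hB : ∀ x, s ≤ x + 1 → B x = 0)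
    (hj : j ∈ J p s n) (hB' : ∀ x, s ≤ x + 1 → B' x = 0)
    (h : Chain n (B + rtSum i) (-(B' + rtSum j))) :
    ∏ x ∈ Finset.Icc 1 (s - 2), -B' x = ∏ x ∈ Finset.Icc 1 (s - 2), B x := by
  have hti : ∀ t ≤ s, tailCount i t = p := fun t ht => tailCount_eq fun k => ht.trans (hi.1 k).1
  have htj : ∀ t ≤ s, tailCount j t = p := fun t ht => tailCount_eq fun k => ht.trans (hj.1 k).1
  have := h.prod_eq (k := s - 2) ?_ ?_
  · convert this using 1
    · refine Finset.prod_congr rfl fun x hx => ?_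
      rw [Finset.mem_Icc] at hx
      simp [rtSum_eq_zero hs hj (x := x) (by omega)]
    · refine Finset.prod_congr rfl fun x hx => ?_
      rw [Finset.mem_Icc] at hx
      simp [rtSum_eq_zero hs hi (x := x) (by omega)]
  · simp only [Pi.neg_apply]
    rw [sum_pos_add_rtSum hs hi hB (by omega), sum_neg_add_rtSum hs hj hB' (by omega),
      hti _ (by omega), htj _ (by omega)]
  · simp only [Pi.neg_apply, neg_neg]
    rw [sum_neg_add_rtSum hs hi hB (by omega), sum_pos_add_rtSum hs hj hB' (by omega),
      hti _ (by omega), htj _ (by omega)]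

lemma sum_sq_add_rtSum (hs : 2 ≤ s) (hsn : s ≤ n + 2) (hi : i ∈ J p s n)
    (hB : ∀ x, s ≤ x + 1 → B x = 0) :
    ∑ x ∈ Finset.Icc 1 n, ((B + rtSum i) x) ^ 2 =
      ∑ x ∈ Finset.Icc 1 (s - 2), (B x) ^ 2 + 2 * p := by
  have hsplit : ∀ F : ℕ → ℤ, ∑ x ∈ Finset.Icc 1 n, F x =
      ∑ x ∈ Finset.Icc 1 (s - 2), F x + ∑ x ∈ Finset.Icc (s - 1) n, F x := by
    intro F
    rw [← Finset.sum_union]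
    · congr 1
      ext x
      simp only [Finset.mem_Icc, Finset.mem_union]
      omega
    · rw [Finset.disjoint_left]
      intro x
      simp only [Finset.mem_Icc]
      omega
  rw [hsplit]
  congr 1
  · refine Finset.sum_congr rfl fun x hx => ?_
    rw [Finset.mem_Icc] at hx
    simp [rtSum_eq_zero hs hi (x := x) (by omega)]
  · have h1 := sum_pos_add_rtSum hs hi hB (t := s - 1) (by omega)
    have h2 := sum_neg_add_rtSum hs hi hB (t := s - 1) (by omega)
    rw [tailCount_eq fun k => by have := (hi.1 k).1; omega] at h1 h2
    have : ((2 * p : ℕ) : ℤ) = p + p := by push_cast; ring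
    push_cast at this
    rw [this]
    nth_rewrite 1 [← h1]
    rw [← h2, ← Finset.sum_add_distrib]
    refine Finset.sum_congr rfl fun x hx => ?_
    rw [Finset.mem_Icc] at hx
    rw [Pi.add_apply, hB x (by omega), zero_add, max_rtSum hs hi, max_neg_rtSum hs hi,
      rtSum_apply hs hi]
    have h3 := seqCount_le_one hi x
    have h4 := seqCount_le_one hi (x + 1)
    have h5 := seqCount_succ hi x
    generalize seqCount i x = u at *
    generalize seqCount i (x + 1) = w at *
    interval_cases u <;> interval_cases w <;> simp_all

/-! Moving the simple roots of a sequence -/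

/-- Induction on `p`, splitting off the last roots `α_a` of `i` and `α_b` of `j`. Exchanging the
coordinates `a - 1` and `a` turns `α_a` into `-α_a`; exchanging those two places apart turns `α_a`
into `-α_{a+1}`, or `α_{b+1}` into `-α_b`. The split-off root is absorbed in `B`, which is why `B`
need only vanish up to `N`. -/
lemma chain_rtSum (hs : 3 ≤ s) (hN : N ≤ n) (hi : i ∈ J p s N) (hj : j ∈ J p s N)
    (hB : ∀ x, s ≤ x + 1 → x ≤ N → B x = 0) (h : Near i j) :
    Chain n (B + rtSum i) (B - rtSum j) := by
  induction p generalizing N B with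
  | zero => simp only [rtSum_zero, add_zero, sub_zero]; exact .refl
  | succ p ih =>
    have hm := hi.1 (Fin.last p)
    have hm' := hj.1 (Fin.last p)
    have hnear := h (Fin.last p)
    have hi' := J.init hi
    have hj' := J.init hj
    have hinit : Near (Fin.init i) (Fin.init j) := fun k => h k.castSucc
    rw [rtSum_init i, rtSum_init j]
    rw [abs_le] at hnear
    generalize i (Fin.last p) = a at *
    generalize j (Fin.last p) = b at *
    have hri : ∀ x, a - 2 < x → rtSum (Fin.init i) x = 0 :=
      fun x hx => rtSum_eq_zero (by omega) hi' (.inr hx)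
    have hrj : ∀ x, b - 2 < x → rtSum (Fin.init j) x = 0 :=
      fun x hx => rtSum_eq_zero (by omega) hj' (.inr hx)
    have hra := rt_of_two_le (i := a) (by omega)
    have hrb := rt_of_two_le (i := b) (by omega)
    have hcase : b = a ∨ b = a + 1 ∨ b + 1 = a := by omega
    rcases hcase with rfl | rfl | rfl
    · refine Chain.trans (g := (B - rt b) + rtSum (Fin.init i)) ?_ ?_
      · refine Chain.swap (a := b - 1) (b := b) (by omega) (by omega) (by omega) ?_ ?_ ?_ ?_
        · simp only [Pi.add_apply, hB (b - 1) (by omega) (by omega), hB b (by omega) (by omega),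
            hri (b - 1) (by omega), hri b (by omega), hra]
          split_ifs <;> omega
        · simp only [Pi.add_apply, Pi.sub_apply, hB (b - 1) (by omega) (by omega),
            hB b (by omega) (by omega), hri (b - 1) (by omega), hri b (by omega), hra]
          split_ifs <;> omega
        · simp only [Pi.add_apply, Pi.sub_apply, hB (b - 1) (by omega) (by omega),
            hB b (by omega) (by omega), hri (b - 1) (by omega), hri b (by omega), hra]
          split_ifs <;> omega
        · intro x h1 h2
          simp only [Pi.add_apply, Pi.sub_apply, hra]
          split_ifs <;> omega
      · have := ih (N := b - 2) (B := B - rt b) (by omega) hi' hj' ?_ hinit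
        · convert this using 1
          ring
        · intro x h1 h2
          simp only [Pi.sub_apply, hB x h1 (by omega), hra]
          split_ifs <;> omega
    -- The last root is moved first: the remaining roots of `i` do not reach the coordinate `a - 1`.
    · refine Chain.trans (g := (B - rt (a + 1)) + rtSum (Fin.init i)) ?_ ?_
      · refine Chain.swap (a := a - 1) (b := a + 1) (by omega) (by omega) (by omega) ?_ ?_ ?_ ?_
        · simp only [Pi.add_apply, hB (a - 1) (by omega) (by omega),
            hB (a + 1) (by omega) (by omega), hri (a - 1) (by omega), hri (a + 1) (by omega), hra]
          split_ifs <;> omega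
        · simp only [Pi.add_apply, Pi.sub_apply, hB (a - 1) (by omega) (by omega),
            hB (a + 1) (by omega) (by omega), hri (a - 1) (by omega), hri (a + 1) (by omega), hra,
            hrb]
          split_ifs <;> omega
        · simp only [Pi.add_apply, Pi.sub_apply, hB (a - 1) (by omega) (by omega),
            hB (a + 1) (by omega) (by omega), hri (a - 1) (by omega), hri (a + 1) (by omega), hra,
            hrb]
          split_ifs <;> omega
        · intro x h1 h2
          simp only [Pi.add_apply, Pi.sub_apply, hra, hrb]
          split_ifs <;> omega
      · have := ih (N := a - 1) (B := B - rt (a + 1)) (by omega) (J.mono hi' le_rfl (by omega))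
          (J.mono hj' le_rfl (by omega)) ?_ hinit
        · convert this using 1
          ring
        · intro x h1 h2
          simp only [Pi.sub_apply, hB x h1 (by omega), hrb]
          split_ifs <;> omega
    -- The last root is moved last: the other roots of `i` may occupy the coordinate `b - 1`, but
    -- those of `j` do not.
    · refine Chain.trans (g := (B + rt (b + 1)) - rtSum (Fin.init j)) ?_ ?_
      · have := ih (N := b - 1) (B := B + rt (b + 1)) (by omega) (J.mono hi' le_rfl (by omega))
          (J.mono hj' le_rfl (by omega)) ?_ hinit
        · convert this using 1
          ring
        · intro x h1 h2
          simp only [Pi.add_apply, hB x h1 (by omega), hra]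
          split_ifs <;> omega
      · refine Chain.swap (a := b - 1) (b := b + 1) (by omega) (by omega) (by omega) ?_ ?_ ?_ ?_
        · simp only [Pi.add_apply, Pi.sub_apply, hB (b - 1) (by omega) (by omega),
            hB (b + 1) (by omega) (by omega), hrj (b - 1) (by omega), hrj (b + 1) (by omega), hra]
          split_ifs <;> omega
        · simp only [Pi.add_apply, Pi.sub_apply, hB (b - 1) (by omega) (by omega),
            hB (b + 1) (by omega) (by omega), hrj (b - 1) (by omega), hrj (b + 1) (by omega), hra,
            hrb]
          split_ifs <;> omega
        · simp only [Pi.add_apply, Pi.sub_apply, hB (b - 1) (by omega) (by omega),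
            hB (b + 1) (by omega) (by omega), hrj (b - 1) (by omega), hrj (b + 1) (by omega), hra,
            hrb]
          split_ifs <;> omega
        · intro x h1 h2
          simp only [Pi.add_apply, Pi.sub_apply, hra, hrb]
          split_ifs <;> omega

end TypeD

end

section

namespace TypeD

variable {n p q s t N : ℕ} {i : Fin p → ℕ} {j : Fin q → ℕ} {f g : ℕ → ℤ}

/-! The possible initial parts of the extremal weights -/

/-- The vector `e_2` as a function on `{1, …, n}`. -/
def vecHalf : ℕ → ℤ := fun x => if x = 2 then 1 else 0

/-- The vector `e_1 + e_2 + e_3` as a function on `{1, …, n}`. -/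
def vecHalf1 : ℕ → ℤ := fun x => if x = 1 ∨ x = 2 ∨ x = 3 then 1 else 0

/-- The vector `-e_1 + e_2 + e_3` as a function on `{1, …, n}`. -/
def vecHalf2 : ℕ → ℤ := fun x => if x = 2 ∨ x = 3 then 1 else if x = 1 then -1 else 0

/-- `B` is an initial part, to which sequences of simple roots from `s` on can be added. -/
def IsBase (s : ℕ) (B : ℕ → ℤ) : Prop :=
  s = 3 ∧ B = 0 ∨ s = 4 ∧ (B = rt 1 ∨ B = rt 2 ∨ B = vecHalf) ∨
    s = 5 ∧ (B = vecHalf1 ∨ B = vecHalf2)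

lemma IsBase.eq_zero {B : ℕ → ℤ} (h : IsBase s B) {x : ℕ} (hx : s ≤ x + 1) : B x = 0 := by
  rcases h with ⟨rfl, rfl⟩ | ⟨rfl, rfl | rfl | rfl⟩ | ⟨rfl, rfl | rfl⟩ <;>
    simp only [rt, vecHalf, vecHalf1, vecHalf2, Pi.zero_apply] <;> split_ifs <;> omega

lemma IsBase.le {B : ℕ → ℤ} (h : IsBase s B) : 3 ≤ s ∧ s ≤ 5 := by
  unfold IsBase at h
  omega

/-- The weights `B + ∑ α_{i_k}` for an initial part `B` and a sequence up to `N`. -/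
def HasForm (N : ℕ) (f : ℕ → ℤ) : Prop :=
  ∃ s B p, ∃ i : Fin p → ℕ, IsBase s B ∧ s ≤ N + 2 ∧ i ∈ J p s N ∧ f = B + rtSum i

lemma HasForm.of_base {B : ℕ → ℤ} (h : IsBase s B) (hs : s ≤ N + 2) (hf : ∀ x, f x = B x) :
    HasForm N f :=
  ⟨s, B, 0, Fin.elim0, h, hs, ⟨fun k => k.elim0, fun k => k.elim0⟩, by
    rw [rtSum_zero, add_zero]; exact funext hf⟩

lemma HasForm.succ (h : HasForm N f) : HasForm (N + 1) f := by
  obtain ⟨s, B, p, i, hB, hs, hi, rfl⟩ := h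
  exact ⟨s, B, p, i, hB, by omega, J.mono hi le_rfl (by omega), rfl⟩

lemma HasForm.add_rt (h : HasForm N (f - rt (N + 2))) : HasForm (N + 2) f := by
  obtain ⟨s, B, p, i, hB, hs, hi, hf⟩ := h
  refine ⟨s, B, p + 1, _, hB, by omega, J.snoc hi hs, ?_⟩
  rw [rtSum_snoc, ← add_assoc, ← hf, sub_add_cancel]

/-- The conditions on a nonnegative weight `f` with entries `0`, `±1` that say that a simple
reflection `s_i` with `⟨f, α_i⟩ > 0` leads to a weight that is not nonnegative. Here `S` is the
function of the suffix sums, up to the index `N`. -/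
structure LocallyMaximal (N : ℕ) (f S : ℕ → ℤ) : Prop where
  zero : f 0 = 0
  entry : ∀ x, f x = 0 ∨ f x = 1 ∨ f x = -1
  vanish : ∀ x, N < x → f x = 0
  sum_vanish : ∀ x, N < x → S x = 0
  sum : ∀ k, 1 ≤ k → S k = f k + S (k + 1)
  nonneg : ∀ k, 3 ≤ k → 0 ≤ S k
  nonneg_one : 0 ≤ S 2 + f 1
  nonneg_two : 0 ≤ S 2 - f 1
  -- The coefficient of `α_1` is `(S 2 + f 1) / 2`, and `s_1` subtracts `(f 2 + f 1) α_1`; the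
  -- condition says that this coefficient becomes negative. For `α_2` the coefficient is `(S 2 - f
  -- 1) / 2`, and for `α_{k+1}` with `k ≥ 2` it is `S (k + 1)`.
  max_one : 0 < f 2 + f 1 → S 2 + f 1 < 2 * (f 2 + f 1)
  max_two : 0 < f 2 - f 1 → S 2 - f 1 < 2 * (f 2 - f 1)
  max : ∀ k, 2 ≤ k → 0 < f (k + 1) - f k → S (k + 1) < f (k + 1) - f k

lemma LocallyMaximal.hasForm_two {S : ℕ → ℤ} (h : LocallyMaximal 2 f S) : HasForm 2 f := by
  have h0 := h.zero
  have hS2 := h.sum 2 (by norm_num)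
  have hS3 := h.sum_vanish 3 (by norm_num)
  norm_num at hS2
  have e1 := h.entry 1
  have e2 := h.entry 2
  have n1 := h.nonneg_one
  have n2 := h.nonneg_two
  have hv : ∀ x, 2 < x → f x = 0 := h.vanish
  have hcase : f 2 = 0 ∧ f 1 = 0 ∨ f 2 = 1 ∧ (f 1 = 1 ∨ f 1 = -1 ∨ f 1 = 0) := by omega
  have key : ∀ B : ℕ → ℤ, B 0 = 0 → B 1 = f 1 → B 2 = f 2 → (∀ x, 2 < x → B x = 0) →
      ∀ x, f x = B x := by
    intro B b0 b1 b2 b3 x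
    by_cases hx : 2 < x
    · rw [hv x hx, b3 x hx]
    · interval_cases x <;> simp_all
  rcases hcase with ⟨h2, h1⟩ | ⟨h2, h1 | h1 | h1⟩
  · exact .of_base (s := 3) (B := 0) (by simp [IsBase]) (by norm_num)
      (key _ rfl (by simp [h1]) (by simp [h2]) (by simp))
  · refine .of_base (s := 4) (B := rt 1) (by simp [IsBase]) (by norm_num)
      (key _ rfl (by simp [h1, rt]) (by simp [h2, rt]) fun x hx => ?_)
    simp only [rt]
    split_ifs <;> omega
  · refine .of_base (s := 4) (B := rt 2) (by simp [IsBase]) (by norm_num)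
      (key _ rfl (by simp [h1, rt]) (by simp [h2, rt]) fun x hx => ?_)
    simp only [rt]
    split_ifs <;> omega
  · refine .of_base (s := 4) (B := vecHalf) (by simp [IsBase]) (by norm_num)
      (key _ rfl (by simp [h1, vecHalf]) (by simp [h2, vecHalf]) fun x hx => ?_)
    simp only [vecHalf]
    split_ifs <;> omega

lemma LocallyMaximal.hasForm_three {S : ℕ → ℤ} (h : LocallyMaximal 3 f S) : HasForm 3 f := by
  have h0 := h.zero
  have hS2 := h.sum 2 (by norm_num)
  have hS3 := h.sum 3 (by norm_num)
  have hS4 := h.sum_vanish 4 (by norm_num)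
  have e1 := h.entry 1
  have e2 := h.entry 2
  have e3 := h.entry 3
  have n1 := h.nonneg_one
  have n2 := h.nonneg_two
  have n3 := h.nonneg 3 le_rfl
  have m1 := h.max_one
  have m2 := h.max_two
  have m3 := h.max 2 le_rfl
  norm_num at hS2 hS3 m3
  have hv : ∀ x, 3 < x → f x = 0 := h.vanish
  have hcase : f 3 = 0 ∨ f 3 = 1 ∧ (f 2 = -1 ∧ f 1 = 0 ∨ f 2 = 1 ∧ (f 1 = 1 ∨ f 1 = -1)) := by
    omega
  have key : ∀ B : ℕ → ℤ, B 0 = 0 → B 1 = f 1 → B 2 = f 2 → B 3 = f 3 → (∀ x, 3 < x → B x = 0) →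
      ∀ x, f x = B x := by
    intro B b0 b1 b2 b3 b4 x
    by_cases hx : 3 < x
    · rw [hv x hx, b4 x hx]
    · interval_cases x <;> simp_all
  rcases hcase with h3 | ⟨h3, ⟨h2, h1⟩ | ⟨h2, h1 | h1⟩⟩
  · refine HasForm.succ (LocallyMaximal.hasForm_two (S := S) { h with vanish := ?_, sum_vanish := ?_ })
    · intro x hx
      by_cases hx3 : x = 3
      · rw [hx3, h3]
      · exact hv x (by omega)
    · intro x hx
      by_cases hx3 : x = 3
      · rw [hx3]; omega
      · exact h.sum_vanish x (by omega)
  · refine HasForm.add_rt (N := 1) (.of_base (s := 3) (B := 0) (by simp [IsBase]) (by norm_num) ?_)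
    intro x
    rw [Pi.sub_apply, Pi.zero_apply, sub_eq_zero]
    change f x = rt 3 x
    refine key (rt 3) rfl (by simp [h1, rt]) (by simp [h2, rt]) (by simp [h3, rt]) (fun x hx => ?_) x
    simp only [rt]
    split_ifs <;> omega
  · refine .of_base (s := 5) (B := vecHalf1) (by simp [IsBase]) (by norm_num)
      (key _ rfl (by simp [h1, vecHalf1]) (by simp [h2, vecHalf1]) (by simp [h3, vecHalf1])
        fun x hx => ?_)
    simp only [vecHalf1]
    split_ifs <;> omega
  · refine .of_base (s := 5) (B := vecHalf2) (by simp [IsBase]) (by norm_num)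
      (key _ rfl (by simp [h1, vecHalf2]) (by simp [h2, vecHalf2]) (by simp [h3, vecHalf2])
        fun x hx => ?_)
    simp only [vecHalf2]
    split_ifs <;> omega

/-- The last two entries `1`, `1` are impossible. -/
lemma LocallyMaximal.not_one_one {S : ℕ → ℤ} (h : LocallyMaximal (N + 4) f S)
    (h1 : f (N + 4) = 1) (h2 : f (N + 3) = 1) : False := by
  -- Once a suffix sum is at least 2, an entry 1 forces the preceding entry to be 1, because a rise
  -- of at most 2 cannot exceed the sum as `max` demands. The run of ones reaches index 2 with `S 2
  -- ≥ 3`, which contradicts `max_one` or `max_two`.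
  have hrun : ∀ d, d ≤ N + 1 → f (N + 3 - d) = 1 ∧ (d : ℤ) + 2 ≤ S (N + 3 - d) := by
    intro d
    induction d with
    | zero =>
      intro _
      have e1 := h.sum (N + 3) (by omega)
      have e2 := h.sum (N + 4) (by omega)
      have e3 := h.sum_vanish (N + 4 + 1) (by omega)
      refine ⟨h2, ?_⟩
      simp only [Nat.sub_zero]
      rw [e1, e2, e3]
      omega
    | succ d ih =>
      intro hd
      obtain ⟨i1, i2⟩ := ih (by omega)
      obtain ⟨m, hm⟩ : ∃ m, N + 3 - d = m + 1 := ⟨N + 2 - d, by omega⟩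
      rw [show N + 3 - (d + 1) = m by omega]
      rw [hm] at i1 i2
      have e1 := h.sum m (by omega)
      have e2 := h.max m (by omega)
      have e3 := h.entry m
      push_cast
      omega
  obtain ⟨r1, r2⟩ := hrun (N + 1) le_rfl
  rw [show N + 3 - (N + 1) = 2 by omega] at r1 r2
  have n1 := h.max_one
  have n2 := h.max_two
  have e1 := h.entry 1
  push_cast at r2
  omega

/-- Induction from the right end: the last coordinate is 0 and is dropped, or the last two are `-1,
1` and form a simple root that is removed. What remains is again locally maximal. -/
theorem LocallyMaximal.hasForm {S : ℕ → ℤ} (hN : 2 ≤ N) (h : LocallyMaximal N f S) :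
    HasForm N f := by
  induction N using Nat.strong_induction_on generalizing f S with
  | _ N ih =>
    obtain rfl | rfl | hN4 : N = 2 ∨ N = 3 ∨ 4 ≤ N := by omega
    · exact h.hasForm_two
    · exact h.hasForm_three
    obtain ⟨N, rfl⟩ := Nat.exists_eq_add_of_le' hN4
    have s1 := h.sum (N + 4) (by omega)
    have s2 := h.sum_vanish (N + 4 + 1) (by omega)
    have s3 := h.nonneg (N + 4) (by omega)
    have s4 := h.sum (N + 3) (by omega)
    have s5 := h.nonneg (N + 3) (by omega)
    have m1 := h.max (N + 3) (by omega)
    have e1 := h.entry (N + 4)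
    have e2 := h.entry (N + 3)
    have hno := h.not_one_one
    simp only [show N + 3 + 1 = N + 4 by omega] at s4 m1
    -- The last entry is a suffix sum, so it is not negative. Last entries `0, 1` violate `max`,
    -- since the rise equals the suffix sum 1.
    have hcase : f (N + 4) = 0 ∨ f (N + 4) = 1 ∧ f (N + 3) = -1 := by
      by_contra hc
      exact hno (by omega) (by omega)
    rcases hcase with h0 | ⟨h1, h2⟩
    · refine HasForm.succ (ih (N + 3) (by omega) (by omega) (S := S)
        { h with vanish := ?_, sum_vanish := ?_ })
      · intro x hx
        by_cases hx3 : x = N + 4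
        · rw [hx3, h0]
        · exact h.vanish x (by omega)
      · intro x hx
        by_cases hx3 : x = N + 4
        · rw [hx3]; omega
        · exact h.sum_vanish x (by omega)
    · have hrt := rt_of_two_le (i := N + 4) (by omega)
      have hf : ∀ x, x < N + 3 → (f - rt (N + 4)) x = f x := by
        intro x hx
        rw [Pi.sub_apply, hrt, if_neg (by omega), if_neg (by omega), sub_zero]
      have hf' : ∀ x, N + 2 < x → (f - rt (N + 4)) x = 0 := by
        intro x hx
        rw [Pi.sub_apply, hrt]
        split_ifs with c1 c2
        · rw [c1, h1]; rfl
        · obtain rfl : x = N + 3 := by omega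
          rw [h2]; rfl
        · rw [h.vanish x (by omega)]; rfl
      have hS : ∀ x, x ≤ N + 3 → (if x = N + 4 then 0 else S x) = S x := by
        intro x hx
        rw [if_neg (by omega)]
      -- Removing `α_{N+4}` changes a single suffix sum, that at `N + 4`, from 1 to 0.
      refine HasForm.add_rt (ih (N + 2) (by omega) (by omega)
        (S := fun k => if k = N + 4 then 0 else S k) ⟨?_, ?_, hf', ?_, ?_, ?_, ?_, ?_, ?_, ?_, ?_⟩)
      · rw [hf 0 (by omega), h.zero]
      · intro x
        by_cases hx : x < N + 3
        · rw [hf x hx]; exact h.entry x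
        · exact .inl (hf' x (by omega))
      · intro x hx
        split_ifs with c
        · rfl
        · by_cases hx3 : x = N + 3
          · rw [hx3]; omega
          · exact h.sum_vanish x (by omega)
      · intro k hk
        by_cases hkN : k ≤ N + 2
        · simp only [hS k (by omega), hS (k + 1) (by omega), hf k (by omega)]
          exact h.sum k hk
        · rw [hf' k (by omega), zero_add]
          by_cases hk3 : k = N + 3
          · rw [hk3, if_neg (by omega), if_pos rfl]; omega
          · rw [if_neg (show k + 1 ≠ N + 4 by omega), h.sum_vanish (k + 1) (by omega)]
            split_ifs
            · rfl
            · exact h.sum_vanish k (by omega)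
      · intro k hk
        split_ifs
        · exact le_rfl
        · exact h.nonneg k hk
      · simp only [hS 2 (by omega), hf 1 (by omega)]; exact h.nonneg_one
      · simp only [hS 2 (by omega), hf 1 (by omega)]; exact h.nonneg_two
      · simp only [hS 2 (by omega), hf 1 (by omega), hf 2 (by omega)]; exact h.max_one
      · simp only [hS 2 (by omega), hf 1 (by omega), hf 2 (by omega)]; exact h.max_two
      · intro k hk
        by_cases hkN : k + 1 ≤ N + 2
        · simp only [hS (k + 1) (by omega), hf k (by omega), hf (k + 1) (by omega)]
          exact h.max k hk
        · rw [hf' (k + 1) (by omega)]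
          by_cases hk2 : k = N + 2
          · subst hk2
            rw [hS _ (by omega), hf _ (by omega)]
            simp only [show N + 2 + 1 = N + 3 by omega]
            intro hlt
            omega
          · rw [hf' k (by omega)]
            intro hlt
            omega

/-! Chains between the extremal weights -/

lemma chain_base_add {B B' C : ℕ → ℤ} (hC : ∀ x ∈ Finset.Icc 1 s, C x = 0) (hs : s ≤ n)
    (h : Chain s B B') : Chain n (B + C) (B' + C) := by
  induction h with
  | refl => exact .refl
  | tail _ hs' ih =>
    refine .tail ih ?_
    obtain ⟨ε, a, b, h, hle⟩ := hs'
    have := h.one_le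
    have := h.lt
    have := h.le
    have ha := hC a (by simp; omega)
    have hb := hC b (by simp; omega)
    refine ⟨ε, a, b, ⟨h.sign, h.one_le, h.lt, by omega, ?_, ?_, fun x hx hx' => ?_⟩, ?_⟩
    · simp [ha, hb, h.left]
    · simp [ha, hb, h.right]
    · simp [h.other x hx hx']
    · simpa [ha, hb] using hle

lemma chain_rt_one : Chain 2 (rt 1) (-rt 1) := by
  refine .swap_neg (a := 1) (b := 2) (by norm_num) (by norm_num) (by norm_num) ?_ ?_ ?_ ?_
  · simp [rt]
  · simp [rt]
  · simp [rt]
  · intro x h1 h2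
    simp [rt, h1, h2]

lemma chain_rt_two : Chain 2 (rt 2) (-rt 2) := by
  refine .swap (a := 1) (b := 2) (by norm_num) (by norm_num) (by norm_num) ?_ ?_ ?_ ?_
  · simp [rt]
  · simp [rt]
  · simp [rt]
  · intro x h1 h2
    simp only [rt, Pi.neg_apply]
    split_ifs <;> omega

lemma chain_vecHalf : Chain 2 vecHalf (-vecHalf) := by
  refine Chain.trans (g := fun x => if x = 1 then 1 else 0) ?_ ?_
  · refine .swap (a := 1) (b := 2) (by norm_num) (by norm_num) (by norm_num) ?_ ?_ ?_ ?_
    · simp [vecHalf]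
    · simp [vecHalf]
    · simp [vecHalf]
    · intro x h1 h2
      simp [vecHalf, h1, h2]
  · refine .swap_neg (a := 1) (b := 2) (by norm_num) (by norm_num) (by norm_num) ?_ ?_ ?_ ?_
    · simp
    · simp [vecHalf]
    · simp [vecHalf]
    · intro x h1 h2
      simp [vecHalf, h1, h2]

lemma chain_rt_three_one : Chain 3 (rt 3) (-rt 1) := by
  refine .swap_neg (a := 1) (b := 3) (by norm_num) (by norm_num) (by norm_num) ?_ ?_ ?_ ?_
  · simp [rt]
  · simp [rt]
  · simp [rt]
  · intro x h1 h2
    simp only [rt, Pi.neg_apply]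
    split_ifs <;> omega

lemma chain_rt_three_two : Chain 3 (rt 3) (-rt 2) := by
  refine .swap (a := 1) (b := 3) (by norm_num) (by norm_num) (by norm_num) ?_ ?_ ?_ ?_
  · simp [rt]
  · simp [rt]
  · simp [rt]
  · intro x h1 h2
    simp only [rt, Pi.neg_apply]
    split_ifs <;> omega

lemma chain_vecHalf1 : Chain 3 vecHalf1 (-vecHalf2) := by
  refine .swap_neg (a := 2) (b := 3) (by norm_num) (by norm_num) (by norm_num) ?_ ?_ ?_ ?_
  · simp [vecHalf1]
  · simp [vecHalf1, vecHalf2]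
  · simp [vecHalf1, vecHalf2]
  · intro x h1 h2
    simp only [vecHalf1, vecHalf2, Pi.neg_apply]
    split_ifs <;> omega

lemma chain_vecHalf2 : Chain 3 vecHalf2 (-vecHalf1) := by
  have := chain_vecHalf1.neg
  rwa [neg_neg] at this

/-- The coordinates run through `(0,1,-1,1)`, `(1,1,-1,0)` and `(-1,-1,-1,0)`. -/
lemma chain_vecHalf_one : Chain 4 (vecHalf + rt 4) (-vecHalf1) := by
  refine Chain.trans (g := fun x => if x = 1 ∨ x = 2 then 1 else if x = 3 then -1 else 0) ?_ ?_
  · refine .swap (a := 1) (b := 4) (by norm_num) (by norm_num) (by norm_num) ?_ ?_ ?_ ?_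
    · simp [vecHalf, rt]
    · simp [vecHalf, rt]
    · simp [vecHalf, rt]
    · intro x h1 h2
      simp only [vecHalf, rt, Pi.add_apply]
      split_ifs <;> omega
  · refine .swap_neg (a := 1) (b := 2) (by norm_num) (by norm_num) (by norm_num) ?_ ?_ ?_ ?_
    · simp
    · simp [vecHalf1]
    · simp [vecHalf1]
    · intro x h1 h2
      simp only [vecHalf1, Pi.neg_apply]
      split_ifs <;> omega

lemma chain_vecHalf_two : Chain 4 (vecHalf + rt 4) (-vecHalf2) := by
  refine Chain.trans (g := fun x => if x = 2 then 1 else if x = 1 ∨ x = 3 then -1 else 0) ?_ ?_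
  · refine .swap_neg (a := 1) (b := 4) (by norm_num) (by norm_num) (by norm_num) ?_ ?_ ?_ ?_
    · simp [vecHalf, rt]
    · simp [vecHalf, rt]
    · simp [vecHalf, rt]
    · intro x h1 h2
      simp only [vecHalf, rt, Pi.add_apply]
      split_ifs <;> omega
  · refine .swap (a := 1) (b := 2) (by norm_num) (by norm_num) (by norm_num) ?_ ?_ ?_ ?_
    · simp
    · simp [vecHalf2]
    · simp [vecHalf2]
    · intro x h1 h2
      simp only [vecHalf2, Pi.neg_apply]
      split_ifs <;> omega

/-- A chain of initial parts followed by a chain that moves the simple roots of a sequence. -/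
lemma chain_of_base {B B' : ℕ → ℤ} {i j : Fin p → ℕ} (hs : 3 ≤ s) (hsn : s ≤ n + 2)
    (h : Chain (s - 2) B (-B')) (hi : i ∈ J p s n)
    (hj : j ∈ J p s n) (hB' : ∀ x, s ≤ x + 1 → B' x = 0) (hij : Near i j) :
    Chain n (B + rtSum i) (-(B' + rtSum j)) := by
  refine Chain.trans (g := -B' + rtSum i) (chain_base_add ?_ (by omega) h) ?_
  · intro x hx
    rw [Finset.mem_Icc] at hx
    exact rtSum_eq_zero (by omega) hi (.inl (by omega))
  · rw [neg_add, ← sub_eq_add_neg]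
    exact chain_rtSum hs le_rfl hi hj (fun x hx _ => by simp [hB' x hx]) hij

/-- The same, with the first simple root of the sequence absorbed in the initial part. -/
lemma chain_of_base_tail {B B' : ℕ → ℤ} {i : Fin (p + 1) → ℕ} {j : Fin p → ℕ} (hs : 3 ≤ s)
    (h : Chain s (B + rt s) (-B')) (hi : i ∈ J (p + 1) s n) (hi0 : i 0 = s)
    (hj : j ∈ J p (s + 1) n) (hB' : ∀ x, s + 1 ≤ x + 1 → B' x = 0) (hij : Near (Fin.tail i) j) :
    Chain n (B + rtSum i) (-(B' + rtSum j)) := by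
  have hsn := (hi.1 0).2
  have ht := J.tail hi
  rw [rtSum_tail, hi0, ← add_assoc]
  refine Chain.trans (g := -B' + rtSum (Fin.tail i)) (chain_base_add ?_ (by omega) h) ?_
  · intro x hx
    rw [Finset.mem_Icc] at hx
    exact rtSum_eq_zero (by omega) ht (.inl (by omega))
  · rw [neg_add, ← sub_eq_add_neg]
    exact chain_rtSum (s := s + 1) (by omega) le_rfl (J.mono ht (by omega) le_rfl) hj
      (fun x hx _ => by simp [hB' x hx]) hij

end TypeD

end

section

namespace TypeD

variable {n r : ℕ} {f g : ℕ → ℤ}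

/-! Weights as functions on `{1, …, n}` -/

/-- The weight with the integral coordinates `f 1, …, f n`. -/
def toWt (n : ℕ) (f : ℕ → ℤ) : Wt n := fun x => ((x : ℤ).sign * f (x : ℤ).natAbs : ℤ)

lemma toWt_add (f g : ℕ → ℤ) : toWt n (f + g) = toWt n f + toWt n g := by
  ext x; simp [toWt, mul_add]

lemma toWt_neg (f : ℕ → ℤ) : toWt n (-f) = -toWt n f := by
  ext x; simp [toWt]

lemma toWt_sum {ι : Type*} (s : Finset ι) (f : ι → ℕ → ℤ) :
    toWt n (∑ k ∈ s, f k) = ∑ k ∈ s, toWt n (f k) := by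
  ext x; simp [toWt, Finset.mul_sum]

lemma toWt_of_pos (f : ℕ → ℤ) {x : Idx n} {k : ℕ} (h : (x : ℤ) = k) : toWt n f x = f k := by
  have h0 := x.ne_zero
  have : (x : ℤ).sign = 1 := Int.sign_eq_one_of_pos (by omega)
  rw [toWt, this, h]
  simp

lemma toWt_of_neg (f : ℕ → ℤ) {x : Idx n} {k : ℕ} (h : (x : ℤ) = -k) : toWt n f x = -f k := by
  have h0 := x.ne_zero
  have : (x : ℤ).sign = -1 := Int.sign_eq_neg_one_of_neg (by omega)
  rw [toWt, this, h]
  simp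

/-- An odd function on the indices is determined by the values at the positive indices. -/
lemma toWt_eq {l : Wt n} (hl : ∀ x, l x.opp = -l x) (h : ∀ (x : Idx n) (k : ℕ), (x : ℤ) = k → l x = f k) :
    toWt n f = l := by
  ext x
  have h0 := x.ne_zero
  rcases lt_or_gt_of_ne h0 with hx | hx
  · obtain ⟨k, hk⟩ := Int.eq_ofNat_of_zero_le (a := -(x : ℤ)) (by omega)
    rw [toWt_of_neg f (k := k) (by omega), ← h x.opp k (by simpa using hk), hl, neg_neg]
  · obtain ⟨k, hk⟩ := Int.eq_ofNat_of_zero_le (a := (x : ℤ)) (by omega)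
    rw [toWt_of_pos f hk, h x k hk]

lemma toWt_inj (hf : ∀ k, k = 0 ∨ n < k → f k = 0) (hg : ∀ k, k = 0 ∨ n < k → g k = 0) :
    toWt n f = toWt n g ↔ f = g := by
  refine ⟨fun h => funext fun k => ?_, fun h => h ▸ rfl⟩
  by_cases hk : k = 0 ∨ n < k
  · rw [hf k hk, hg k hk]
  · have := congrFun h (Idx.mk' k (by omega) (by omega) (by omega))
    rw [toWt_of_pos f (Idx.coe_mk' _ _ _ _), toWt_of_pos g (Idx.coe_mk' _ _ _ _)] at this
    exact_mod_cast this

lemma e_opp (k : ℤ) (hk : k ≠ 0) (x : Idx n) : e n k x.opp = -e n k x := by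
  have := x.coe_opp
  generalize x.opp = y at this ⊢
  simp only [e]
  split_ifs <;> first | omega | norm_num

lemma simpleRoot_opp {i : ℕ} (hi : 1 ≤ i) (x : Idx n) :
    simpleRoot n i x.opp = -simpleRoot n i x := by
  have : (simplePair i).1 ≠ 0 ∧ (simplePair i).2 ≠ 0 := by
    unfold simplePair
    split_ifs <;> simp <;> omega
  simp only [simpleRoot, Pi.sub_apply, e_opp _ this.1, e_opp _ this.2]
  ring

lemma toWt_rt {i : ℕ} (hi : 1 ≤ i) : toWt n (rt i) = simpleRoot n i := by
  refine toWt_eq (simpleRoot_opp hi) fun x k hk => ?_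
  have h0 := x.ne_zero
  simp only [simpleRoot, simplePair, rt, Pi.sub_apply, e, hk]
  split_ifs <;> simp only [] at * <;> first | omega | norm_num

lemma toWt_rtSum {p : ℕ} {i : Fin p → ℕ} (hi : ∀ k, 1 ≤ i k) :
    toWt n (rtSum i) = rootSum n i := by
  rw [rtSum, toWt_sum, rootSum]
  exact Finset.sum_congr rfl fun k _ => toWt_rt (hi k)

lemma toWt_vecHalf : toWt n vecHalf =
    (1 / 2 : ℝ) • simpleRoot n 1 + (1 / 2 : ℝ) • simpleRoot n 2 := by
  rw [← toWt_rt le_rfl, ← toWt_rt one_le_two]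
  ext x
  simp only [toWt, Pi.add_apply, Pi.smul_apply, smul_eq_mul, vecHalf, rt]
  split_ifs <;> first | omega | (push_cast; ring)

lemma toWt_vecHalf1 : toWt n vecHalf1 =
    (3 / 2 : ℝ) • simpleRoot n 1 + (1 / 2 : ℝ) • simpleRoot n 2 + simpleRoot n 3 := by
  rw [← toWt_rt le_rfl, ← toWt_rt one_le_two, ← toWt_rt (by norm_num)]
  ext x
  simp only [toWt, Pi.add_apply, Pi.smul_apply, smul_eq_mul, vecHalf1, rt]
  split_ifs <;> first | omega | (push_cast; ring)

lemma toWt_vecHalf2 : toWt n vecHalf2 =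
    (1 / 2 : ℝ) • simpleRoot n 1 + (3 / 2 : ℝ) • simpleRoot n 2 + simpleRoot n 3 := by
  rw [← toWt_rt le_rfl, ← toWt_rt one_le_two, ← toWt_rt (by norm_num)]
  ext x
  simp only [toWt, Pi.add_apply, Pi.smul_apply, smul_eq_mul, vecHalf2, rt]
  split_ifs <;> first | omega | (push_cast; ring)

/-! Nonnegative weights -/

/-- The conditions on the coordinates that say that a weight is nonnegative. -/
def NonnegCoord (n : ℕ) (f : ℕ → ℤ) : Prop :=
  (∀ k, 3 ≤ k → 0 ≤ ∑ x ∈ Finset.Icc k n, f x) ∧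
    0 ≤ ∑ x ∈ Finset.Icc 2 n, f x + f 1 ∧ 0 ≤ ∑ x ∈ Finset.Icc 2 n, f x - f 1

lemma sum_rt {i k : ℕ} (hi : 2 ≤ i) (hin : i ≤ n) :
    ∑ x ∈ Finset.Icc k n, rt i x = if k = i then 1 else 0 := by
  have : ∀ x ∈ Finset.Icc k n, rt i x = (if x = i then 1 else 0) - (if x = i - 1 then 1 else 0) := by
    intro x _
    rw [rt_of_two_le hi]
    split_ifs <;> first | omega | norm_num
  rw [Finset.sum_congr rfl this, Finset.sum_sub_distrib, Finset.sum_ite_eq', Finset.sum_ite_eq']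
  simp only [Finset.mem_Icc]
  split_ifs <;> first | omega | norm_num

lemma sum_rt_one {k : ℕ} (hk : 2 ≤ k) (hn : 2 ≤ n) :
    ∑ x ∈ Finset.Icc k n, rt 1 x = if k = 2 then 1 else 0 := by
  have : ∀ x ∈ Finset.Icc k n, rt 1 x = if x = 2 then 1 else 0 := by
    intro x hx
    rw [Finset.mem_Icc] at hx
    simp only [rt]
    split_ifs <;> omega
  rw [Finset.sum_congr rfl this, Finset.sum_ite_eq']
  simp only [Finset.mem_Icc]
  split_ifs <;> first | omega | norm_num

/-- The expressions in `NonnegCoord` are linear in the weight and nonnegative on every simple root.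
-/
lemma Nonneg.coord (hn : 2 ≤ n) (h : Nonneg (toWt n f)) : NonnegCoord n f := by
  obtain ⟨c, hc, hf⟩ := h
  have hx : ∀ x, 1 ≤ x → x ≤ n → (f x : ℝ) = ∑ i ∈ Finset.Icc 1 n, c i * rt i x := by
    intro x h1 h2
    have := congrFun hf (Idx.mk' x (by omega) (by omega) (by omega))
    rw [toWt_of_pos f (Idx.coe_mk' _ _ _ _), Finset.sum_apply] at this
    rw [this]
    refine Finset.sum_congr rfl fun i hi => ?_
    rw [Finset.mem_Icc] at hi
    rw [Pi.smul_apply, ← toWt_rt hi.1, toWt_of_pos _ (Idx.coe_mk' _ _ _ _), smul_eq_mul]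
  have hsum : ∀ k, 1 ≤ k → ((∑ x ∈ Finset.Icc k n, f x : ℤ) : ℝ) =
      ∑ i ∈ Finset.Icc 1 n, c i * (∑ x ∈ Finset.Icc k n, rt i x : ℤ) := by
    intro k hk
    push_cast
    simp only [Finset.mul_sum]
    rw [Finset.sum_comm]
    refine Finset.sum_congr rfl fun x hx' => ?_
    rw [Finset.mem_Icc] at hx'
    exact hx x (by omega) hx'.2
  have hS : ∀ i ∈ Finset.Icc 1 n, ∀ k, 2 ≤ k → (0 : ℤ) ≤ ∑ x ∈ Finset.Icc k n, rt i x := by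
    intro i hi k hk
    rw [Finset.mem_Icc] at hi
    by_cases h1 : i = 1
    · rw [h1, sum_rt_one hk hn]
      split_ifs <;> norm_num
    · rw [sum_rt (by omega) hi.2]
      split_ifs <;> norm_num
  have h12 : ∀ i ∈ Finset.Icc 1 n, (0 : ℤ) ≤ ∑ x ∈ Finset.Icc 2 n, rt i x + rt i 1 ∧
      (0 : ℤ) ≤ ∑ x ∈ Finset.Icc 2 n, rt i x - rt i 1 := by
    intro i hi
    rw [Finset.mem_Icc] at hi
    by_cases h1 : i = 1
    · rw [h1, sum_rt_one le_rfl hn]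
      simp [rt]
    · rw [sum_rt (by omega) hi.2, rt_of_two_le (by omega)]
      split_ifs <;> first | omega | norm_num
  refine ⟨fun k hk => ?_, ?_, ?_⟩
  · have : (0 : ℝ) ≤ ((∑ x ∈ Finset.Icc k n, f x : ℤ) : ℝ) := by
      rw [hsum k (by omega)]
      exact Finset.sum_nonneg fun i hi =>
        mul_nonneg (hc i) (by exact_mod_cast hS i hi k (by omega))
    exact_mod_cast this
  · have : (0 : ℝ) ≤ ((∑ x ∈ Finset.Icc 2 n, f x : ℤ) : ℝ) + f 1 := by
      rw [hsum 2 (by omega), hx 1 le_rfl (by omega), ← Finset.sum_add_distrib]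
      refine Finset.sum_nonneg fun i hi => ?_
      rw [← mul_add]
      exact mul_nonneg (hc i) (by exact_mod_cast (h12 i hi).1)
    exact_mod_cast this
  · have : (0 : ℝ) ≤ ((∑ x ∈ Finset.Icc 2 n, f x : ℤ) : ℝ) - f 1 := by
      rw [hsum 2 (by omega), hx 1 le_rfl (by omega), ← Finset.sum_sub_distrib]
      refine Finset.sum_nonneg fun i hi => ?_
      rw [← mul_sub]
      exact mul_nonneg (hc i) (by exact_mod_cast (h12 i hi).2)
    exact_mod_cast this

lemma sum_Icc_eq_add {k : ℕ} (hk : k ≤ n) (f : ℕ → ℤ) :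
    ∑ x ∈ Finset.Icc k n, f x = f k + ∑ x ∈ Finset.Icc (k + 1) n, f x := by
  rw [Finset.Icc_add_one_left_eq_Ioc, Finset.add_sum_Ioc_eq_sum_Icc hk]

lemma NonnegCoord.nonneg (hn : 2 ≤ n) (h : NonnegCoord n f) : Nonneg (toWt n f) := by
  set S : ℕ → ℝ := fun k => ((∑ x ∈ Finset.Icc k n, f x : ℤ) : ℝ) with hS
  have hSn : ∀ k, k ≤ n → S k = f k + S (k + 1) := by
    intro k hk
    simp only [hS]
    rw [sum_Icc_eq_add hk]
    push_cast
    ring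
  have hS0 : ∀ k, n < k → S k = 0 := by
    intro k hk
    simp [hS, Finset.Icc_eq_empty_of_lt hk]
  -- This solves `f 1 = c 1 - c 2`, `f 2 = c 1 + c 2 - c 3` and `f k = c k - c (k + 1)` for `k ≥ 3`.
  -- The value at 0 plays no role in the sum, but has to be nonnegative.
  set c : ℕ → ℝ := fun i => if i = 1 then (S 2 + f 1) / 2 else if i = 2 then (S 2 - f 1) / 2 else
    if i = 0 then 0 else S i with hcdef
  refine ⟨c, fun i => ?_, ?_⟩
  · have h1 : (0 : ℝ) ≤ S 2 + f 1 := by simp only [hS]; exact_mod_cast h.2.1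
    have h2 : (0 : ℝ) ≤ S 2 - f 1 := by simp only [hS]; exact_mod_cast h.2.2
    simp only [hcdef]
    split_ifs with c1 c2 c3
    · linarith
    · linarith
    · exact le_rfl
    · simp only [hS]; exact_mod_cast h.1 i (by omega)
  · have hopp : ∀ x : Idx n, (∑ i ∈ Finset.Icc 1 n, c i • simpleRoot n i) x.opp =
        -(∑ i ∈ Finset.Icc 1 n, c i • simpleRoot n i) x := by
      intro x
      rw [Finset.sum_apply, Finset.sum_apply, ← Finset.sum_neg_distrib]
      refine Finset.sum_congr rfl fun i hi => ?_
      rw [Finset.mem_Icc] at hi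
      rw [Pi.smul_apply, Pi.smul_apply, simpleRoot_opp hi.1, smul_neg]
    refine toWt_eq hopp fun x k hk => ?_
    have hk1 : 1 ≤ k := by have := x.ne_zero; omega
    have hkn : k ≤ n := by have := x.le_n; omega
    rw [Finset.sum_apply]
    have key : ∀ i ∈ Finset.Icc 1 n, (c i • simpleRoot n i) x =
        (if i = 1 then (if k ≤ 2 then c 1 else 0) else 0) +
          ((if i = k then (if k = 1 then 0 else c k) else 0) -
            (if i = k + 1 then c (k + 1) else 0)) := by
      intro i hi
      rw [Finset.mem_Icc] at hi
      rw [Pi.smul_apply, ← toWt_rt hi.1, toWt_of_pos _ hk, smul_eq_mul]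
      simp only [rt]
      split_ifs <;> first | omega | (subst_vars; push_cast; ring)
    rw [Finset.sum_congr rfl key, Finset.sum_add_distrib, Finset.sum_sub_distrib,
      Finset.sum_ite_eq', Finset.sum_ite_eq', Finset.sum_ite_eq']
    simp only [Finset.mem_Icc, hcdef]
    have e1 := hSn k hkn
    by_cases c1 : k = 1
    · subst c1
      norm_num [hn]
      split_ifs <;> first | omega | ring
    by_cases c2 : k = 2
    · subst c2
      have := hS0 3
      norm_num at e1
      norm_num [hn]
      split_ifs <;> first | (rw [this (by omega)] at e1; linarith) | (rw [e1]; ring) | omega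
    · have := hS0 (k + 1)
      split_ifs <;> first | contradiction | omega | linarith | (rw [this (by omega)] at e1; linarith)

lemma nonneg_toWt_iff (hn : 2 ≤ n) : Nonneg (toWt n f) ↔ NonnegCoord n f :=
  ⟨fun h => h.coord hn, fun h => h.nonneg hn⟩

lemma Nonneg.smul {l : Wt n} (h : Nonneg l) {κ : ℝ} (hκ : 0 ≤ κ) : Nonneg (κ • l) := by
  obtain ⟨c, hc, rfl⟩ := h
  refine ⟨fun i => κ * c i, fun i => mul_nonneg hκ (hc i), ?_⟩
  rw [Finset.smul_sum]
  exact Finset.sum_congr rfl fun i _ => smul_smul _ _ _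

lemma nonneg_smul_iff {l : Wt n} {κ : ℝ} (hκ : 0 < κ) : Nonneg (κ • l) ↔ Nonneg l := by
  refine ⟨fun h => ?_, fun h => h.smul hκ.le⟩
  have := h.smul (inv_nonneg.2 hκ.le)
  rwa [inv_smul_smul₀ hκ.ne'] at this

lemma ReflRel.sum {ε : ℤ} {a b : ℕ} (h : ReflRel n ε a b f g) (k : ℕ) :
    ∑ x ∈ Finset.Icc k n, g x = ∑ x ∈ Finset.Icc k n, f x +
      ((if k ≤ a then g a - f a else 0) + if k ≤ b then g b - f b else 0) := by
  have hlt := h.lt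
  have hle := h.le
  have : ∀ x ∈ Finset.Icc k n, g x = f x +
      ((if x = a then g a - f a else 0) + if x = b then g b - f b else 0) := by
    intro x _
    by_cases ha : x = a
    · subst ha
      rw [if_pos rfl, if_neg (by omega)]; ring
    by_cases hb : x = b
    · subst hb
      rw [if_neg ha, if_pos rfl]; ring
    · rw [if_neg ha, if_neg hb, h.other x ha hb]; ring
  rw [Finset.sum_congr rfl this, Finset.sum_add_distrib, Finset.sum_add_distrib,
    Finset.sum_ite_eq', Finset.sum_ite_eq']
  simp only [Finset.mem_Icc]
  congr 2 <;> split_ifs <;> first | rfl | omega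

/-- A nonnegative weight with entries `0`, `±1`, such that the simple reflections that lower it
lead to weights that are not nonnegative, is locally maximal. -/
lemma locallyMaximal_of_reflRel (hn : 2 ≤ n) (h0 : ∀ k, k = 0 ∨ n < k → f k = 0)
    (hf : ∀ x, f x = 0 ∨ f x = 1 ∨ f x = -1) (hnn : NonnegCoord n f)
    (h : ∀ ε a b, (ε = 1 ∧ b = a + 1 ∨ ε = -1 ∧ a = 1 ∧ b = 2) → 1 ≤ a → b ≤ n →
      ε * f a < f b → ∃ g, ReflRel n ε a b f g ∧ ¬ NonnegCoord n g) :
    LocallyMaximal n f fun k => ∑ x ∈ Finset.Icc k n, f x where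
  zero := h0 0 (.inl rfl)
  entry := hf
  vanish x hx := h0 x (.inr hx)
  sum_vanish x hx := by rw [Finset.Icc_eq_empty_of_lt hx, Finset.sum_empty]
  sum k hk := by
    by_cases hkn : k ≤ n
    · exact sum_Icc_eq_add hkn f
    · rw [Finset.Icc_eq_empty_of_lt (by omega), Finset.Icc_eq_empty_of_lt (by omega),
        h0 k (by omega), Finset.sum_empty, add_zero]
  nonneg := hnn.1
  nonneg_one := hnn.2.1
  nonneg_two := hnn.2.2
  -- The simple reflection changes only the coefficient of its own simple root. The other conditions
  -- persist, so nonnegativity can fail only at this coefficient; the same argument gives `max_two`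
  -- and `max`.
  max_one hlt := by
    obtain ⟨g, hg, hgn⟩ := h (-1) 1 2 (by omega) le_rfl hn (by omega)
    by_contra hc
    have := hg.left
    have := hg.right
    have := hnn.2.2
    refine hgn ⟨fun k hk => ?_, ?_, ?_⟩
    · rw [hg.sum, if_neg (by omega), if_neg (by omega)]
      simpa using hnn.1 k hk
    · rw [hg.sum, if_neg (by omega), if_pos le_rfl]; omega
    · rw [hg.sum, if_neg (by omega), if_pos le_rfl]; omega
  max_two hlt := by
    obtain ⟨g, hg, hgn⟩ := h 1 1 2 (by omega) le_rfl hn (by omega)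
    by_contra hc
    have := hg.left
    have := hg.right
    have := hnn.2.1
    refine hgn ⟨fun k hk => ?_, ?_, ?_⟩
    · rw [hg.sum, if_neg (by omega), if_neg (by omega)]
      simpa using hnn.1 k hk
    · rw [hg.sum, if_neg (by omega), if_pos le_rfl]; omega
    · rw [hg.sum, if_neg (by omega), if_pos le_rfl]; omega
  max k hk hlt := by
    by_cases hkn : k + 1 ≤ n
    · obtain ⟨g, hg, hgn⟩ := h 1 k (k + 1) (by omega) (by omega) hkn (by omega)
      by_contra hc
      have e1 := hg.left
      have e2 := hg.right
      have e3 := hnn.2.1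
      have e4 := hnn.2.2
      have e5 := hg.other 1 (by omega) (by omega)
      refine hgn ⟨fun l hl => ?_, ?_, ?_⟩
      · have := hnn.1 l hl
        by_cases hl1 : l = k + 1
        · rw [hg.sum, if_neg (by omega), if_pos (by omega), hl1]; omega
        · rw [hg.sum]
          split_ifs <;> omega
      · rw [hg.sum, if_pos hk, if_pos (by omega)]; omega
      · rw [hg.sum, if_pos hk, if_pos (by omega)]; omega
    -- For `k ≥ n` the suffix sum is empty, and the claim is the hypothesis `hlt`.
    · rw [h0 (k + 1) (by omega)] at hlt ⊢
      rw [Finset.Icc_eq_empty_of_lt (by omega), Finset.sum_empty]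
      exact hlt

/-! The weights `w(ω_r)` -/

/-- The factor that makes the fundamental weight integral. -/
def weightScale (r : ℕ) : ℝ := if r ≤ 2 then 2 else 1

lemma weightScale_pos : 0 < weightScale r := by
  unfold weightScale
  split_ifs <;> norm_num

/-- The fundamental weight, scaled to be integral. -/
def intWeight (n r : ℕ) (x : Idx n) : ℤ :=
  if r = 1 then (if 0 < (x : ℤ) then 1 else -1)
  else if r = 2 then (if 1 < (x : ℤ) ∨ (x : ℤ) = -1 then 1 else -1)
  else if (r : ℤ) ≤ x then 1 else if (x : ℤ) ≤ -r then -1 else 0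

lemma intWeight_eq (hr : 1 ≤ r) (x : Idx n) :
    (intWeight n r x : ℝ) = weightScale r * fundamentalWeight n r x := by
  rw [fundamentalWeight_apply hr]
  unfold intWeight weightScale
  split_ifs <;> first | omega | norm_num

lemma intWeight_opp (hr : 1 ≤ r) (x : Idx n) : intWeight n r x.opp = -intWeight n r x := by
  have : (intWeight n r x.opp : ℝ) = -intWeight n r x := by
    rw [intWeight_eq hr, intWeight_eq hr, fundamentalWeight_opp hr, mul_neg]
  exact_mod_cast this

lemma intWeight_le_iff (hr : 1 ≤ r) (x y : Idx n) :
    intWeight n r x ≤ intWeight n r y ↔ fundamentalWeight n r x ≤ fundamentalWeight n r y := by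
  rw [← mul_le_mul_iff_right₀ (weightScale_pos (r := r)), ← intWeight_eq hr, ← intWeight_eq hr,
    Int.cast_le]

lemma intWeight_lt_iff (hr : 1 ≤ r) (x y : Idx n) :
    intWeight n r x < intWeight n r y ↔ fundamentalWeight n r x < fundamentalWeight n r y := by
  rw [← not_le, ← not_le, intWeight_le_iff hr]

lemma intWeight_entry (x : Idx n) :
    intWeight n r x = 0 ∨ intWeight n r x = 1 ∨ intWeight n r x = -1 := by
  unfold intWeight
  split_ifs <;> norm_num

/-- The coordinates of the scaled weight `w(ω_r)`. -/
def wtFun (r : ℕ) (w : weylGroup n) (k : ℕ) : ℤ :=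
  if h : (k : ℤ) ≠ 0 ∧ (k : ℤ) ≤ n then
    intWeight n r (w.1⁻¹ (Idx.mk' k h.1 (by omega) h.2)) else 0

lemma wtFun_zero (w : weylGroup n) (k : ℕ) (hk : k = 0 ∨ n < k) : wtFun r w k = 0 :=
  dif_neg (by omega)

lemma wtFun_of_pos (w : weylGroup n) {x : Idx n} {k : ℕ} (h : (x : ℤ) = k) :
    wtFun r w k = intWeight n r (w.1⁻¹ x) := by
  have h0 := x.ne_zero
  have h1 := x.le_n
  rw [wtFun, dif_pos (by omega)]
  congr 2
  exact Subtype.ext h.symm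

lemma wtFun_of_neg (hr : 1 ≤ r) (w : weylGroup n) {x : Idx n} {k : ℕ} (h : (x : ℤ) = -k) :
    wtFun r w k = -intWeight n r (w.1⁻¹ x) := by
  rw [wtFun_of_pos w (x := x.opp) (by simp [h]), (weylGroup_isOdd w).inv, intWeight_opp hr]

lemma wtFun_entry (w : weylGroup n) (k : ℕ) :
    wtFun r w k = 0 ∨ wtFun r w k = 1 ∨ wtFun r w k = -1 := by
  unfold wtFun
  split_ifs
  · exact intWeight_entry _
  · exact .inl rfl

lemma toWt_wtFun (hr : 1 ≤ r) (w : weylGroup n) :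
    toWt n (wtFun r w) = weightScale r • act w (fundamentalWeight n r) := by
  refine toWt_eq (fun x => ?_) fun x k hk => ?_
  · simp only [Pi.smul_apply, act_apply, (weylGroup_isOdd w).inv x, fundamentalWeight_opp hr,
      smul_neg]
  · rw [wtFun_of_pos w hk, intWeight_eq hr]; rfl

lemma sign_mul_wtFun (hr : 1 ≤ r) (w : weylGroup n) {x : Idx n} {ε : ℤ} {k : ℕ}
    (hε : ε = 1 ∨ ε = -1) (h : (x : ℤ) = ε * k) : ε * wtFun r w k = intWeight n r (w.1⁻¹ x) := by
  rcases hε with rfl | rfl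
  · rw [one_mul] at h ⊢
    exact wtFun_of_pos w h
  · rw [wtFun_of_neg hr w (x := x) (by omega)]; ring

lemma reflRel_wtFun (hr : 1 ≤ r) (w : weylGroup n) {a b : Idx n} {ε : ℤ} {k l : ℕ}
    (hε : ε = 1 ∨ ε = -1) (ha : (a : ℤ) = ε * k) (hb : (b : ℤ) = l) (hkl : k < l) :
    ReflRel n ε k l (wtFun r w) (wtFun r (rf a b * w)) := by
  have ha0 := a.ne_zero
  have hbn := b.le_n
  have hεk : (a : ℤ) = k ∨ (a : ℤ) = -k := by rcases hε with rfl | rfl <;> omega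
  have hk1 : 1 ≤ k := by omega
  have hsq : ε * ε = 1 := by rcases hε with rfl | rfl <;> rfl
  have key : ∀ (x : Idx n), intWeight n r ((rf a b * w).1⁻¹ x) =
      intWeight n r (w.1⁻¹ (rootRefl a b x)) := fun x => by rw [rf_mul_inv_apply]
  refine ⟨hε, hk1, hkl, by omega, ?_, ?_, fun x hx hx' => ?_⟩
  · have h1 := sign_mul_wtFun hr (rf a b * w) hε ha
    rw [key, rootRefl_left (by omega) (by omega), ← wtFun_of_pos w hb] at h1
    rw [← h1, ← mul_assoc, hsq, one_mul]
  · rw [wtFun_of_pos _ hb, key, rootRefl_right (by omega) (by omega), sign_mul_wtFun hr w hε ha]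
  · by_cases hxn : x = 0 ∨ n < x
    · rw [wtFun_zero _ _ hxn, wtFun_zero _ _ hxn]
    · have hxi : ((Idx.mk' x (by omega) (by omega) (by omega) : Idx n) : ℤ) = x := rfl
      rw [wtFun_of_pos _ hxi, wtFun_of_pos _ hxi, key]
      congr 2
      rw [Idx.ext_iff', coe_rootRefl (by omega) (by omega), hxi, if_neg (by omega),
        if_neg (by omega), if_neg (by omega), if_neg (by omega)]

lemma ReflRel.unique {ε : ℤ} {a b : ℕ} {g' : ℕ → ℤ} (h : ReflRel n ε a b f g)
    (h' : ReflRel n ε a b f g') : g = g' := by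
  funext x
  by_cases ha : x = a
  · rw [ha, h.left, h'.left]
  by_cases hb : x = b
  · rw [hb, h.right, h'.right]
  · rw [h.other x ha hb, h'.other x ha hb]

lemma ReflRel.neg {ε : ℤ} {a b : ℕ} (h : ReflRel n ε a b f g) : ReflRel n ε a b (-f) (-g) :=
  ⟨h.sign, h.one_le, h.lt, h.le, by simp [h.left], by simp [h.right],
    fun x hx hx' => by simp [h.other x hx hx']⟩

lemma exists_idx_eq_mul {ε : ℤ} {a : ℕ} (hε : ε = 1 ∨ ε = -1) (ha : 1 ≤ a) (han : a ≤ n) :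
    ∃ x : Idx n, (x : ℤ) = ε * a := by
  rcases hε with rfl | rfl
  · exact ⟨Idx.mk' a (by omega) (by omega) (by omega), by simp⟩
  · exact ⟨Idx.mk' (-a) (by omega) (by omega) (by omega), by simp⟩

lemma exists_mul_eq_idx {a b : Idx n} (hab : (a : ℤ) < b) (hab' : 0 < (a : ℤ) + b) :
    ∃ (ε : ℤ) (k l : ℕ), (ε = 1 ∨ ε = -1) ∧ (a : ℤ) = ε * k ∧ (b : ℤ) = l ∧ k < l := by
  obtain ⟨l, hl⟩ := Int.eq_ofNat_of_zero_le (a := (b : ℤ)) (by omega)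
  rcases le_total 0 (a : ℤ) with h | h
  · obtain ⟨k, hk⟩ := Int.eq_ofNat_of_zero_le h
    exact ⟨1, k, l, .inl rfl, by omega, hl, by omega⟩
  · obtain ⟨k, hk⟩ := Int.eq_ofNat_of_zero_le (a := -(a : ℤ)) (by omega)
    exact ⟨-1, k, l, .inr rfl, by omega, hl, by omega⟩

lemma BruhatLE.chain (hr : 1 ≤ r) {v w : weylGroup n} (h : BruhatLE v w) :
    Chain n (wtFun r v) (wtFun r w) := by
  induction h with
  | refl => exact .refl
  | @tail u w _ hs ih =>
    obtain ⟨a, b, hab, hab', rfl, hlt⟩ := hs.exists_rf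
    obtain ⟨ε, k, l, hε, ha, hb, hkl⟩ := exists_mul_eq_idx hab hab'
    refine .tail ih ⟨ε, k, l, reflRel_wtFun hr u hε ha hb hkl, ?_⟩
    rw [sign_mul_wtFun hr u hε ha, wtFun_of_pos u hb, intWeight_le_iff hr]
    exact fundamentalWeight_mono hr hlt ((weylGroup_isOdd u).inv.add_ne hab'.ne')

/-- A strict inequality of the two coordinates forces the order of the indices under `u⁻¹`, so the
reflection is a Bruhat step. With equality the weight does not change and `u` itself serves. -/
lemma Step.exists_bruhatLE (hr : 1 ≤ r) {u : weylGroup n} (h : Step n (wtFun r u) g) :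
    ∃ y, BruhatLE u y ∧ wtFun r y = g := by
  obtain ⟨ε, k, l, h, hle⟩ := h
  have hk := h.one_le
  have hkl := h.lt
  have hl := h.le
  obtain ⟨a, ha⟩ := exists_idx_eq_mul (n := n) h.sign hk (by omega)
  obtain ⟨b, hb⟩ := exists_idx_eq_mul (n := n) (ε := 1) (a := l) (.inl rfl) (by omega) hl
  rw [one_mul] at hb
  have hak : (a : ℤ) = k ∨ (a : ℤ) = -k := by rcases h.sign with rfl | rfl <;> omega
  rcases hle.lt_or_eq with hlt | heq
  · refine ⟨rf a b * u, .single (bruhatStep_rf_mul u (by omega) (by omega) ?_),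
      (reflRel_wtFun hr u h.sign ha hb hkl).unique h⟩
    rw [sign_mul_wtFun hr u h.sign ha, wtFun_of_pos u hb, intWeight_lt_iff hr] at hlt
    exact fundamentalWeight_lt_imp hr ((weylGroup_isOdd u).inv.add_ne (by omega)) hlt
  · refine ⟨u, .refl, (ReflRel.unique ⟨h.sign, hk, hkl, hl, ?_, heq.symm, fun _ _ _ => rfl⟩ h)⟩
    rw [← heq]
    rcases h.sign with rfl | rfl <;> ring

/-- A chain lifts to some `y ≥ v` with `y(ω_r) = w(ω_r)`. As `v` is a minimal representative, `y`
may be replaced by `w` through `BruhatLE.of_act_eq`. -/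
lemma bruhatLE_iff_chain (hn : 2 ≤ n) (hr : 1 ≤ r) {v w : weylGroup n} (hv : v ∈ minReps n r) :
    BruhatLE v w ↔ Chain n (wtFun r v) (wtFun r w) := by
  refine ⟨fun h => h.chain hr, fun h => ?_⟩
  have key : ∀ g, Chain n (wtFun r v) g → ∃ y, BruhatLE v y ∧ wtFun r y = g := by
    intro g hg
    induction hg with
    | refl => exact ⟨v, .refl, rfl⟩
    | tail _ hs ih =>
      obtain ⟨y, hy, rfl⟩ := ih
      obtain ⟨z, hz, hzg⟩ := hs.exists_bruhatLE hr
      exact ⟨z, hy.trans hz, hzg⟩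
  obtain ⟨y, hy, hyw⟩ := key _ h
  refine hy.of_act_eq hn hr hv ?_
  have := toWt_wtFun hr y
  rw [hyw, toWt_wtFun hr w] at this
  exact (smul_right_injective _ weightScale_pos.ne' this).symm

/-- Induction along the generators: the coordinates of `w(ω_r)` arise from those of `ω_r` by
reflections. -/
lemma wtFun_invariant {α : Type*} (hr : 1 ≤ r) (F : (ℕ → ℤ) → α)
    (hF : ∀ f g ε a b, ReflRel n ε a b f g → F g = F f) (w : weylGroup n) :
    F (wtFun r w) = F (wtFun r (1 : weylGroup n)) := by
  have key : ∀ u : weylGroup n, F (wtFun r (w * u)) = F (wtFun r u) := by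
    obtain ⟨w, hw⟩ := w
    induction hw using Subgroup.closure_induction with
    | mem x hx =>
      intro u
      obtain ⟨i, -, hi1, hi2, a, b, hab, rfl⟩ := hx
      have hs : IsSimplePair i a b := ⟨hi1, hi2, hab⟩
      obtain ⟨ε, k, l, hε, ha, hb, hkl⟩ := exists_mul_eq_idx hs.lt hs.add_pos
      exact hF _ _ _ _ _ (reflRel_wtFun hr u hε ha hb hkl)
    | one => exact fun u => congrArg F (congrArg (wtFun r) (one_mul u))
    | mul x y hx hy ihx ihy =>
      intro u
      rw [← ihy u, ← ihx (⟨y, hy⟩ * u), ← mul_assoc]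
      rfl
    | inv x hx ih =>
      intro u
      rw [← ih (⟨x⁻¹, inv_mem hx⟩ * u), ← mul_assoc]
      have : (⟨x, hx⟩ * ⟨x⁻¹, inv_mem hx⟩ : weylGroup n) = 1 := Subtype.ext (mul_inv_cancel x)
      rw [this, one_mul]
  simpa using key 1

lemma sum_sq_wtFun_one (hr : 1 ≤ r) (hrn : r ≤ n) :
    ∑ x ∈ Finset.Icc 1 n, (wtFun r (1 : weylGroup n) x) ^ 2 =
      if r ≤ 2 then (n : ℤ) else (n : ℤ) + 1 - r := by
  have : ∀ x ∈ Finset.Icc 1 n, (wtFun r (1 : weylGroup n) x) ^ 2 =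
      if r ≤ 2 ∨ r ≤ x then 1 else 0 := by
    intro x hx
    rw [Finset.mem_Icc] at hx
    rw [wtFun_of_pos (x := Idx.mk' x (by omega) (by omega) (by omega)) _ rfl]
    simp only [OneMemClass.coe_one, inv_one, Equiv.Perm.one_apply, intWeight, Idx.coe_mk']
    split_ifs <;> first | omega | norm_num
  rw [Finset.sum_congr rfl this]
  split_ifs with h
  · simp [h]
  · simp only [h, false_or, ← Finset.sum_filter]
    rw [show (Finset.Icc 1 n).filter (fun x => r ≤ x) = Finset.Icc r n by
      ext x; simp only [Finset.mem_filter, Finset.mem_Icc]; omega]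
    simp
    omega

lemma sum_sq_wtFun (hr : 1 ≤ r) (hrn : r ≤ n) (w : weylGroup n) :
    ∑ x ∈ Finset.Icc 1 n, (wtFun r w x) ^ 2 = if r ≤ 2 then (n : ℤ) else (n : ℤ) + 1 - r := by
  rw [← sum_sq_wtFun_one hr hrn]
  exact wtFun_invariant hr (fun f => ∑ x ∈ Finset.Icc 1 n, (f x) ^ 2)
    (fun f g ε a b h => h.sum_sq) w

lemma prod_wtFun (hr : 1 ≤ r) (v w : weylGroup n) :
    ∏ x ∈ Finset.Icc 1 n, wtFun r v x = ∏ x ∈ Finset.Icc 1 n, wtFun r w x := by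
  have := wtFun_invariant (n := n) hr (fun f => ∏ x ∈ Finset.Icc 1 n, f x)
    (fun f g ε a b h => h.prod h.le)
  exact (this v).trans (this w).symm

/-! The extremal elements -/

lemma BruhatStep.ne {u w : weylGroup n} (h : BruhatStep u w) : u ≠ w := by
  rintro rfl
  exact lt_irrefl _ h.2

lemma exists_isSimplePair_of_mul {ε : ℤ} {a b : ℕ}
    (h : ε = 1 ∧ b = a + 1 ∨ ε = -1 ∧ a = 1 ∧ b = 2) (ha : 1 ≤ a) (hb : b ≤ n) :
    ∃ i, ∃ x y : Idx n, IsSimplePair i x y ∧ (x : ℤ) = ε * a ∧ (y : ℤ) = b ∧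
      (ε = 1 ∨ ε = -1) ∧ a < b := by
  have hε : ε = 1 ∨ ε = -1 := by omega
  obtain ⟨x, hx⟩ := exists_idx_eq_mul (n := n) hε ha (by omega)
  obtain ⟨y, hy⟩ := exists_idx_eq_mul (n := n) (ε := 1) (a := b) (.inl rfl) (by omega) hb
  rw [one_mul] at hy
  rcases h with ⟨rfl, rfl⟩ | ⟨rfl, rfl, rfl⟩
  · refine ⟨a + 1, x, y, ⟨by omega, hb, ?_⟩, hx, hy, hε, by omega⟩
    rw [simplePair, if_neg (by omega), hx, hy]
    push_cast
    simp
  · exact ⟨1, x, y, ⟨le_rfl, by omega, by simp [simplePair, hx, hy]⟩, hx, hy, hε, by omega⟩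

lemma nonneg_act_iff (hn : 2 ≤ n) (hr : 1 ≤ r) (v : weylGroup n) :
    Nonneg (act v (fundamentalWeight n r)) ↔ NonnegCoord n (wtFun r v) := by
  rw [← nonneg_toWt_iff hn, toWt_wtFun hr, nonneg_smul_iff weightScale_pos]

lemma nonneg_neg_act_iff (hn : 2 ≤ n) (hr : 1 ≤ r) (v : weylGroup n) :
    Nonneg (-act v (fundamentalWeight n r)) ↔ NonnegCoord n (-wtFun r v) := by
  rw [← nonneg_toWt_iff hn, toWt_neg, toWt_wtFun hr, ← smul_neg, nonneg_smul_iff weightScale_pos]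

/-- If a simple reflection `s` strictly lowers `v(ω_r)`, then `s v` is again a minimal
representative and `s v > v`. By maximality `s v(ω_r)` is not nonnegative, which is the local
condition. -/
lemma IsMaximalNonneg.hasForm (hn : 2 ≤ n) (hr : 1 ≤ r) {v : weylGroup n}
    (h : IsMaximalNonneg n r v) : HasForm n (wtFun r v) := by
  obtain ⟨hv, hnn, hmax⟩ := h
  refine LocallyMaximal.hasForm hn (locallyMaximal_of_reflRel hn (wtFun_zero v) (wtFun_entry v)
    ((nonneg_act_iff hn hr v).1 hnn) fun ε a b hab ha hb hlt => ?_)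
  obtain ⟨i, x, y, hs, hx, hy, hε, hab'⟩ := exists_isSimplePair_of_mul hab ha hb
  refine ⟨_, reflRel_wtFun hr v hε hx hy hab', fun hc => ?_⟩
  rw [sign_mul_wtFun hr v hε hx, wtFun_of_pos v hy, intWeight_lt_iff hr] at hlt
  have hstep : BruhatStep v (rf x y * v) := bruhatStep_rf_mul v hs.lt hs.add_pos.ne'
    (fundamentalWeight_lt_imp hr ((weylGroup_isOdd v).inv.add_ne hs.add_pos.ne') hlt)
  exact hstep.ne (hmax _ (rf_mul_mem_minReps hn hr hv hs (.inl hlt.ne))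
    ((nonneg_act_iff hn hr _).2 hc) (.single hstep)).symm

lemma IsMinimalNonpos.hasForm (hn : 2 ≤ n) (hr : 1 ≤ r) {w : weylGroup n}
    (h : IsMinimalNonpos n r w) : HasForm n (-wtFun r w) := by
  obtain ⟨hw, hnn, hmin⟩ := h
  refine LocallyMaximal.hasForm hn (locallyMaximal_of_reflRel hn
    (fun k hk => by rw [Pi.neg_apply, wtFun_zero w k hk, neg_zero])
    (fun k => by have := wtFun_entry (r := r) w k; rw [Pi.neg_apply]; omega)
    ((nonneg_neg_act_iff hn hr w).1 hnn) fun ε a b hab ha hb hlt => ?_)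
  obtain ⟨i, x, y, hs, hx, hy, hε, hab'⟩ := exists_isSimplePair_of_mul hab ha hb
  refine ⟨_, (reflRel_wtFun hr w hε hx hy hab').neg, fun hc => ?_⟩
  rw [Pi.neg_apply, Pi.neg_apply, mul_neg, neg_lt_neg_iff, sign_mul_wtFun hr w hε hx,
    wtFun_of_pos w hy, intWeight_lt_iff hr] at hlt
  have hlt' := fundamentalWeight_lt_imp hr
    ((weylGroup_isOdd w).inv.add_ne (x := y) (y := x) (by have := hs.add_pos; omega)) hlt
  have hstep : BruhatStep (rf x y * w) w := by
    have := bruhatStep_rf_mul (rf x y * w) hs.lt hs.add_pos.ne' (by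
      rw [rf_mul_inv_apply, rf_mul_inv_apply, rootRefl_left hs.lt.ne hs.add_pos.ne',
        rootRefl_right hs.lt.ne hs.add_pos.ne']
      exact hlt')
    rwa [rf_mul_cancel] at this
  exact hstep.ne (hmin _ (rf_mul_mem_minReps hn hr hw hs (.inr hlt'))
    ((nonneg_neg_act_iff hn hr _).2 hc) (.single hstep))

/-- For `r ≥ 3` the weight `v(ω_r)` is determined by its coordinates. -/
lemma hasWt_iff (hr : 3 ≤ r) {v : weylGroup n} (hv : v ∈ minReps n r) {l : Wt n}
    (hl : toWt n g = l) (hg : ∀ k, k = 0 ∨ n < k → g k = 0) : HasWt n r v l ↔ wtFun r v = g := by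
  rw [HasWt, and_iff_right hv, ← toWt_inj (wtFun_zero v) hg, hl, toWt_wtFun (by omega),
    weightScale, if_neg (by omega), one_smul]

end TypeD

end

/-! ### Classification of the pairs of extremal weights. -/

section

namespace TypeD

variable {n r p q s t : ℕ} {f g : ℕ → ℤ}

/-- Each root of the sequence contributes 2 to the sum of squares, so the parity of the total
separates the initial parts `0`, `rt 1`, `rt 2` from `vecHalf`, `vecHalf1`, `vecHalf2`; within
either class the total then fixes the length of the sequence. -/
lemma IsBase.sum_sq {B : ℕ → ℤ} (h : IsBase s B) : ∑ x ∈ Finset.Icc 1 (s - 2), (B x) ^ 2 = 0 ∧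
      s = 3 ∧ B = 0 ∨
    ∑ x ∈ Finset.Icc 1 (s - 2), (B x) ^ 2 = 2 ∧ s = 4 ∧ (B = rt 1 ∨ B = rt 2) ∨
    ∑ x ∈ Finset.Icc 1 (s - 2), (B x) ^ 2 = 1 ∧ s = 4 ∧ B = vecHalf ∨
    ∑ x ∈ Finset.Icc 1 (s - 2), (B x) ^ 2 = 3 ∧ s = 5 ∧ (B = vecHalf1 ∨ B = vecHalf2) := by
  rcases h with ⟨rfl, rfl⟩ | ⟨rfl, rfl | rfl | rfl⟩ | ⟨rfl, rfl | rfl⟩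
  · exact .inl ⟨by decide, rfl, rfl⟩
  · exact .inr (.inl ⟨by decide, rfl, .inl rfl⟩)
  · exact .inr (.inl ⟨by decide, rfl, .inr rfl⟩)
  · exact .inr (.inr (.inl ⟨by decide, rfl, rfl⟩))
  · exact .inr (.inr (.inr ⟨by decide, rfl, .inl rfl⟩))
  · exact .inr (.inr (.inr ⟨by decide, rfl, .inr rfl⟩))

lemma HasForm.even (h : HasForm n f) (hn : 3 ≤ n)
    (hd : ∑ x ∈ Finset.Icc 1 n, (f x) ^ 2 = 2 * q) :
    (∃ i ∈ J q 3 n, f = 0 + rtSum i) ∨ ∃ p B, q = p + 1 ∧ (B = rt 1 ∨ B = rt 2) ∧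
      ∃ i ∈ J p 4 n, f = B + rtSum i := by
  obtain ⟨s, B, p, i, hB, -, hi, rfl⟩ := h
  have hs := hB.le
  rw [sum_sq_add_rtSum (by omega) (by omega) hi fun x => hB.eq_zero] at hd
  rcases hB.sum_sq with ⟨e, rfl, rfl⟩ | ⟨e, rfl, hb⟩ | ⟨e, rfl, rfl⟩ | ⟨e, rfl, hb⟩ <;> rw [e] at hd
  · obtain rfl : p = q := by omega
    exact .inl ⟨i, hi, rfl⟩
  · exact .inr ⟨p, B, by omega, hb, i, hi, rfl⟩
  · omega
  · omega

lemma HasForm.odd (h : HasForm n f) (hn : 3 ≤ n)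
    (hd : ∑ x ∈ Finset.Icc 1 n, (f x) ^ 2 = 2 * q + 1) :
    (∃ i ∈ J q 4 n, f = vecHalf + rtSum i) ∨ ∃ p B, q = p + 1 ∧ (B = vecHalf1 ∨ B = vecHalf2) ∧
      ∃ i ∈ J p 5 n, f = B + rtSum i := by
  obtain ⟨s, B, p, i, hB, -, hi, rfl⟩ := h
  have hs := hB.le
  rw [sum_sq_add_rtSum (by omega) (by omega) hi fun x => hB.eq_zero] at hd
  rcases hB.sum_sq with ⟨e, rfl, rfl⟩ | ⟨e, rfl, hb⟩ | ⟨e, rfl, rfl⟩ | ⟨e, rfl, hb⟩ <;> rw [e] at hd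
  · omega
  · omega
  · obtain rfl : p = q := by omega
    exact .inl ⟨i, hi, rfl⟩
  · exact .inr ⟨p, B, by omega, hb, i, hi, rfl⟩

lemma IsBase.zero : IsBase 3 0 := .inl ⟨rfl, rfl⟩

lemma IsBase.rt {B : ℕ → ℤ} (h : B = rt 1 ∨ B = rt 2) : IsBase 4 B :=
  .inr (.inl ⟨rfl, h.imp_right .inl⟩)

lemma IsBase.half : IsBase 4 vecHalf := .inr (.inl ⟨rfl, .inr (.inr rfl)⟩)

lemma IsBase.half12 {B : ℕ → ℤ} (h : B = vecHalf1 ∨ B = vecHalf2) : IsBase 5 B :=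
  .inr (.inr ⟨rfl, h⟩)

lemma hasWt_base_add_iff (hn : 3 ≤ n) (hr : 3 ≤ r) {v : weylGroup n} (hv : v ∈ minReps n r)
    {B : ℕ → ℤ} (hB : IsBase s B) {b : Wt n} (hb : toWt n B = b) {i : Fin p → ℕ}
    (hi : i ∈ J p s n) : HasWt n r v (b + rootSum n i) ↔ wtFun r v = B + rtSum i := by
  have hs := hB.le
  refine hasWt_iff hr hv ?_ fun k hk => ?_
  · rw [toWt_add, hb, toWt_rtSum fun k => by have := (hi.1 k).1; omega]
  · rw [Pi.add_apply, rtSum_eq_zero (by omega) hi (by omega), add_zero]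
    rcases hk with rfl | hk
    · rcases hB with ⟨rfl, rfl⟩ | ⟨rfl, rfl | rfl | rfl⟩ | ⟨rfl, rfl | rfl⟩ <;> rfl
    · exact hB.eq_zero (by omega)

lemma hasWt_neg_base_add_iff (hn : 3 ≤ n) (hr : 3 ≤ r) {v : weylGroup n} (hv : v ∈ minReps n r)
    {B : ℕ → ℤ} (hB : IsBase s B) {b : Wt n} (hb : toWt n B = b) {i : Fin p → ℕ}
    (hi : i ∈ J p s n) : HasWt n r v (-(b + rootSum n i)) ↔ wtFun r v = -(B + rtSum i) := by
  have hs := hB.le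
  refine hasWt_iff hr hv ?_ fun k hk => ?_
  · rw [toWt_neg, toWt_add, hb, toWt_rtSum fun k => by have := (hi.1 k).1; omega]
  · rw [Pi.neg_apply, Pi.add_apply, rtSum_eq_zero (by omega) hi (by omega), add_zero, neg_eq_zero]
    rcases hk with rfl | hk
    · rcases hB with ⟨rfl, rfl⟩ | ⟨rfl, rfl | rfl | rfl⟩ | ⟨rfl, rfl | rfl⟩ <;> rfl
    · exact hB.eq_zero (by omega)

lemma Near.symm {i j : Fin p → ℕ} (h : Near i j) : Near j i := fun k => by
  rw [abs_sub_comm]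
  exact h k

/-! The existence of chains -/

lemma Chain.symm (h : Chain n f (-g)) : Chain n g (-f) := by
  have := h.neg
  rwa [neg_neg] at this

/-- Negating two coordinates keeps their product, which is 1 for `rt 1` and `-1` for `rt 2`;
therefore the labels agree. -/
lemma prod_rt_eq {B B' : ℕ → ℤ} (hB : B = rt 1 ∨ B = rt 2) (hB' : B' = rt 1 ∨ B' = rt 2)
    (h : ∏ x ∈ Finset.Icc 1 2, -B' x = ∏ x ∈ Finset.Icc 1 2, B x) : B = B' := by
  rcases hB with rfl | rfl <;> rcases hB' with rfl | rfl <;>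
    first | rfl | exact absurd h (by decide)

/-- Negating three coordinates changes the sign of their product; therefore the labels are opposite
here, in contrast to the even case. -/
lemma prod_vecHalf_eq {B B' : ℕ → ℤ} (hB : B = vecHalf1 ∨ B = vecHalf2)
    (hB' : B' = vecHalf1 ∨ B' = vecHalf2)
    (h : ∏ x ∈ Finset.Icc 1 3, -B' x = ∏ x ∈ Finset.Icc 1 3, B x) :
    B = vecHalf1 ∧ B' = vecHalf2 ∨ B = vecHalf2 ∧ B' = vecHalf1 := by
  rcases hB with rfl | rfl <;> rcases hB' with rfl | rfl <;>
    first | exact .inl ⟨rfl, rfl⟩ | exact .inr ⟨rfl, rfl⟩ | exact absurd h (by decide)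

lemma chain_rt_rt {B : ℕ → ℤ} (hn : 3 ≤ n) (hB : B = rt 1 ∨ B = rt 2) {i j : Fin p → ℕ}
    (hi : i ∈ J p 4 n) (hj : j ∈ J p 4 n) (hij : Near i j) :
    Chain n (B + rtSum i) (-(B + rtSum j)) := by
  refine chain_of_base (s := 4) (by norm_num) (by omega) ?_ hi hj
    (fun x => (IsBase.rt hB).eq_zero) hij
  rcases hB with rfl | rfl
  · exact chain_rt_one
  · exact chain_rt_two

lemma chain_zero_rt {B : ℕ → ℤ} (hB : B = rt 1 ∨ B = rt 2) {i : Fin (p + 1) → ℕ}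
    {j : Fin p → ℕ} (hi : i ∈ J (p + 1) 3 n) (hi0 : i 0 = 3) (hj : j ∈ J p 4 n)
    (hij : Near (Fin.tail i) j) : Chain n (0 + rtSum i) (-(B + rtSum j)) := by
  refine chain_of_base_tail (s := 3) le_rfl ?_ hi hi0 hj (fun x => (IsBase.rt hB).eq_zero) hij
  rw [zero_add]
  rcases hB with rfl | rfl
  · exact chain_rt_three_one
  · exact chain_rt_three_two

lemma chain_half_half12 {B : ℕ → ℤ} (hB : B = vecHalf1 ∨ B = vecHalf2) {i : Fin (p + 1) → ℕ}
    {j : Fin p → ℕ} (hi : i ∈ J (p + 1) 4 n) (hi0 : i 0 = 4) (hj : j ∈ J p 5 n)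
    (hij : Near (Fin.tail i) j) : Chain n (vecHalf + rtSum i) (-(B + rtSum j)) := by
  refine chain_of_base_tail (s := 4) (by norm_num) ?_ hi hi0 hj
    (fun x => (IsBase.half12 hB).eq_zero) hij
  rcases hB with rfl | rfl
  · exact chain_vecHalf_one
  · exact chain_vecHalf_two

lemma chain_half12 {B B' : ℕ → ℤ} (hn : 3 ≤ n)
    (hB : B = vecHalf1 ∧ B' = vecHalf2 ∨ B = vecHalf2 ∧ B' = vecHalf1) {i j : Fin p → ℕ}
    (hi : i ∈ J p 5 n) (hj : j ∈ J p 5 n) (hij : Near i j) :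
    Chain n (B + rtSum i) (-(B' + rtSum j)) := by
  refine chain_of_base (s := 5) (by norm_num) (by omega) ?_ hi hj (fun x => ?_) hij
  · rcases hB with ⟨rfl, rfl⟩ | ⟨rfl, rfl⟩
    · exact chain_vecHalf1
    · exact chain_vecHalf2
  · exact (IsBase.half12 (by tauto)).eq_zero

lemma chain_half_half (hn : 2 ≤ n) {i j : Fin p → ℕ} (hi : i ∈ J p 4 n) (hj : j ∈ J p 4 n)
    (hij : Near i j) : Chain n (vecHalf + rtSum i) (-(vecHalf + rtSum j)) :=
  chain_of_base (s := 4) (by norm_num) (by omega) chain_vecHalf hi hj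
    (fun _ => IsBase.half.eq_zero) hij

/-! The classification of the pairs for `3 ≤ r` -/

lemma chain_iff_evenList (hn : 3 ≤ n) (hr : 3 ≤ r) (hrn : r ≤ n) (hd : n + 1 = r + 2 * (p + 1))
    {v w : weylGroup n} (hv : IsMaximalNonneg n r v) (hw : IsMinimalNonpos n r w) :
    Chain n (wtFun r v) (wtFun r w) ↔ EvenList n r p v w := by
  have W0 : toWt n 0 = 0 := by ext x; simp [toWt]
  have W1 := toWt_rt (n := n) le_rfl
  have W2 := toWt_rt (n := n) one_le_two
  have V0 : ∀ i ∈ J (p + 1) 3 n, HasWt n r v (rootSum n i) ↔ wtFun r v = 0 + rtSum i := by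
    intro i hi
    rw [← hasWt_base_add_iff hn hr hv.1 .zero W0 hi, zero_add]
  have V0' : ∀ i ∈ J (p + 1) 3 n, HasWt n r w (-rootSum n i) ↔ wtFun r w = -(0 + rtSum i) := by
    intro i hi
    rw [← hasWt_neg_base_add_iff hn hr hw.1 .zero W0 hi, zero_add]
  have V1 := fun (i : Fin p → ℕ) hi =>
    hasWt_base_add_iff hn hr hv.1 (IsBase.rt (.inl rfl)) W1 (i := i) hi
  have V2 := fun (i : Fin p → ℕ) hi =>
    hasWt_base_add_iff hn hr hv.1 (IsBase.rt (.inr rfl)) W2 (i := i) hi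
  have V1' := fun (i : Fin p → ℕ) hi =>
    hasWt_neg_base_add_iff hn hr hw.1 (IsBase.rt (.inl rfl)) W1 (i := i) hi
  have V2' := fun (i : Fin p → ℕ) hi =>
    hasWt_neg_base_add_iff hn hr hw.1 (IsBase.rt (.inr rfl)) W2 (i := i) hi
  constructor
  · intro h
    have hfv := (hv.hasForm (by omega) (by omega)).even (q := p + 1) hn (by
      rw [sum_sq_wtFun (by omega) hrn, if_neg (by omega)]; push_cast; omega)
    have hfw := (hw.hasForm (by omega) (by omega)).even (q := p + 1) hn (by
      simp only [Pi.neg_apply, neg_sq]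
      rw [sum_sq_wtFun (by omega) hrn, if_neg (by omega)]; push_cast; omega)
    simp only [neg_eq_iff_eq_neg] at hfw
    rcases hfv with ⟨i, hi, hvi⟩ | ⟨p', B, hp, hB, i, hi, hvi⟩ <;>
      rcases hfw with ⟨j, hj, hwj⟩ | ⟨p'', B', hp', hB', j, hj, hwj⟩
    · refine .inl ⟨i, hi, j, hj, (V0 i hi).2 hvi, (V0' j hj).2 hwj, ?_⟩
      rw [hvi, hwj] at h
      exact h.near (by norm_num) hi (fun _ => IsBase.zero.eq_zero) hj fun _ => IsBase.zero.eq_zero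
    · obtain rfl : p = p'' := by omega
      refine .inr (.inl ⟨i, hi, j, hj, (V0 i hi).2 hvi, ?_, ?_⟩)
      · rw [V1' j hj, V2' j hj]
        rcases hB' with rfl | rfl
        · exact .inl hwj
        · exact .inr hwj
      · rw [hvi, hwj] at h
        exact h.near_tail (by norm_num) hi (fun _ => IsBase.zero.eq_zero) hj
          fun _ => (IsBase.rt hB').eq_zero
    · obtain rfl : p = p' := by omega
      refine .inr (.inr (.inl ⟨i, hi, j, hj, ?_, (V0' j hj).2 hwj, ?_⟩))
      · rw [V1 i hi, V2 i hi]
        rcases hB with rfl | rfl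
        · exact .inl hvi
        · exact .inr hvi
      · rw [hvi, hwj] at h
        have := h.symm.near_tail (by norm_num) hj (fun _ => IsBase.zero.eq_zero) hi
          fun _ => (IsBase.rt hB).eq_zero
        exact ⟨this.1.symm, this.2⟩
    · obtain rfl : p = p' := by omega
      obtain rfl : p = p'' := by omega
      rw [hvi, hwj] at h
      have hnear := h.near (by norm_num) hi (fun _ => (IsBase.rt hB).eq_zero) hj
        fun _ => (IsBase.rt hB').eq_zero
      have hprod := h.prod_base (by norm_num) hi (fun _ => (IsBase.rt hB).eq_zero) hj
        fun _ => (IsBase.rt hB').eq_zero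
      obtain rfl := prod_rt_eq hB hB' hprod
      refine .inr (.inr (.inr ⟨i, hi, j, hj, ?_, hnear⟩))
      rw [V1 i hi, V2 i hi, V1' j hj, V2' j hj]
      rcases hB with rfl | rfl
      · exact .inl ⟨hvi, hwj⟩
      · exact .inr ⟨hvi, hwj⟩
  · rintro (⟨i, hi, j, hj, hvi, hwj, h⟩ | ⟨i, hi, j, hj, hvi, hwj, h, h0⟩ |
      ⟨i, hi, j, hj, hvi, hwj, h, h0⟩ | ⟨i, hi, j, hj, hvw, h⟩)
    · rw [(V0 i hi).1 hvi, (V0' j hj).1 hwj]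
      exact chain_of_base (s := 3) le_rfl (by omega) (by rw [neg_zero]; exact .refl) hi hj
        (fun _ => IsBase.zero.eq_zero) h
    · rw [V1' j hj, V2' j hj] at hwj
      rw [(V0 i hi).1 hvi]
      rcases hwj with hwj | hwj <;> rw [hwj]
      · exact chain_zero_rt (.inl rfl) hi h0 hj h
      · exact chain_zero_rt (.inr rfl) hi h0 hj h
    · rw [V1 i hi, V2 i hi] at hvi
      rw [(V0' j hj).1 hwj]
      rcases hvi with hvi | hvi <;> rw [hvi]
      · exact (chain_zero_rt (.inl rfl) hj h0 hi h.symm).symm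
      · exact (chain_zero_rt (.inr rfl) hj h0 hi h.symm).symm
    · rw [V1 i hi, V2 i hi, V1' j hj, V2' j hj] at hvw
      rcases hvw with ⟨hvi, hwj⟩ | ⟨hvi, hwj⟩ <;> rw [hvi, hwj]
      · exact chain_rt_rt hn (.inl rfl) hi hj h
      · exact chain_rt_rt hn (.inr rfl) hi hj h

lemma chain_iff_oddList (hn : 3 ≤ n) (hr : 3 ≤ r) (hrn : r ≤ n)
    (hd : n + 1 = r + (2 * (p + 1) + 1)) {v w : weylGroup n} (hv : IsMaximalNonneg n r v)
    (hw : IsMinimalNonpos n r w) :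
    Chain n (wtFun r v) (wtFun r w) ↔ OddList n r p v w := by
  have V0 : ∀ i ∈ J (p + 1) 4 n, HasWt n r v (wtHalf n i) ↔ wtFun r v = vecHalf + rtSum i :=
    fun i hi => hasWt_base_add_iff hn hr hv.1 .half toWt_vecHalf hi
  have V0' : ∀ i ∈ J (p + 1) 4 n, HasWt n r w (-wtHalf n i) ↔ wtFun r w = -(vecHalf + rtSum i) :=
    fun i hi => hasWt_neg_base_add_iff hn hr hw.1 .half toWt_vecHalf hi
  have V1 : ∀ i ∈ J p 5 n, HasWt n r v (wtHalf1 n i) ↔ wtFun r v = vecHalf1 + rtSum i :=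
    fun i hi => hasWt_base_add_iff hn hr hv.1 (.half12 (.inl rfl)) toWt_vecHalf1 hi
  have V2 : ∀ i ∈ J p 5 n, HasWt n r v (wtHalf2 n i) ↔ wtFun r v = vecHalf2 + rtSum i :=
    fun i hi => hasWt_base_add_iff hn hr hv.1 (.half12 (.inr rfl)) toWt_vecHalf2 hi
  have V1' : ∀ i ∈ J p 5 n, HasWt n r w (-wtHalf1 n i) ↔ wtFun r w = -(vecHalf1 + rtSum i) :=
    fun i hi => hasWt_neg_base_add_iff hn hr hw.1 (.half12 (.inl rfl)) toWt_vecHalf1 hi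
  have V2' : ∀ i ∈ J p 5 n, HasWt n r w (-wtHalf2 n i) ↔ wtFun r w = -(vecHalf2 + rtSum i) :=
    fun i hi => hasWt_neg_base_add_iff hn hr hw.1 (.half12 (.inr rfl)) toWt_vecHalf2 hi
  constructor
  · intro h
    have hfv := (hv.hasForm (by omega) (by omega)).odd (q := p + 1) hn (by
      rw [sum_sq_wtFun (by omega) hrn, if_neg (by omega)]; push_cast; omega)
    have hfw := (hw.hasForm (by omega) (by omega)).odd (q := p + 1) hn (by
      simp only [Pi.neg_apply, neg_sq]
      rw [sum_sq_wtFun (by omega) hrn, if_neg (by omega)]; push_cast; omega)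
    simp only [neg_eq_iff_eq_neg] at hfw
    rcases hfv with ⟨i, hi, hvi⟩ | ⟨p', B, hp, hB, i, hi, hvi⟩ <;>
      rcases hfw with ⟨j, hj, hwj⟩ | ⟨p'', B', hp', hB', j, hj, hwj⟩
    · refine .inl ⟨i, hi, j, hj, (V0 i hi).2 hvi, (V0' j hj).2 hwj, ?_⟩
      rw [hvi, hwj] at h
      exact h.near (by norm_num) hi (fun _ => IsBase.half.eq_zero) hj fun _ => IsBase.half.eq_zero
    · obtain rfl : p = p'' := by omega
      refine .inr (.inl ⟨i, hi, j, hj, (V0 i hi).2 hvi, ?_, ?_⟩)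
      · rw [V1' j hj, V2' j hj]
        rcases hB' with rfl | rfl
        · exact .inl hwj
        · exact .inr hwj
      · rw [hvi, hwj] at h
        exact h.near_tail (by norm_num) hi (fun _ => IsBase.half.eq_zero) hj
          fun _ => (IsBase.half12 hB').eq_zero
    · obtain rfl : p = p' := by omega
      refine .inr (.inr (.inl ⟨i, hi, j, hj, ?_, (V0' j hj).2 hwj, ?_⟩))
      · rw [V1 i hi, V2 i hi]
        rcases hB with rfl | rfl
        · exact .inl hvi
        · exact .inr hvi
      · rw [hvi, hwj] at h
        have := h.symm.near_tail (by norm_num) hj (fun _ => IsBase.half.eq_zero) hi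
          fun _ => (IsBase.half12 hB).eq_zero
        exact ⟨this.1.symm, this.2⟩
    · obtain rfl : p = p' := by omega
      obtain rfl : p = p'' := by omega
      rw [hvi, hwj] at h
      have hnear := h.near (by norm_num) hi (fun _ => (IsBase.half12 hB).eq_zero) hj
        fun _ => (IsBase.half12 hB').eq_zero
      have hprod := h.prod_base (by norm_num) hi (fun _ => (IsBase.half12 hB).eq_zero) hj
        fun _ => (IsBase.half12 hB').eq_zero
      refine .inr (.inr (.inr ⟨i, hi, j, hj, ?_, hnear⟩))
      rw [V1 i hi, V2 i hi, V1' j hj, V2' j hj]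
      rcases prod_vecHalf_eq hB hB' hprod with ⟨rfl, rfl⟩ | ⟨rfl, rfl⟩
      · exact .inl ⟨hvi, hwj⟩
      · exact .inr ⟨hvi, hwj⟩
  · rintro (⟨i, hi, j, hj, hvi, hwj, h⟩ | ⟨i, hi, j, hj, hvi, hwj, h, h0⟩ |
      ⟨i, hi, j, hj, hvi, hwj, h, h0⟩ | ⟨i, hi, j, hj, hvw, h⟩)
    · rw [(V0 i hi).1 hvi, (V0' j hj).1 hwj]
      exact chain_half_half (by omega) hi hj h
    · rw [V1' j hj, V2' j hj] at hwj
      rw [(V0 i hi).1 hvi]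
      rcases hwj with hwj | hwj <;> rw [hwj]
      · exact chain_half_half12 (.inl rfl) hi h0 hj h
      · exact chain_half_half12 (.inr rfl) hi h0 hj h
    · rw [V1 i hi, V2 i hi] at hvi
      rw [(V0' j hj).1 hwj]
      rcases hvi with hvi | hvi <;> rw [hvi]
      · exact (chain_half_half12 (.inl rfl) hj h0 hi h.symm).symm
      · exact (chain_half_half12 (.inr rfl) hj h0 hi h.symm).symm
    · rw [V1 i hi, V2 i hi, V1' j hj, V2' j hj] at hvw
      rcases hvw with ⟨hvi, hwj⟩ | ⟨hvi, hwj⟩ <;> rw [hvi, hwj]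
      · exact chain_half12 hn (.inl ⟨rfl, rfl⟩) hi hj h
      · exact chain_half12 hn (.inr ⟨rfl, rfl⟩) hi hj h

/-! The minuscule cases -/

lemma J.le_apply {i : Fin p → ℕ} (hi : i ∈ J p s t) (k : Fin p) : s + 2 * k ≤ i k := by
  obtain ⟨k, hk⟩ := k
  induction k with
  | zero => simpa using (hi.1 ⟨0, hk⟩).1
  | succ k ih =>
    have := ih (by omega)
    have := hi.2 ⟨k, by omega⟩ ⟨k + 1, hk⟩ rfl
    simp only at *
    omega

lemma J.apply_le {i : Fin p → ℕ} (hi : i ∈ J p s t) (d : ℕ) (k : Fin p) (hk : k + d + 1 = p) :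
    i k + 2 * d ≤ t := by
  induction d generalizing k with
  | zero => simpa using (hi.1 k).2
  | succ d ih =>
    have := ih ⟨k + 1, by omega⟩ (by simp only; omega)
    have := hi.2 k ⟨k + 1, by omega⟩ rfl
    omega

/-- A sequence that fills the interval is unique. -/
lemma J.apply_eq {i : Fin p → ℕ} (hi : i ∈ J p s t) (ht : t + 2 = s + 2 * p) (k : Fin p) :
    i k = s + 2 * k := by
  have h1 := J.le_apply hi k
  have h2 := J.apply_le hi (p - k - 1) k (by omega)
  omega

lemma J.le_length {i : Fin p → ℕ} (hi : i ∈ J p s t) (hp : p ≠ 0) : s + 2 * p ≤ t + 2 := by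
  have h1 := J.le_apply hi ⟨0, by omega⟩
  have h2 := J.apply_le hi (p - 1) ⟨0, by omega⟩ (by simp only; omega)
  omega

lemma J.eq_of_full {i j : Fin p → ℕ} (hi : i ∈ J p s t) (hj : j ∈ J p s t)
    (ht : t + 2 = s + 2 * p) : i = j :=
  funext fun k => by rw [J.apply_eq hi ht, J.apply_eq hj ht]

lemma near_refl (i : Fin p → ℕ) : Near i i := fun k => by simp

/-- If the sequence fills the interval, then the products of the coordinates determine the products
of the coordinates of the initial parts. -/
lemma prod_base_of_full {B B' : ℕ → ℤ} {i : Fin p → ℕ} (hs : 2 ≤ s) (hi : i ∈ J p s n)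
    (hn : n + 2 = s + 2 * p) (hB : ∀ x, s ≤ x + 1 → B x = 0) (hB' : ∀ x, s ≤ x + 1 → B' x = 0)
    (h : ∏ x ∈ Finset.Icc 1 n, (B + rtSum i) x = ∏ x ∈ Finset.Icc 1 n, (-(B' + rtSum i)) x)
    (h0 : ∏ x ∈ Finset.Icc 1 n, (B + rtSum i) x ≠ 0) :
    ∏ x ∈ Finset.Icc 1 (s - 2), -B' x = ∏ x ∈ Finset.Icc 1 (s - 2), B x := by
  have hsplit : ∀ F : ℕ → ℤ, ∏ x ∈ Finset.Icc 1 n, F x =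
      (∏ x ∈ Finset.Icc 1 (s - 2), F x) * ∏ x ∈ Finset.Icc (s - 1) n, F x := by
    intro F
    rw [← Finset.prod_union]
    · congr 1
      ext x
      simp only [Finset.mem_Icc, Finset.mem_union]
      omega
    · rw [Finset.disjoint_left]
      intro x
      simp only [Finset.mem_Icc]
      omega
  have e1 : ∏ x ∈ Finset.Icc 1 (s - 2), (B + rtSum i) x = ∏ x ∈ Finset.Icc 1 (s - 2), B x := by
    refine Finset.prod_congr rfl fun x hx => ?_
    rw [Finset.mem_Icc] at hx
    simp [rtSum_eq_zero hs hi (x := x) (by omega)]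
  have e2 : ∏ x ∈ Finset.Icc 1 (s - 2), (-(B' + rtSum i)) x =
      ∏ x ∈ Finset.Icc 1 (s - 2), -B' x := by
    refine Finset.prod_congr rfl fun x hx => ?_
    rw [Finset.mem_Icc] at hx
    simp [rtSum_eq_zero hs hi (x := x) (by omega)]
  have e3 : ∏ x ∈ Finset.Icc (s - 1) n, (B + rtSum i) x =
      ∏ x ∈ Finset.Icc (s - 1) n, rtSum i x := by
    refine Finset.prod_congr rfl fun x hx => ?_
    rw [Finset.mem_Icc] at hx
    simp [hB x (by omega)]
  have e4 : ∏ x ∈ Finset.Icc (s - 1) n, (-(B' + rtSum i)) x =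
      ∏ x ∈ Finset.Icc (s - 1) n, rtSum i x := by
    have : ∏ x ∈ Finset.Icc (s - 1) n, (-(B' + rtSum i)) x =
        ∏ x ∈ Finset.Icc (s - 1) n, -rtSum i x := by
      refine Finset.prod_congr rfl fun x hx => ?_
      rw [Finset.mem_Icc] at hx
      simp [hB' x (by omega)]
    -- The interval `[s - 1, n]` has `2 * p` elements, so the signs cancel.
    rw [this, Finset.prod_neg, Nat.card_Icc, Even.neg_one_pow ⟨p, by omega⟩, one_mul]
  rw [hsplit, e1, e3] at h0
  rw [hsplit, hsplit, e1, e2, e3, e4] at h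
  exact (mul_right_cancel₀ (right_ne_zero_of_mul h0) h).symm

/-- All coordinates of the scaled weights are `±1`, so the sum of squares is `n`. This leaves room
only for the larger initial parts, and the sequence must fill the remaining interval; it is the same
for `v` and `w`. The product of all coordinates is constant on the Weyl group orbit and leaves
exactly the combinations of initial parts that a chain joins. -/
lemma chain_of_le_two (hn : 4 ≤ n) (hr : 1 ≤ r) (hr2 : r ≤ 2) {v w : weylGroup n}
    (hv : IsMaximalNonneg n r v) (hw : IsMinimalNonpos n r w) :
    Chain n (wtFun r v) (wtFun r w) := by
  have hsv := sum_sq_wtFun hr (by omega) v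
  have hsw := sum_sq_wtFun hr (by omega) w
  rw [if_pos hr2] at hsv hsw
  have hsw' : ∑ x ∈ Finset.Icc 1 n, ((-wtFun r w) x) ^ 2 = n := by
    simpa only [Pi.neg_apply, neg_sq] using hsw
  have hprod := prod_wtFun hr v w
  have h0 : ∏ x ∈ Finset.Icc 1 n, wtFun r v x ≠ 0 := by
    rw [Finset.prod_ne_zero_iff]
    intro x hx
    rw [Finset.mem_Icc] at hx
    rw [wtFun_of_pos (x := Idx.mk' x (by omega) (by omega) (by omega)) _ rfl, intWeight]
    split_ifs <;> first | omega | norm_num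
  obtain ⟨q, hq | hq⟩ := Nat.even_or_odd' n
  · have hfv := (hv.hasForm (by omega) hr).even (q := q) (by omega) (by rw [hsv]; omega)
    have hfw := (hw.hasForm (by omega) hr).even (q := q) (by omega) (by rw [hsw']; omega)
    simp only [neg_eq_iff_eq_neg] at hfw
    rcases hfv with ⟨i, hi, -⟩ | ⟨p, B, rfl, hB, i, hi, hvi⟩
    · have := J.le_length hi (by omega)
      omega
    rcases hfw with ⟨j, hj, -⟩ | ⟨p', B', hp, hB', j, hj, hwj⟩
    · have := J.le_length hj (by omega)
      omega
    obtain rfl : p = p' := by omega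
    obtain rfl := J.eq_of_full hi hj (by omega)
    rw [hvi] at h0 hprod
    rw [hwj] at hprod
    obtain rfl := prod_rt_eq hB hB' (prod_base_of_full (by norm_num) hi (by omega)
      (fun _ => (IsBase.rt hB).eq_zero) (fun _ => (IsBase.rt hB').eq_zero) hprod h0)
    rw [hvi, hwj]
    exact chain_rt_rt (by omega) hB hi hi (near_refl i)
  · have hfv := (hv.hasForm (by omega) hr).odd (q := q) (by omega) (by rw [hsv]; omega)
    have hfw := (hw.hasForm (by omega) hr).odd (q := q) (by omega) (by rw [hsw']; omega)
    simp only [neg_eq_iff_eq_neg] at hfw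
    rcases hfv with ⟨i, hi, -⟩ | ⟨p, B, rfl, hB, i, hi, hvi⟩
    · have := J.le_length hi (by omega)
      omega
    rcases hfw with ⟨j, hj, -⟩ | ⟨p', B', hp, hB', j, hj, hwj⟩
    · have := J.le_length hj (by omega)
      omega
    obtain rfl : p = p' := by omega
    obtain rfl := J.eq_of_full hi hj (by omega)
    rw [hvi] at h0 hprod
    rw [hwj] at hprod
    have := prod_vecHalf_eq hB hB' (prod_base_of_full (by norm_num) hi (by omega)
      (fun _ => (IsBase.half12 hB).eq_zero) (fun _ => (IsBase.half12 hB').eq_zero) hprod h0)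
    rw [hvi, hwj]
    exact chain_half12 (by omega) this hi hi (near_refl i)

/-- The sum of squares is 1, so the sequences are empty and both initial parts are `vecHalf`. -/
lemma chain_of_eq (hn : 4 ≤ n) {v w : weylGroup n} (hv : IsMaximalNonneg n n v)
    (hw : IsMinimalNonpos n n w) : Chain n (wtFun n v) (wtFun n w) := by
  have hsv := sum_sq_wtFun (by omega) le_rfl v
  have hsw := sum_sq_wtFun (by omega) le_rfl w
  rw [if_neg (by omega)] at hsv hsw
  have hfv := (hv.hasForm (by omega) (by omega)).odd (q := 0) (by omega) (by rw [hsv]; simp)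
  have hfw := (hw.hasForm (by omega) (by omega)).odd (q := 0) (by omega) (by
    simp only [Pi.neg_apply, neg_sq]; rw [hsw]; simp)
  simp only [neg_eq_iff_eq_neg] at hfw
  rcases hfv with ⟨i, hi, hvi⟩ | ⟨p, B, hp, -⟩
  · rcases hfw with ⟨j, hj, hwj⟩ | ⟨p, B, hp, -⟩
    · rw [hvi, hwj]
      exact chain_half_half (by omega) hi hj fun k => k.elim0
    · omega
  · omega

end TypeD

end

end

theorem proposition5p4 (K : Type*) [Field K] [IsAlgClosed K] (n r : ℕ) (hn : 4 ≤ n)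
    (hr : 1 ≤ r) (hrn : r ≤ n) (v w : TypeD.weylGroup n)
    (hv : TypeD.IsMaximalNonneg n r v) (hw : TypeD.IsMinimalNonpos n r w) :
    ((TypeD.richardson K n r v w).Nonempty ↔ TypeD.BruhatLE v w) ∧
    (∀ p : ℕ, 3 ≤ r → r < n → n + 1 = r + 2 * (p + 1) →
      ((TypeD.richardson K n r v w).Nonempty ↔ TypeD.EvenList n r p v w)) ∧
    (∀ p : ℕ, 3 ≤ r → r < n → n + 1 = r + (2 * (p + 1) + 1) →
      ((TypeD.richardson K n r v w).Nonempty ↔ TypeD.OddList n r p v w)) ∧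
    (r = 1 ∨ r = 2 ∨ r = n → (TypeD.richardson K n r v w).Nonempty) := by
  have hR : (TypeD.richardson K n r v w).Nonempty ↔ TypeD.BruhatLE v w :=
    TypeD.richardson_nonempty_iff (by omega) hr hv.1
  have hC : TypeD.BruhatLE v w ↔ TypeD.Chain n (TypeD.wtFun r v) (TypeD.wtFun r w) :=
    TypeD.bruhatLE_iff_chain (by omega) hr hv.1
  refine ⟨hR, fun p h3 _ hd => ?_, fun p h3 _ hd => ?_, fun h => ?_⟩
  · rw [hR, hC, TypeD.chain_iff_evenList (by omega) h3 hrn hd hv hw]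
  · rw [hR, hC, TypeD.chain_iff_oddList (by omega) h3 hrn hd hv hw]
  · rw [hR, hC]
    rcases h with rfl | rfl | rfl
    · exact TypeD.chain_of_le_two hn hr (by norm_num) hv hw
    · exact TypeD.chain_of_le_two hn hr le_rfl hv hw
    · exact TypeD.chain_of_eq hn hv hw
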